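/- A weighted tree $(T,w)$ consists of a rooted tree $T$ with leaf set $\mathcal L$ and a function $w : T \to \mathbb{R}_{\ge 0}$ on its vertices such that $w(v)=0$ for every leaf $v$ and $w(v) < w(p(v))$ for every non-root vertex $v$ with parent $p(v)$. It induces the distance $\delta_{\mathcal T}(x,y) = w(\mathrm{lca}(x,y))$ on $\mathcal L$, where $\mathrm{lca}(x,y)$ is the least common ancestor. For $\alpha>1$, an $\alpha$-HSBT over a finite set $V$ is a weighted tree $(T,w)$ with leaf set $V$ such that $T$ is a full binary tree (every internal vertex has exactly two children) and $w(p(v)) \ge \alpha\, w(v)$ for every non-root vertex $v$. The height of $T$ is the maximal depth, in hops, of a leaf. Theorem. There are universal constants $c, C > 0$ such that the following holds. Let $n \ge 2$, let $(V,\delta)$ be an $n$-point metric space, and let $\Delta = \max_{x \ne y}\delta(x,y) / \min_{x\neq y}\delta(x,y)$ be its aspect ratio. Let $\mathcal U$ be the set of all $(1 + c/\log n)$-HSBTs $(T,w)$ over $V$ with $\mathrm{height}(T) \le C(\log \Delta + \log n)$ whose distance functions dominate $\delta$, that is, $\delta_{\mathcal T}(x,y) \ge \delta(x,y)$ for all $x,y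 \in V$. Then there is a probability distribution $\mathcal P$ over $\mathcal U$ such that $$\mathbb{E}_{\mathcal T \sim \mathcal P}[\delta_{\mathcal T}(x,y)] \le C \log n \cdot \delta(x,y) \qquad \text{for all } x,y\in V.$$ Moreover, $\mathcal P$ can be sampled efficiently: there is a single randomized algorithm (a fixed program for a real random access machine that can draw uniformly random integers from finite ranges $\{0,\dots,m\}$, with unit cost per operation) that, given $n$ and the $n \times n$ distance matrix of $(V,\delta)$ with respect to an arbitrary enumeration of $V$, always halts within a number of steps polynomial in $n + \lceil\log \Delta\rceil$ and outputs a tree distributed exactly according to such a distribution $\mathcal P$ (which may depend on the enumeration). -/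

import Mathlib

/-! ## Weighted full binary trees and the metrics they induce -/

/-- A finite rooted full binary tree whose leaves are labelled by points of `V` and whose internal
vertices carry real weights.  Leaves have weight `0`.  A vertex of the tree is identified with the
subtree rooted at it. -/
inductive BinTree (V : Type*) where
  | leaf (x : V) : BinTree V
  | node (w : ℝ) (l r : BinTree V) : BinTree V

namespace BinTree

variable {V : Type*}

/-- The weight of the root; leaves have weight `0`. -/
def weight : BinTree V → ℝ
  | leaf _ => 0
  | node w _ _ => w

/-- The leaf labels, from left to right. -/
def leaves : BinTree V → List V
  | leaf x => [x]
  | node _ l r => l.leaves ++ r.leaves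

/-- The maximal depth (in hops) of a leaf. -/
def height : BinTree V → ℕ
  | leaf _ => 0
  | node _ l r => max l.height r.height + 1

/-- The leaves of the tree are precisely the points of `V`, each occurring exactly once. -/
def IsOver (T : BinTree V) : Prop :=
  T.leaves.Nodup ∧ ∀ x : V, x ∈ T.leaves

/-- Weights are nonnegative, and each non-root vertex has weight smaller than its parent. -/
def IsWeighted : BinTree V → Prop
  | leaf _ => True
  | node w l r => 0 ≤ w ∧ l.weight < w ∧ r.weight < w ∧ l.IsWeighted ∧ r.IsWeighted

/-- Each non-root vertex `v` with parent `p` satisfies `w p ≥ α * w v`. -/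
def IsSeparated (α : ℝ) : BinTree V → Prop
  | leaf _ => True
  | node w l r =>
      α * l.weight ≤ w ∧ α * r.weight ≤ w ∧ l.IsSeparated α ∧ r.IsSeparated α

open Classical in
/-- The least common ancestor of the leaves `x` and `y`
(meaningful when both are leaves of the tree and labels are not repeated). -/
noncomputable def lca (x y : V) : BinTree V → BinTree V
  | leaf z => leaf z
  | node w l r =>
      if x ∈ l.leaves ∧ y ∈ l.leaves then l.lca x y
      else if x ∈ r.leaves ∧ y ∈ r.leaves then r.lca x y
      else node w l r

/-- The distance induced on the leaves: the weight of the least common ancestor. -/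
noncomputable def treeDist (T : BinTree V) (x y : V) : ℝ :=
  (T.lca x y).weight

/-- Hierarchically separated (full) binary trees over `V` with parameter `α`. -/
structure IsHSBT (α : ℝ) (T : BinTree V) : Prop where
  isOver : T.IsOver
  isWeighted : T.IsWeighted
  isSeparated : T.IsSeparated α

/-- The `α`-HSBTs over the metric space `V` of height at most `h` whose distance function
dominates the metric of `V`. -/
def dominatingHSBTs (V : Type*) [MetricSpace V] (α h : ℝ) : Set (BinTree V) :=
  {T | T.IsHSBT α ∧ (T.height : ℝ) ≤ h ∧ ∀ x y : V, dist x y ≤ T.treeDist x y}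

end BinTree

/-- The aspect ratio: the maximal distance divided by the minimal distance of distinct points. -/
noncomputable def aspectRatio (V : Type*) [MetricSpace V] : ℝ :=
  Metric.diam (Set.univ : Set V) / Set.infsep (Set.univ : Set V)

/-! ## A randomized real random access machine with a step count -/

namespace RealRAM

/-- Output symbols.  A tree is written in prefix (Polish) notation. -/
inductive Symbol where
  | leaf (i : ℕ) : Symbol
  | node (w : ℝ) : Symbol

/-- Machine instructions.  `N` is an infinite array of natural numbers, `R` an infinite array of
real numbers, `D` is the read-only input matrix.  Arguments are constants of the program.
There is no rounding of reals, and the only arithmetic on naturals is `+` and `-`. -/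
inductive Instr where
  /-- `N[a] := k` -/
  | const (a k : ℕ)
  /-- `N[a] := N[b] + N[c]` -/
  | add (a b c : ℕ)
  /-- `N[a] := N[b] - N[c]`, truncated at `0` -/
  | sub (a b c : ℕ)
  /-- `N[a] := N[N[b]]` -/
  | load (a b : ℕ)
  /-- `N[N[a]] := N[b]` -/
  | store (a b : ℕ)
  /-- `N[a] :=` a fresh uniformly random element of `{0, …, N[b]}` -/
  | draw (a b : ℕ)
  /-- `R[a] := D[N[b], N[c]]` -/
  | input (a b c : ℕ)
  /-- `R[a] := N[b]` -/
  | rcast (a b : ℕ)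
  /-- `R[a] := R[b] + R[c]` -/
  | radd (a b c : ℕ)
  /-- `R[a] := R[b] - R[c]` -/
  | rsub (a b c : ℕ)
  /-- `R[a] := R[b] * R[c]` -/
  | rmul (a b c : ℕ)
  /-- `R[a] := R[b] / R[c]` -/
  | rdiv (a b c : ℕ)
  /-- `R[a] := R[N[b]]` -/
  | rload (a b : ℕ)
  /-- `R[N[a]] := R[b]` -/
  | rstore (a b : ℕ)
  /-- write the output symbol `leaf N[a]` -/
  | outLeaf (a : ℕ)
  /-- write the output symbol `node R[a]` -/
  | outNode (a : ℕ)

/-- Tests: `N[a] ≤ N[b]` and `R[a] ≤ R[b]`. -/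
inductive Test where
  | le (a b : ℕ)
  | rle (a b : ℕ)

/-- Programs. -/
inductive Program where
  | skip : Program
  | instr (i : Instr) : Program
  | seq (p q : Program) : Program
  | branch (t : Test) (p q : Program) : Program
  | loop (t : Test) (p : Program) : Program

/-- The memory of the machine: the two arrays, and the output written so far. -/
structure Memory where
  nat : ℕ → ℕ
  real : ℕ → ℝ
  out : List Symbol

namespace Memory

/-- Write into the array of naturals. -/
def setNat (σ : Memory) (a v : ℕ) : Memory :=
  { σ with nat := Function.update σ.nat a v }

/-- Write into the array of reals. -/
noncomputable def setReal (σ : Memory) (a : ℕ) (v : ℝ) : Memory :=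
  { σ with real := Function.update σ.real a v }

/-- Append an output symbol. -/
def emit (σ : Memory) (s : Symbol) : Memory :=
  { σ with out := σ.out ++ [s] }

end Memory

/-- The effect of one instruction, with input matrix `D`. -/
noncomputable def Instr.exec (D : ℕ → ℕ → ℝ) (σ : Memory) : Instr → PMF Memory
  | .const a k => PMF.pure (σ.setNat a k)
  | .add a b c => PMF.pure (σ.setNat a (σ.nat b + σ.nat c))
  | .sub a b c => PMF.pure (σ.setNat a (σ.nat b - σ.nat c))
  | .load a b => PMF.pure (σ.setNat a (σ.nat (σ.nat b)))
  | .store a b => PMF.pure (σ.setNat (σ.nat a) (σ.nat b))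
  | .draw a b =>
      (PMF.uniformOfFintype (Fin (σ.nat b + 1))).map fun v => σ.setNat a (v : ℕ)
  | .input a b c => PMF.pure (σ.setReal a (D (σ.nat b) (σ.nat c)))
  | .rcast a b => PMF.pure (σ.setReal a (σ.nat b : ℝ))
  | .radd a b c => PMF.pure (σ.setReal a (σ.real b + σ.real c))
  | .rsub a b c => PMF.pure (σ.setReal a (σ.real b - σ.real c))
  | .rmul a b c => PMF.pure (σ.setReal a (σ.real b * σ.real c))
  | .rdiv a b c => PMF.pure (σ.setReal a (σ.real b / σ.real c))
  | .rload a b => PMF.pure (σ.setReal a (σ.real (σ.nat b)))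
  | .rstore a b => PMF.pure (σ.setReal (σ.nat a) (σ.real b))
  | .outLeaf a => PMF.pure (σ.emit (.leaf (σ.nat a)))
  | .outNode a => PMF.pure (σ.emit (.node (σ.real a)))

/-- The truth of a test. -/
def Test.Holds (σ : Memory) : Test → Prop
  | .le a b => σ.nat a ≤ σ.nat b
  | .rle a b => σ.real a ≤ σ.real b

/-- A configuration: the pending program parts, to be executed in this order, and the memory. -/
abbrev Config : Type := List Program × Memory

/-- The machine has halted when nothing is left to be executed. -/
def Config.Halted (κ : Config) : Prop := κ.1 = []

open Classical in
/-- One step of the machine. -/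
noncomputable def step (D : ℕ → ℕ → ℝ) : Config → PMF Config
  | ([], σ) => PMF.pure ([], σ)
  | (.skip :: K, σ) => PMF.pure (K, σ)
  | (.instr i :: K, σ) => (i.exec D σ).map fun τ => (K, τ)
  | (.seq p q :: K, σ) => PMF.pure (p :: q :: K, σ)
  | (.branch t p q :: K, σ) => PMF.pure (if t.Holds σ then (p :: K, σ) else (q :: K, σ))
  | (.loop t p :: K, σ) =>
      PMF.pure (if t.Holds σ then (p :: .loop t p :: K, σ) else (K, σ))

/-- The initial configuration for an `n × n` input matrix: `N[0] = n`, everything else is `0`. -/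
noncomputable def initial (M : Program) (n : ℕ) : Config :=
  ([M], { nat := Function.update (fun _ => 0) 0 n, real := fun _ => 0, out := [] })

/-- The distribution of the configuration after `t` steps of `M` on the `n × n` matrix `D`. -/
noncomputable def run (M : Program) (n : ℕ) (D : ℕ → ℕ → ℝ) : ℕ → PMF Config
  | 0 => PMF.pure (initial M n)
  | t + 1 => (run M n D t).bind (step D)

/-- The distance matrix of a metric space whose points are enumerated by `e`,
padded by zeros outside the range of indices. -/
noncomputable def distMatrix {V : Type*} [MetricSpace V] {n : ℕ} (e : Fin n ≃ V) :
    ℕ → ℕ → ℝ :=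
  fun i j => if h : i < n ∧ j < n then dist (e ⟨i, h.1⟩) (e ⟨j, h.2⟩) else 0

/-- A tree over `V` in prefix notation, a leaf being written as the index of its point. -/
def encodeTree {V : Type*} {n : ℕ} (e : Fin n ≃ V) : BinTree V → List Symbol
  | .leaf x => [.leaf (e.symm x : ℕ)]
  | .node w l r => .node w :: (encodeTree e l ++ encodeTree e r)

/-- On the distance matrix of `V`, the program `M` always halts within `t` steps, and
its output is a random tree with distribution exactly `P`. -/
def Samples {V : Type*} [MetricSpace V] {n : ℕ} (M : Program) (e : Fin n ≃ V)
    (P : PMF (BinTree V)) (t : ℕ) : Prop :=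
  (∀ κ ∈ (run M n (distMatrix e) t).support, κ.Halted) ∧
    (run M n (distMatrix e) t).map (fun κ => κ.2.out) = P.map (encodeTree e)

end RealRAM

/-! The random ultrametric is that of Fakcharoenphol, Rao and Talwar; it is then realised by a
binary tree of small height through balanced splitting.

Draw an integer priority for each point and a random base radius `R`. At level `i` every point takes
as centre the point of least priority within `R * 2 ^ i`, and `sepLevel x y` is the last level at
which the centres of `x` and `y` differ. Sharing centres at all higher levels is transitive, so
`sepLevel` obeys the ultrametric inequality. A common centre one level higher gives `D x y ≤ 4 * R *
2 ^ sepLevel` (`le_sepLevel`). Conversely, a separation needs a point `w` whose distances to `x` and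
`y` enclose the radius and which has least priority among all points no farther from the pair
(`exists_cut`). If `w` has rank `k` in nearness, the priorities allow this with probability `O(1 /
k)` and the radius with probability `O(D x y / radius)`, and only two of the large levels matter for
each `w`. The harmonic sum over `w` gives the factor `log n` (`sum_sepLevel_le`).

For the tree, order the points so that each is followed by a nearest remaining one. The level of two
points is then the maximum of the consecutive levels `h` between them (`le_dist`, `exists_dist_le`),
so clusters are intervals, and a tree arises by splitting intervals at maxima of `h`. A node gets
the smaller of its natural weight `8 * R * 2 ^ h k` and `γ` times the weight of its parent, where `γ
= 1 - 1 / (4 * L)` and `L` is about `log₂ n`; this forces the separation. Splitting at a maximum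
near the middle halves a potential which is at most `2 * n ^ 2`, so a chain of splits at one level
has length at most about `2 * log₂ n`. This bounds the height (`pow_height_le`). It also keeps the
forced decay above `1 / 2` until the level drops, when the halved natural weight absorbs it
(`le_treeDist`). Tree distances thus lie between `4 * R * 2 ^ sepLevel` and `8 * R * 2 ^ sepLevel`,
which yields both domination and the expected stretch.

The sampler computes its parameters from the sum of the distances and the sum of their inverses,
using doubling instead of logarithms. Only `n + 1` draws are random, so its output is the image of a
uniform tuple. A calculus with step bounds (`Ok` for deterministic programs, `Yields` for randomized
ones) establishes correctness and running time together. -/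

/-! ## Reasoning about programs -/

namespace RealRAM

/-- The distribution after `t` steps from a given configuration. -/
noncomputable def runFrom (D : ℕ → ℕ → ℝ) : Config → ℕ → PMF Config
  | κ, 0 => PMF.pure κ
  | κ, t + 1 => (step D κ).bind fun κ' => runFrom D κ' t

theorem runFrom_add (D : ℕ → ℕ → ℝ) (s t : ℕ) (κ : Config) :
    runFrom D κ (s + t) = (runFrom D κ s).bind fun κ' => runFrom D κ' t := by
  induction s generalizing κ with
  | zero => simp [runFrom]
  | succ s ih =>
    rw [Nat.succ_add_eq_add_succ, Nat.add_succ]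
    simp only [runFrom, PMF.bind_bind, ih]

/-- `run` adds steps at the end and `runFrom` at the beginning; the latter suits induction on
programs. -/
theorem run_eq_runFrom (M : Program) (n : ℕ) (D : ℕ → ℕ → ℝ) (t : ℕ) :
    run M n D t = runFrom D (initial M n) t := by
  induction t with
  | zero => rfl
  | succ t ih =>
    rw [runFrom_add, run, ih]
    congr 1
    ext1 κ
    simp [runFrom]

/-- The machine passes deterministically from `κ` to `κ'` in exactly `t` steps. -/
def Reach (D : ℕ → ℕ → ℝ) (κ : Config) (t : ℕ) (κ' : Config) : Prop :=
  runFrom D κ t = PMF.pure κ'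

theorem Reach.trans {D : ℕ → ℕ → ℝ} {κ₁ κ₂ κ₃ : Config} {s t : ℕ}
    (h₁ : Reach D κ₁ s κ₂) (h₂ : Reach D κ₂ t κ₃) : Reach D κ₁ (s + t) κ₃ := by
  unfold Reach at *
  rw [runFrom_add, h₁, PMF.pure_bind, h₂]

theorem Reach.of_step {D : ℕ → ℕ → ℝ} {κ κ' : Config} (h : step D κ = PMF.pure κ') :
    Reach D κ 1 κ' := by
  simp [Reach, runFrom, h]

/-- Started in `σ`, the program `p` ends deterministically within `T` steps in a memory
satisfying `Q`. -/
def Ok (D : ℕ → ℕ → ℝ) (p : Program) (T : ℕ) (σ : Memory) (Q : Memory → Prop) : Prop :=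
  ∃ t ≤ T, ∃ τ, Q τ ∧ ∀ K, Reach D (p :: K, σ) t (K, τ)

variable {D : ℕ → ℕ → ℝ} {σ : Memory} {Q R : Memory → Prop}

theorem Ok.mono {p : Program} {T T' : ℕ} (h : Ok D p T σ R) (hT : T ≤ T')
    (hQ : ∀ τ, R τ → Q τ) : Ok D p T' σ Q := by
  obtain ⟨t, ht, τ, hτ, hr⟩ := h
  exact ⟨t, ht.trans hT, τ, hQ τ hτ, hr⟩

theorem ok_skip (h : Q σ) : Ok D .skip 1 σ Q :=
  ⟨1, le_rfl, σ, h, fun _ => Reach.of_step rfl⟩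

theorem ok_seq {p q : Program} {T₁ T₂ : ℕ} (h : Ok D p T₁ σ fun τ => Ok D q T₂ τ Q) :
    Ok D (.seq p q) (T₁ + T₂ + 1) σ Q := by
  obtain ⟨t₁, ht₁, τ₁, ⟨t₂, ht₂, τ₂, hQ, hr₂⟩, hr₁⟩ := h
  refine ⟨1 + (t₁ + t₂), by omega, τ₂, hQ, fun K => ?_⟩
  exact (Reach.of_step rfl).trans ((hr₁ _).trans (hr₂ _))

theorem ok_branch {t : Test} {p q : Program} {T₁ T₂ : ℕ} (h₁ : t.Holds σ → Ok D p T₁ σ Q)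
    (h₂ : ¬ t.Holds σ → Ok D q T₂ σ Q) : Ok D (.branch t p q) (max T₁ T₂ + 1) σ Q := by
  by_cases ht : t.Holds σ
  · obtain ⟨s, hs, τ, hQ, hr⟩ := h₁ ht
    refine ⟨1 + s, by omega, τ, hQ, fun K => (Reach.of_step ?_).trans (hr K)⟩
    simp [step, ht]
  · obtain ⟨s, hs, τ, hQ, hr⟩ := h₂ ht
    refine ⟨1 + s, by omega, τ, hQ, fun K => (Reach.of_step ?_).trans (hr K)⟩
    simp [step, ht]

theorem Reach.loop_enter {t : Test} {p : Program} {K : List Program} (h : t.Holds σ) :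
    Reach D (.loop t p :: K, σ) 1 (p :: .loop t p :: K, σ) :=
  Reach.of_step (by simp [step, h])

theorem Reach.loop_exit {t : Test} {p : Program} {K : List Program} (h : ¬ t.Holds σ) :
    Reach D (.loop t p :: K, σ) 1 (K, σ) :=
  Reach.of_step (by simp [step, h])

/-- A loop whose body is executed exactly `N` times. -/
theorem ok_loop {t : Test} {p : Program} (N T : ℕ) (Inv : ℕ → Memory → Prop)
    (h0 : Inv 0 σ)
    (hstep : ∀ k < N, ∀ τ, Inv k τ → t.Holds τ ∧ Ok D p T τ (Inv (k + 1)))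
    (hend : ∀ τ, Inv N τ → ¬ t.Holds τ) :
    Ok D (.loop t p) (N * (T + 1) + 1) σ (Inv N) := by
  suffices H : ∀ j k, k + j = N → ∀ τ, Inv k τ → Ok D (.loop t p) (j * (T + 1) + 1) τ (Inv N) from
    H N 0 (by omega) σ h0
  intro j
  induction j with
  | zero =>
    intro k hk τ hτ
    obtain rfl : k = N := by omega
    exact ⟨1, by omega, τ, hτ, fun K => Reach.loop_exit (hend τ hτ)⟩
  | succ j ih =>
    intro k hk τ hτ
    obtain ⟨ht, s, hs, τ₁, h₁, hr₁⟩ := hstep k (by omega) τ hτ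
    obtain ⟨s₂, hs₂, τ₂, h₂, hr₂⟩ := ih (k + 1) (by omega) τ₁ h₁
    refine ⟨1 + (s + s₂), ?_, τ₂, h₂, fun K =>
      (Reach.loop_enter ht).trans ((hr₁ _).trans (hr₂ _))⟩
    have : (j + 1) * (T + 1) = j * (T + 1) + (T + 1) := by ring
    omega

/-- The effect of an instruction that draws nothing. -/
@[simp] noncomputable def Instr.det (D : ℕ → ℕ → ℝ) (σ : Memory) : Instr → Memory
  | .const a k => σ.setNat a k
  | .add a b c => σ.setNat a (σ.nat b + σ.nat c)
  | .sub a b c => σ.setNat a (σ.nat b - σ.nat c)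
  | .load a b => σ.setNat a (σ.nat (σ.nat b))
  | .store a b => σ.setNat (σ.nat a) (σ.nat b)
  | .draw _ _ => σ
  | .input a b c => σ.setReal a (D (σ.nat b) (σ.nat c))
  | .rcast a b => σ.setReal a (σ.nat b : ℝ)
  | .radd a b c => σ.setReal a (σ.real b + σ.real c)
  | .rsub a b c => σ.setReal a (σ.real b - σ.real c)
  | .rmul a b c => σ.setReal a (σ.real b * σ.real c)
  | .rdiv a b c => σ.setReal a (σ.real b / σ.real c)
  | .rload a b => σ.setReal a (σ.real (σ.nat b))
  | .rstore a b => σ.setReal (σ.nat a) (σ.real b)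
  | .outLeaf a => σ.emit (.leaf (σ.nat a))
  | .outNode a => σ.emit (.node (σ.real a))

/-- Whether an instruction draws nothing. -/
def Instr.isDet : Instr → Bool
  | .draw _ _ => false
  | _ => true

theorem Instr.exec_eq_det {i : Instr} (h : i.isDet = true) :
    i.exec D σ = PMF.pure (i.det D σ) := by
  cases i <;> first | rfl | simp [Instr.isDet] at h

/-- A straight-line program. -/
def code (l : List Instr) : Program :=
  l.foldr (fun i p => .seq (.instr i) p) .skip

/-- Correctness of straight-line code becomes a statement about a fold, which `simp` can evaluate.
An instruction costs one step for unfolding `seq` and one for execution, so the factor `3` is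
generous. -/
theorem ok_code {l : List Instr} (hl : l.all Instr.isDet = true)
    (h : Q (l.foldl (Instr.det D) σ)) : Ok D (code l) (3 * l.length + 1) σ Q := by
  induction l generalizing σ with
  | nil => exact ok_skip h
  | cons i l ih =>
    simp only [List.all_cons, Bool.and_eq_true] at hl
    have h1 : Ok D (.instr i) 1 σ fun τ => Ok D (code l) (3 * l.length + 1) τ Q := by
      refine ⟨1, le_rfl, i.det D σ, ih hl.2 h, fun K => Reach.of_step ?_⟩
      simp [step, Instr.exec_eq_det hl.1, PMF.pure_map]
    exact (ok_seq h1).mono (by simp; omega) fun _ h => h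

section Memory

variable (σ : Memory) (a b v : ℕ) (r : ℝ) (s : Symbol)

@[simp] theorem nat_setNat : (σ.setNat a v).nat b = if b = a then v else σ.nat b := by
  simp [Memory.setNat, Function.update_apply]

@[simp] theorem real_setNat : (σ.setNat a v).real = σ.real := rfl

@[simp] theorem out_setNat : (σ.setNat a v).out = σ.out := rfl

@[simp] theorem nat_setReal : (σ.setReal a r).nat = σ.nat := rfl

@[simp] theorem real_setReal : (σ.setReal a r).real b = if b = a then r else σ.real b := by
  simp [Memory.setReal, Function.update_apply]

@[simp] theorem out_setReal : (σ.setReal a r).out = σ.out := rfl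

@[simp] theorem nat_emit : (σ.emit s).nat = σ.nat := rfl

@[simp] theorem real_emit : (σ.emit s).real = σ.real := rfl

@[simp] theorem out_emit : (σ.emit s).out = σ.out ++ [s] := rfl

end Memory

/-! ### Randomized programs -/

/-- From `κ` the machine halts within `T` steps, and its final memory is `G a` for a uniformly
random `a : A`, where `G a` satisfies `Q a`. -/
def Yields (D : ℕ → ℕ → ℝ) (κ : Config) (T : ℕ) (A : Type) [Fintype A] [Nonempty A]
    (Q : A → Memory → Prop) : Prop :=
  ∃ G : A → Memory, (∀ a, Q a (G a)) ∧
    ∀ T' ≥ T, runFrom D κ T' = (PMF.uniformOfFintype A).map fun a => ([], G a)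

/-- Halted configurations are absorbing, so random branches of different lengths agree with their
outcomes at any sufficiently late common time. -/
theorem runFrom_halted (D : ℕ → ℕ → ℝ) (σ : Memory) (t : ℕ) :
    runFrom D ([], σ) t = PMF.pure ([], σ) := by
  induction t with
  | zero => rfl
  | succ t ih => simp [runFrom, step, ih]

theorem yields_halted {Q : Unit → Memory → Prop} (h : Q () σ) : Yields D ([], σ) 0 Unit Q := by
  refine ⟨fun _ => σ, fun _ => h, fun T' _ => ?_⟩
  rw [runFrom_halted]
  exact (PMF.map_const _ _).symm

theorem Yields.mono {κ : Config} {T T' : ℕ} {A : Type} [Fintype A] [Nonempty A]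
    {Q R : A → Memory → Prop} (h : Yields D κ T A R) (hT : T ≤ T')
    (hQ : ∀ a τ, R a τ → Q a τ) : Yields D κ T' A Q := by
  obtain ⟨G, hG, h⟩ := h
  exact ⟨G, fun a => hQ a _ (hG a), fun t ht => h t (hT.trans ht)⟩

theorem yields_of_reach {κ κ' : Config} {t T : ℕ} {A : Type} [Fintype A] [Nonempty A]
    {Q : A → Memory → Prop} (h : Reach D κ t κ') (h' : Yields D κ' T A Q) :
    Yields D κ (t + T) A Q := by
  obtain ⟨G, hG, hr⟩ := h'
  refine ⟨G, hG, fun T' hT' => ?_⟩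
  obtain ⟨s, rfl⟩ := Nat.exists_eq_add_of_le hT'
  rw [add_assoc, runFrom_add, h, PMF.pure_bind, hr _ (by omega)]

theorem yields_of_ok {p : Program} {K : List Program} {T₁ T₂ : ℕ} {A : Type} [Fintype A]
    [Nonempty A] {Q : A → Memory → Prop} (h : Ok D p T₁ σ R)
    (h' : ∀ τ, R τ → Yields D (K, τ) T₂ A Q) : Yields D (p :: K, σ) (T₁ + T₂) A Q := by
  obtain ⟨t, ht, τ, hτ, hr⟩ := h
  exact (yields_of_reach (hr K) (h' τ hτ)).mono (by omega) fun _ _ h => h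

theorem yields_seq {p q : Program} {K : List Program} {T : ℕ} {A : Type} [Fintype A]
    [Nonempty A] {Q : A → Memory → Prop} (h : Yields D (p :: q :: K, σ) T A Q) :
    Yields D (.seq p q :: K, σ) (T + 1) A Q :=
  (yields_of_reach (Reach.of_step rfl) h).mono (by omega) fun _ _ h => h

/-- Merges successive draws, so that all randomness of a run ends up in a single uniform tuple. -/
theorem uniform_bind_map {A B X : Type} [Fintype A] [Nonempty A] [Fintype B] [Nonempty B]
    (f : A → B → X) :
    ((PMF.uniformOfFintype A).bind fun a => (PMF.uniformOfFintype B).map (f a)) =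
      (PMF.uniformOfFintype (A × B)).map fun p => f p.1 p.2 := by
  ext x
  classical
  simp only [PMF.bind_apply, PMF.map_apply, PMF.uniformOfFintype_apply, tsum_fintype,
    Fintype.sum_prod_type, Finset.mul_sum, Fintype.card_prod, Nat.cast_mul]
  refine Finset.sum_congr rfl fun a _ => Finset.sum_congr rfl fun b _ => ?_
  rw [ENNReal.mul_inv (Or.inr (ENNReal.natCast_ne_top _)) (Or.inl (ENNReal.natCast_ne_top _))]
  split_ifs <;> simp

theorem uniform_map_equiv {A B : Type} [Fintype A] [Nonempty A] [Fintype B] [Nonempty B]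
    (f : A ≃ B) : (PMF.uniformOfFintype A).map f = PMF.uniformOfFintype B := by
  ext b
  classical
  rw [PMF.map_apply, tsum_eq_single (f.symm b)]
  · simp [Fintype.card_congr f]
  · intro a ha
    rw [if_neg]
    rintro rfl
    simp at ha

theorem Yields.equiv {κ : Config} {T : ℕ} {A B : Type} [Fintype A] [Nonempty A] [Fintype B]
    [Nonempty B] (f : B ≃ A) {Q : A → Memory → Prop} (h : Yields D κ T A Q) :
    Yields D κ T B fun b => Q (f b) := by
  obtain ⟨G, hG, hr⟩ := h
  refine ⟨fun b => G (f b), fun b => hG _, fun T' hT' => ?_⟩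
  rw [hr T' hT', ← uniform_map_equiv f, PMF.map_comp]
  rfl

theorem yields_draw {a b m : ℕ} (hm : σ.nat b = m) {K : List Program} {T : ℕ} {A : Type}
    [Fintype A] [Nonempty A] {Q : Fin (m + 1) → A → Memory → Prop}
    (h : ∀ v : Fin (m + 1), Yields D (K, σ.setNat a v) T A (Q v)) :
    Yields D (.instr (.draw a b) :: K, σ) (T + 1) (Fin (m + 1) × A) fun p => Q p.1 p.2 := by
  subst hm
  choose G hG hr using h
  refine ⟨fun p => G p.1 p.2, fun p => hG _ _, fun T' hT' => ?_⟩
  obtain ⟨s, rfl⟩ := Nat.exists_eq_add_of_le' hT'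
  rw [← add_assoc, runFrom, step, Instr.exec]
  have : ∀ v : Fin (σ.nat b + 1), runFrom D (K, σ.setNat a v) (s + T) =
      (PMF.uniformOfFintype A).map fun a => ([], G v a) := fun v => hr v _ (by omega)
  rw [PMF.map_comp, PMF.bind_map]
  refine Eq.trans ?_ (uniform_bind_map fun v a => (([], G v a) : Config))
  refine (PMF.bind_bind _ _ _).trans ?_
  congr 1
  ext1 v
  exact (PMF.pure_bind _ _).trans (this v)

end RealRAM

/-! ## The clustering of the points by ball centres of least priority -/

namespace Clustering

variable (D : ℕ → ℕ → ℝ) (π : ℕ → ℝ)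

/-- The least priority of `x` and of the points `v < k` with `D v x ≤ R`. -/
noncomputable def minPrio (R : ℝ) (x : ℕ) : ℕ → ℝ
  | 0 => π x
  | k + 1 => if D k x ≤ R then min (minPrio R x k) (π k) else minPrio R x k

/-- The last level `i < k` at which the centres of `x` and `y` differ, or `0`. -/
noncomputable def sepLevel (n : ℕ) (R : ℝ) (x y : ℕ) : ℕ → ℕ
  | 0 => 0
  | k + 1 => if minPrio D π (R * 2 ^ k) x n = minPrio D π (R * 2 ^ k) y n then
      sepLevel n R x y k else k

variable {D π} {R : ℝ} {n x y z : ℕ}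

theorem minPrio_le {k v : ℕ} (hv : v < k) (h : D v x ≤ R) : minPrio D π R x k ≤ π v := by
  induction k with
  | zero => omega
  | succ k ih =>
    rw [minPrio]
    rcases Nat.lt_succ_iff_lt_or_eq.1 hv with hv | rfl
    · split_ifs
      · exact (min_le_left _ _).trans (ih hv)
      · exact ih hv
    · rw [if_pos h]
      exact min_le_right _ _

theorem exists_minPrio_eq (hx : x < n) (h : D x x ≤ R) :
    ∃ v < n, D v x ≤ R ∧ minPrio D π R x n = π v := by
  suffices H : ∀ k ≤ n, ∃ v < n, D v x ≤ R ∧ minPrio D π R x k = π v from H n le_rfl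
  intro k hk
  induction k with
  | zero => exact ⟨x, hx, h, rfl⟩
  | succ k ih =>
    obtain ⟨v, hv, hvx, he⟩ := ih (by omega)
    rw [minPrio]
    split_ifs with hkx
    · rcases min_choice (minPrio D π R x k) (π k) with h | h
      · exact ⟨v, hv, hvx, h.trans he⟩
      · exact ⟨k, by omega, hkx, h⟩
    · exact ⟨v, hv, hvx, he⟩

theorem minPrio_eq_of_sepLevel_lt {K i : ℕ} (hi : i < K) (h : sepLevel D π n R x y K < i) :
    minPrio D π (R * 2 ^ i) x n = minPrio D π (R * 2 ^ i) y n := by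
  induction K with
  | zero => omega
  | succ k ih =>
    rw [sepLevel] at h
    split_ifs at h with he
    · rcases Nat.lt_succ_iff_lt_or_eq.1 hi with hi | rfl
      · exact ih hi h
      · exact he
    · omega

theorem sepLevel_spec (K : ℕ) : sepLevel D π n R x y K = 0 ∨
    (sepLevel D π n R x y K < K ∧
      minPrio D π (R * 2 ^ sepLevel D π n R x y K) x n ≠
        minPrio D π (R * 2 ^ sepLevel D π n R x y K) y n) := by
  induction K with
  | zero => exact Or.inl rfl
  | succ k ih =>
    rw [sepLevel]
    split_ifs with he
    · rcases ih with h | h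
      · exact Or.inl h
      · exact Or.inr ⟨by omega, h.2⟩
    · exact Or.inr ⟨by omega, he⟩

theorem sepLevel_le (K : ℕ) : sepLevel D π n R x y K ≤ K := by
  rcases sepLevel_spec (D := D) (π := π) (n := n) (R := R) (x := x) (y := y) K with h | h <;> omega

theorem sepLevel_comm (K : ℕ) : sepLevel D π n R x y K = sepLevel D π n R y x K := by
  induction K with
  | zero => rfl
  | succ k ih => simp only [sepLevel, ih, eq_comm]

/-- Above both levels on the right, `x`, `y` and `z` share their centres; but a nonzero `sepLevel`
is itself a level at which the centres differ. -/
theorem sepLevel_le_max (K : ℕ) : sepLevel D π n R x z K ≤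
    max (sepLevel D π n R x y K) (sepLevel D π n R y z K) := by
  by_contra! h
  rw [max_lt_iff] at h
  rcases sepLevel_spec (D := D) (π := π) (n := n) (R := R) (x := x) (y := z) K with h0 | ⟨h1, h2⟩
  · omega
  · exact h2 ((minPrio_eq_of_sepLevel_lt h1 h.1).trans
      (minPrio_eq_of_sepLevel_lt h1 h.2))

/-- Points are close to each other compared with the radius of the level separating them. -/
theorem le_sepLevel {K : ℕ} (hR : 0 ≤ R) (hD : ∀ i < n, D i i = 0)
    (hs : ∀ i < n, ∀ j < n, D i j = D j i)
    (ht : ∀ i < n, ∀ j < n, ∀ k < n, D i k ≤ D i j + D j k)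
    (hπ : ∀ i < n, ∀ j < n, π i = π j → i = j)
    (hK : ∀ i < n, ∀ j < n, D i j ≤ R * 2 ^ K) (hx : x < n) (hy : y < n) :
    D x y ≤ 4 * (R * 2 ^ sepLevel D π n R x y K) := by
  set l := sepLevel D π n R x y K with hl
  -- At level `l + 1` both points lie in the ball of a common centre; if there is no such level, the
  -- top radius already bounds every distance.
  have key : D x y ≤ 2 * (R * 2 ^ (l + 1)) := by
    rcases lt_or_ge (l + 1) K with h | h
    · have hR' : 0 ≤ R * 2 ^ (l + 1) := by positivity
      obtain ⟨v, hv, hvx, he⟩ := exists_minPrio_eq (π := π) hx ((hD x hx).trans_le hR')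
      obtain ⟨v', hv', hvy, he'⟩ := exists_minPrio_eq (π := π) hy ((hD y hy).trans_le hR')
      have := minPrio_eq_of_sepLevel_lt (D := D) (π := π) (n := n) (R := R) (x := x) (y := y) h
        (by omega)
      obtain rfl : v = v' := hπ v hv v' hv' (by rw [← he, ← he', this])
      have := ht x hx v hv y hy
      rw [hs x hx v hv] at this
      linarith
    · have h1 := hK x hx y hy
      have h2 : R * 2 ^ K ≤ R * 2 ^ (l + 1) := by
        gcongr
        · norm_num
      have h3 : 0 ≤ R * 2 ^ (l + 1) := by positivity
      linarith
  rw [pow_succ] at key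
  linarith

end Clustering

/-! ## Orders adapted to an ultrametric -/

/-- `p` permutes the numbers below `n`, and for `1 ≤ k < m` the entry `p k` is, among the entries
from position `k` on, one closest to its predecessor with respect to `d`, at distance `h k`. -/
structure IsGreedyOrder (d : ℕ → ℕ → ℕ) (n m : ℕ) (p h : ℕ → ℕ) : Prop where
  lt : ∀ i < n, p i < n
  inj : ∀ i < n, ∀ j < n, p i = p j → i = j
  eq : ∀ k, 1 ≤ k → k < m → h k = d (p (k - 1)) (p k)
  le : ∀ k, 1 ≤ k → k < m → ∀ j, k ≤ j → j < n → h k ≤ d (p (k - 1)) (p j)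

namespace IsGreedyOrder

variable {d : ℕ → ℕ → ℕ} {n : ℕ} {p h : ℕ → ℕ}

/-- Swapping positions `k` and `c` only permutes the entries from `k` on, so the earlier minimality
conditions survive. -/
theorem step {k c : ℕ} (H : IsGreedyOrder d n k p h) (hk : 1 ≤ k) (hkc : k ≤ c) (hc : c < n)
    (hmin : ∀ j, k ≤ j → j < n → d (p (k - 1)) (p c) ≤ d (p (k - 1)) (p j)) :
    IsGreedyOrder d n (k + 1) (p ∘ Equiv.swap k c)
      (Function.update h k (d (p (k - 1)) (p c))) := by
  have small : ∀ i, i < k → Equiv.swap k c i = i := fun i hi =>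
    Equiv.swap_apply_of_ne_of_ne (by omega) (by omega)
  have large : ∀ i j, i ≤ k → i ≤ j → j < n → i ≤ Equiv.swap k c j ∧ Equiv.swap k c j < n := by
    intro i j hi hij hj
    rw [Equiv.swap_apply_def]
    split_ifs <;> omega
  refine ⟨fun i hi => H.lt _ (large 0 i (by omega) (by omega) hi).2, fun i hi j hj he => ?_,
    fun j h1 h2 => ?_, fun i h1 h2 j h3 h4 => ?_⟩
  · exact (Equiv.swap k c).injective (H.inj _ (large 0 i (by omega) (by omega) hi).2 _
      (large 0 j (by omega) (by omega) hj).2 he)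
  · simp only [Function.comp, small (j - 1) (by omega)]
    rcases Nat.lt_succ_iff_lt_or_eq.1 h2 with h2 | rfl
    · rw [small j h2, Function.update_of_ne (by omega), H.eq j h1 h2]
    · rw [Equiv.swap_apply_left, Function.update_self]
  · obtain ⟨h5, h6⟩ := large i j (by omega) h3 h4
    simp only [Function.comp, small (i - 1) (by omega)]
    rcases Nat.lt_succ_iff_lt_or_eq.1 h2 with h2 | rfl
    · rw [Function.update_of_ne (by omega)]
      exact H.le i h1 h2 _ h5 h6
    · rw [Function.update_self]
      exact hmin _ h5 h6

/-- Each greedy step is no longer than the distance from its starting point to `p j`. By the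
ultrametric inequality, walking along the order therefore never increases the distance to `p j`. -/
theorem le_dist (H : IsGreedyOrder d n n p h) (hc : ∀ x y, d x y = d y x)
    (hu : ∀ x y z, d x z ≤ max (d x y) (d y z)) {i j k : ℕ} (hik : i < k) (hkj : k ≤ j)
    (hj : j < n) : h k ≤ d (p i) (p j) := by
  have key : ∀ t, i + t < j → d (p (i + t)) (p j) ≤ d (p i) (p j) := by
    intro t
    induction t with
    | zero => intro _; exact le_rfl
    | succ t ih =>
      intro ht
      have h1 := ih (by omega)
      have h2 := hu (p (i + (t + 1))) (p (i + t)) (p j)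
      have h3 := H.le (i + (t + 1)) (by omega) (by omega) j (by omega) hj
      have h4 := H.eq (i + (t + 1)) (by omega) (by omega)
      have e : i + (t + 1) - 1 = i + t := by omega
      rw [e] at h3 h4
      rw [hc (p (i + (t + 1))) (p (i + t))] at h2
      omega
  have h1 := H.le k (by omega) (by omega) j hkj hj
  have h2 := key (k - 1 - i) (by omega)
  have e : i + (k - 1 - i) = k - 1 := by omega
  rw [e] at h2
  omega

theorem exists_dist_le (H : IsGreedyOrder d n n p h)
    (hu : ∀ x y z, d x z ≤ max (d x y) (d y z)) {i j : ℕ} (hij : i < j) (hj : j < n) :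
    ∃ t, i < t ∧ t ≤ j ∧ d (p i) (p j) ≤ h t := by
  induction j, hij using Nat.le_induction with
  | base =>
    refine ⟨i + 1, by omega, le_rfl, ?_⟩
    rw [H.eq (i + 1) (by omega) hj]
    simp
  | succ j hij ih =>
    obtain ⟨t, h1, h2, h3⟩ := ih (by omega)
    have h4 := hu (p i) (p j) (p (j + 1))
    have h5 := H.eq (j + 1) (by omega) hj
    rw [Nat.add_sub_cancel] at h5
    rcases le_total (d (p i) (p j)) (d (p j) (p (j + 1))) with h | h
    · exact ⟨j + 1, by omega, le_rfl, by omega⟩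
    · exact ⟨t, h1, by omega, by omega⟩

end IsGreedyOrder

/-! ## Trees built by balanced splitting of intervals -/

/-- `k` is a position of the open interval `(a, b)` where `h` is maximal: the first such position
in the right half, or else the last one. -/
structure IsSplit (h : ℕ → ℕ) (a b k : ℕ) : Prop where
  left : a < k
  right : k < b
  maximal : ∀ j, a < j → j < b → h j ≤ h k
  before : ∀ j, a < j → j < k → h j = h k → 2 * j < a + b
  after : 2 * k < a + b → ∀ j, k < j → j < b → h j < h k

/-- The tree is obtained by recursive splitting of the interval `[a, b)`, the parent of its root
having weight `pw`. -/
inductive IsBuilt {V : Type*} (q : ℕ → V) (h : ℕ → ℕ) (γ A : ℝ) : ℕ → ℕ → ℝ → BinTree V → Prop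
  | leaf (a : ℕ) (pw : ℝ) : IsBuilt q h γ A a (a + 1) pw (.leaf (q a))
  | node {a b k : ℕ} {pw w : ℝ} {l r : BinTree V} (hk : IsSplit h a b k)
      (hw : w = min (γ * pw) (A * 2 ^ h k)) (hl : IsBuilt q h γ A a k w l)
      (hr : IsBuilt q h γ A k b w r) : IsBuilt q h γ A a b pw (.node w l r)

namespace BinTree

variable {V : Type*}

theorem lca_comm (x y : V) (T : BinTree V) : T.lca x y = T.lca y x := by
  induction T with
  | leaf z => rfl
  | node w l r hl hr =>
    simp only [lca, hl, hr]
    split_ifs <;> first | rfl | tauto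

theorem treeDist_comm (x y : V) (T : BinTree V) : T.treeDist x y = T.treeDist y x := by
  rw [treeDist, lca_comm, treeDist]

theorem treeDist_self {x : V} {T : BinTree V} (hx : x ∈ T.leaves) : T.treeDist x x = 0 := by
  induction T with
  | leaf z => rfl
  | node w l r hl hr =>
    simp only [treeDist, lca, and_self] at *
    rw [leaves, List.mem_append] at hx
    split_ifs with h1 h2
    · exact hl h1.1
    · exact hr h2.1
    · tauto

end BinTree

/-- The potential of `[a, b)` is its length times the larger of that length and `2 * e`, where all
maxima of `h` lie at or before `a + e`. If `k` is in the left half, the left part is less than half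
as long. Otherwise `k` is the first maximum of the right half, so the maxima before it lie in the
left half, while `k - a ≤ e`. -/
theorem IsSplit.left_child {h : ℕ → ℕ} {a b k e : ℕ} (hk : IsSplit h a b k)
    (he : ∀ j, a < j → j < b → h j = h k → j ≤ a + e) :
    ∃ e', 2 * ((k - a) * max (2 * e') (k - a)) ≤ (b - a) * max (2 * e) (b - a) ∧
      ∀ j, a < j → j < k → h j = h k → j ≤ a + e' := by
  obtain ⟨c, rfl⟩ := Nat.exists_eq_add_of_lt hk.left
  obtain ⟨N, rfl⟩ := Nat.exists_eq_add_of_lt (hk.left.trans hk.right)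
  have h1 := he _ hk.left hk.right rfl
  have h2 := hk.right
  have e1 : a + c + 1 - a = c + 1 := by omega
  have e2 : a + N + 1 - a = N + 1 := by omega
  rw [e1, e2]
  rcases lt_or_ge (2 * (a + c + 1)) (a + (a + N + 1)) with h | h
  · refine ⟨c + 1, ?_, fun j _ _ _ => by omega⟩
    have : N + 1 ≤ max (2 * e) (N + 1) := le_max_right _ _
    rw [max_eq_left (by omega)]
    calc 2 * ((c + 1) * (2 * (c + 1))) = (2 * (c + 1)) * (2 * (c + 1)) := by ring
      _ ≤ (N + 1) * max (2 * e) (N + 1) := Nat.mul_le_mul (by omega) (by omega)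
  · refine ⟨N / 2, ?_, fun j h1 h2 h3 => ?_⟩
    · have h3 : max (2 * (N / 2)) (c + 1) ≤ N + 1 := by omega
      calc 2 * ((c + 1) * max (2 * (N / 2)) (c + 1)) ≤ 2 * ((c + 1) * (N + 1)) := by gcongr
        _ = (N + 1) * (2 * (c + 1)) := by ring
        _ ≤ (N + 1) * max (2 * e) (N + 1) := Nat.mul_le_mul le_rfl (by omega)
    · have := hk.before j h1 h2 h3
      omega

/-- If `k` is in the left half, it is the last maximum, so the level drops to its right. Otherwise
the right part has at most half the length and `e` can be kept. -/
theorem IsSplit.right_child {h : ℕ → ℕ} {a b k e : ℕ} (hk : IsSplit h a b k)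
    (he : ∀ j, a < j → j < b → h j = h k → j ≤ a + e) :
    (∀ j, k < j → j < b → h j < h k) ∨
    ∃ e', 2 * ((b - k) * max (2 * e') (b - k)) ≤ (b - a) * max (2 * e) (b - a) ∧
      ∀ j, k < j → j < b → h j = h k → j ≤ k + e' := by
  rcases lt_or_ge (2 * k) (a + b) with h | h
  · exact Or.inl (hk.after h)
  · have h1 := hk.left
    have h2 := hk.right
    refine Or.inr ⟨e, ?_, fun j h3 h4 h5 => ?_⟩
    · calc 2 * ((b - k) * max (2 * e) (b - k)) = (2 * (b - k)) * max (2 * e) (b - k) := by ring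
        _ ≤ (b - a) * max (2 * e) (b - a) := Nat.mul_le_mul (by omega) (by omega)
    · have := he j (by omega) h4 h5
      omega

namespace IsBuilt

open BinTree

variable {V : Type*} {q : ℕ → V} {h : ℕ → ℕ} {γ A : ℝ} {a b : ℕ} {pw : ℝ} {T : BinTree V}

theorem lt (H : IsBuilt q h γ A a b pw T) : a < b := by
  induction H with
  | leaf => omega
  | node hk => exact hk.left.trans hk.right

theorem leaves_eq (H : IsBuilt q h γ A a b pw T) :
    T.leaves = (List.range' a (b - a)).map q := by
  induction H with
  | leaf a pw => simp [leaves]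
  | @node a b k pw w l r hk hw hl hr ihl ihr =>
    have h1 := hk.left
    have h2 := hk.right
    rw [leaves, ihl, ihr, ← List.map_append]
    obtain ⟨c, rfl⟩ := Nat.exists_eq_add_of_lt h1
    obtain ⟨d, rfl⟩ := Nat.exists_eq_add_of_lt h2
    have e1 : a + c + 1 - a = c + 1 := by omega
    have e2 : a + c + 1 + d + 1 - (a + c + 1) = d + 1 := by omega
    have e3 : a + c + 1 + d + 1 - a = (c + 1) + (d + 1) := by omega
    rw [e1, e2, e3, add_assoc a c 1, List.range'_append_1]

theorem mem_leaves (H : IsBuilt q h γ A a b pw T) {n : ℕ} (hb : b ≤ n)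
    (hq : ∀ i < n, ∀ j < n, q i = q j → i = j) {i : ℕ} (hi : i < n) :
    q i ∈ T.leaves ↔ a ≤ i ∧ i < b := by
  have := H.lt
  rw [H.leaves_eq, List.mem_map]
  constructor
  · rintro ⟨j, hj, he⟩
    rw [List.mem_range'_1] at hj
    obtain rfl := hq j (by omega) i hi he
    omega
  · intro hi
    exact ⟨i, by rw [List.mem_range'_1]; omega, rfl⟩

/-- The right-hand side at least halves from a node to each child. At constant level this is the
decrease of the potential; when the level drops, the factor `4` pays for the halving and for
resetting `e` to the length of the interval. -/
theorem pow_height_le (H : IsBuilt q h γ A a b pw T) (M e : ℕ)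
    (hM : ∀ j, a < j → j < b → h j < M) (he : ∀ j, a < j → j < b → h j + 1 = M → j ≤ a + e) :
    2 ^ T.height ≤ (b - a) * max (2 * e) (b - a) * 4 ^ M := by
  induction H generalizing M e with
  | leaf a pw =>
    have : 1 ≤ 4 ^ M := Nat.one_le_pow _ _ (by norm_num)
    have e1 : a + 1 - a = 1 := by omega
    simp only [height, pow_zero, e1, one_mul]
    exact this.trans (Nat.le_mul_of_pos_left _ (by simp))
  | @node a b k pw w l r hk hw hl hr ihl ihr =>
    have h1 := hk.left
    have h2 := hk.right
    have hkM := hM k h1 h2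
    obtain ⟨M, rfl⟩ := Nat.exists_eq_add_of_lt (Nat.zero_lt_of_lt hkM)
    rw [zero_add] at *
    have drop : ∀ c d, a ≤ c → d ≤ b → c < d →
        2 * ((d - c) * max (2 * (d - c)) (d - c) * 4 ^ M) ≤
          (b - a) * max (2 * e) (b - a) * 4 ^ (M + 1) := by
      intro c d hc hd hcd
      rw [max_eq_left (by omega)]
      calc 2 * ((d - c) * (2 * (d - c)) * 4 ^ M) = (d - c) * (d - c) * 4 ^ (M + 1) := by ring
        _ ≤ (b - a) * max (2 * e) (b - a) * 4 ^ (M + 1) :=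
          Nat.mul_le_mul (Nat.mul_le_mul (by omega) (by omega)) le_rfl
    have bl : 2 * 2 ^ l.height ≤ (b - a) * max (2 * e) (b - a) * 4 ^ (M + 1) := by
      rcases Nat.lt_succ_iff_lt_or_eq.1 hkM with hlt | heq
      · refine (Nat.mul_le_mul_left 2 (ihl M (k - a) (fun j h3 h4 => ?_) fun j h3 h4 _ => ?_)).trans
          (drop a k le_rfl h2.le h1)
        · exact (hk.maximal j h3 (by omega)).trans_lt hlt
        · omega
      · obtain ⟨e', h5, h6⟩ := hk.left_child (e := e) fun j h3 h4 h5 => he j h3 h4 (by omega)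
        refine (Nat.mul_le_mul_left 2 (ihl (M + 1) e' (fun j h3 h4 => hM j h3 (by omega))
          fun j h3 h4 h5 => h6 j h3 h4 (by omega))).trans ?_
        rw [← mul_assoc]
        exact Nat.mul_le_mul_right _ h5
    have br : 2 * 2 ^ r.height ≤ (b - a) * max (2 * e) (b - a) * 4 ^ (M + 1) := by
      have hdrop : (∀ j, k < j → j < b → h j < M) →
          2 * 2 ^ r.height ≤ (b - a) * max (2 * e) (b - a) * 4 ^ (M + 1) := fun hj =>
        (Nat.mul_le_mul_left 2 (ihr M (b - k) hj fun j h3 h4 _ => by omega)).trans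
          (drop k b h1.le le_rfl h2)
      rcases Nat.lt_succ_iff_lt_or_eq.1 hkM with hlt | heq
      · exact hdrop fun j h3 h4 => (hk.maximal j (by omega) h4).trans_lt hlt
      · rcases hk.right_child (e := e) fun j h3 h4 h5 => he j h3 h4 (by omega) with h5 | ⟨e', h5, h6⟩
        · exact hdrop fun j h3 h4 => heq ▸ h5 j h3 h4
        · refine (Nat.mul_le_mul_left 2 (ihr (M + 1) e' (fun j h3 h4 => hM j (by omega) h4)
            fun j h3 h4 h5 => h6 j h3 h4 (by omega))).trans ?_
          rw [← mul_assoc]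
          exact Nat.mul_le_mul_right _ h5
    rw [height, pow_succ, mul_comm]
    rcases max_choice l.height r.height with h3 | h3 <;> rw [h3] <;> assumption

theorem weight_le (H : IsBuilt q h γ A a b pw T) (hγ : 0 < γ) (hγ1 : γ < 1) (hA : 0 < A)
    (hpw : 0 < pw) : 0 ≤ T.weight ∧ T.weight ≤ γ * pw ∧ T.IsWeighted := by
  induction H with
  | leaf a pw => exact ⟨le_rfl, by simp only [weight]; positivity, trivial⟩
  | @node a b k pw w l r hk hw hl hr ihl ihr =>
    have hw0 : 0 < w := by rw [hw]; positivity
    obtain ⟨h1, h2, h3⟩ := ihl hw0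
    obtain ⟨h4, h5, h6⟩ := ihr hw0
    refine ⟨hw0.le, hw.trans_le (min_le_left _ _), hw0.le, ?_, ?_, h3, h6⟩ <;> nlinarith

theorem isSeparated (H : IsBuilt q h γ A a b pw T) (hγ : 0 < γ) (hγ1 : γ < 1) (hA : 0 < A)
    (hpw : 0 < pw) {α : ℝ} (hα : 0 ≤ α) (hαγ : α * γ ≤ 1) : T.IsSeparated α := by
  induction H with
  | leaf a pw => trivial
  | @node a b k pw w l r hk hw hl hr ihl ihr =>
    have hw0 : 0 < w := by rw [hw]; positivity
    have key : ∀ s, s ≤ γ * w → α * s ≤ w := fun s hs =>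
      calc α * s ≤ α * (γ * w) := by gcongr
        _ = α * γ * w := by ring
        _ ≤ 1 * w := by gcongr
        _ = w := one_mul w
    exact ⟨key _ (hl.weight_le hγ hγ1 hA hw0).2.1, key _ (hr.weight_le hγ hγ1 hA hw0).2.1,
      ihl hw0, ihr hw0⟩

/-- The least common ancestor of `q i` and `q j` is the node whose split position lies in `(i, j]`.
-/
theorem treeDist_le (H : IsBuilt q h γ A a b pw T) {n : ℕ} (hb : b ≤ n)
    (hq : ∀ i < n, ∀ j < n, q i = q j → i = j) {i j : ℕ} (hi : a ≤ i) (hij : i < j) (hj : j < b) :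
    ∃ t, i < t ∧ t ≤ j ∧ T.treeDist (q i) (q j) ≤ A * 2 ^ h t := by
  induction H with
  | leaf a pw => omega
  | @node a b k pw w l r hk hw hl hr ihl ihr =>
    have h1 := hk.left
    have h2 := hk.right
    simp only [treeDist, lca] at ihl ihr ⊢
    have m1 := hl.mem_leaves (i := i) (by omega) hq (by omega)
    have m2 := hl.mem_leaves (i := j) (by omega) hq (by omega)
    have m3 := hr.mem_leaves (i := i) hb hq (by omega)
    have m4 := hr.mem_leaves (i := j) hb hq (by omega)
    split_ifs with h3 h4 <;> rw [m1, m2] at h3 <;> try rw [m3, m4] at h4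
    · exact ihl (by omega) hi (by omega)
    · exact ihr hb (by omega) (by omega)
    · exact ⟨k, by omega, by omega, hw.trans_le (min_le_right _ _)⟩

/-- Here `s` counts the splits made so far at level `M`. The invariant `hpw` says that forced decay
has cost at most the factor `γ ^ s` against the natural weight `A * 2 ^ M`, and `hs` bounds `s`
through the potential. A drop of the level at least halves the natural weight, which makes up for `γ
^ s ≥ 1 / 2`, and `s` restarts at `0`. -/
theorem le_treeDist (H : IsBuilt q h γ A a b pw T) {n : ℕ} (hb : b ≤ n)
    (hq : ∀ i < n, ∀ j < n, q i = q j → i = j) (hγ : 0 < γ) (hγ1 : γ < 1) (hA : 0 < A)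
    (hγn : ∀ s, 2 * 2 ^ s ≤ n ^ 2 → 1 / 2 ≤ γ ^ (s + 1)) (M e s : ℕ)
    (hM : ∀ j, a < j → j < b → h j ≤ M) (he : ∀ j, a < j → j < b → h j = M → j ≤ a + e)
    (hs : (b - a) * max (2 * e) (b - a) * 2 ^ s ≤ 2 * n ^ 2) (hpw : A * 2 ^ M * γ ^ s ≤ γ * pw)
    {i j t : ℕ} (hi : a ≤ i) (hit : i < t) (htj : t ≤ j) (hj : j < b) :
    A * 2 ^ h t / 2 ≤ T.treeDist (q i) (q j) := by
  induction H generalizing M e s with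
  | leaf a pw => omega
  | @node a b k pw w l r hk hw hl hr ihl ihr =>
    have h1 := hk.left
    have h2 := hk.right
    -- An interval that is split has length at least `2`, hence potential at least `4`.
    have half : ∀ e s, (b - a) * max (2 * e) (b - a) * 2 ^ s ≤ 2 * n ^ 2 →
        1 / 2 ≤ γ ^ (s + 1) := by
      intro e s hs
      apply hγn
      have : 2 * 2 ≤ (b - a) * max (2 * e) (b - a) := Nat.mul_le_mul (by omega) (by omega)
      have := Nat.mul_le_mul_right (2 ^ s) this
      omega
    have half' : ∀ s, 1 / 2 ≤ γ ^ (s + 1) → 1 / 2 ≤ γ ^ s := by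
      intro s hs
      refine hs.trans ?_
      rw [pow_succ]
      exact mul_le_of_le_one_right (by positivity) hγ1.le
    have sq_le : ∀ c d, d - c ≤ n → (d - c) * max (2 * (d - c)) (d - c) * 2 ^ 0 ≤ 2 * n ^ 2 := by
      intro c d hcd
      rw [max_eq_left (by omega)]
      calc (d - c) * (2 * (d - c)) * 2 ^ 0 = 2 * ((d - c) * (d - c)) := by ring
        _ ≤ 2 * (n * n) := by gcongr
        _ = 2 * n ^ 2 := by ring
    -- Make the level bound exact: if `h k < M`, restart with `e = b - a` and `s = 0`.
    obtain ⟨e, s, he, hs, hpw⟩ : ∃ e s, (∀ j, a < j → j < b → h j = h k → j ≤ a + e) ∧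
        (b - a) * max (2 * e) (b - a) * 2 ^ s ≤ 2 * n ^ 2 ∧
        A * 2 ^ h k * γ ^ s ≤ γ * pw := by
      rcases (hM k h1 h2).lt_or_eq with hlt | heq
      · refine ⟨b - a, 0, fun j _ _ _ => by omega, sq_le a b (by omega), le_trans ?_ hpw⟩
        obtain ⟨c, rfl⟩ := Nat.exists_eq_add_of_lt hlt
        calc A * 2 ^ h k * γ ^ 0 = A * 2 ^ h k * (2 * (1 / 2)) := by ring
          _ ≤ A * 2 ^ h k * (2 ^ (c + 1) * γ ^ s) := by
            gcongr
            · calc (2 : ℝ) = 2 ^ 1 := by norm_num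
                _ ≤ 2 ^ (c + 1) := by gcongr <;> simp
            · exact half' s (half e s hs)
          _ = A * 2 ^ (h k + c + 1) * γ ^ s := by ring
      · exact ⟨e, s, fun j h3 h4 h5 => he j h3 h4 (h5.trans heq), hs, heq ▸ hpw⟩
    have hγs := half e s hs
    have hwl : A * 2 ^ h k * γ ^ s ≤ w := by
      rw [hw, le_min_iff]
      refine ⟨hpw, ?_⟩
      exact mul_le_of_le_one_right (by positivity) (pow_le_one₀ hγ.le hγ1.le)
    have hwl' : A * 2 ^ h k * γ ^ (s + 1) ≤ γ * w :=
      calc A * 2 ^ h k * γ ^ (s + 1) = γ * (A * 2 ^ h k * γ ^ s) := by ring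
        _ ≤ γ * w := by gcongr
    simp only [treeDist, lca] at ihl ihr ⊢
    have m1 := hl.mem_leaves (i := i) (by omega) hq (by omega)
    have m2 := hl.mem_leaves (i := j) (by omega) hq (by omega)
    have m3 := hr.mem_leaves (i := i) hb hq (by omega)
    have m4 := hr.mem_leaves (i := j) hb hq (by omega)
    split_ifs with h3 h4 <;> rw [m1, m2] at h3 <;> try rw [m3, m4] at h4
    · obtain ⟨e', h5, h6⟩ := hk.left_child he
      refine ihl (by omega) (h k) e' (s + 1) (fun j h7 h8 => hk.maximal j h7 (by omega)) h6 ?_ hwl' hi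
        (by omega)
      calc (k - a) * max (2 * e') (k - a) * 2 ^ (s + 1)
          = 2 * ((k - a) * max (2 * e') (k - a)) * 2 ^ s := by ring
        _ ≤ (b - a) * max (2 * e) (b - a) * 2 ^ s := Nat.mul_le_mul_right _ h5
        _ ≤ 2 * n ^ 2 := hs
    · rcases hk.right_child he with h5 | ⟨e', h5, h6⟩
      -- To the right of `k` the level is at most `c = h k - 1`, so the count restarts there.
      · have hpos := h5 t (by omega) (by omega)
        obtain ⟨c, hc⟩ := Nat.exists_eq_add_of_lt (Nat.zero_lt_of_lt hpos)
        rw [zero_add] at hc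
        refine ihr hb c (b - k) 0 (fun j h7 h8 => ?_) (fun j _ _ _ => by omega)
          (sq_le k b (by omega)) ?_ (by omega) (by omega)
        · have := h5 j h7 h8
          omega
        · refine le_trans ?_ hwl'
          rw [hc]
          calc A * 2 ^ c * γ ^ 0 = A * 2 ^ (c + 1) * (1 / 2) := by ring
            _ ≤ A * 2 ^ (c + 1) * γ ^ (s + 1) := by gcongr
      · refine ihr hb (h k) e' (s + 1) (fun j h7 h8 => hk.maximal j (by omega) h8) h6 ?_ hwl' (by omega)
          (by omega)
        calc (b - k) * max (2 * e') (b - k) * 2 ^ (s + 1)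
            = 2 * ((b - k) * max (2 * e') (b - k)) * 2 ^ s := by ring
          _ ≤ (b - a) * max (2 * e) (b - a) * 2 ^ s := Nat.mul_le_mul_right _ h5
          _ ≤ 2 * n ^ 2 := hs
    · have h5 := hk.maximal t (by omega) (by omega)
      refine le_trans ?_ hwl
      calc A * 2 ^ h t / 2 = A * 2 ^ h t * (1 / 2) := by ring
        _ ≤ A * 2 ^ h k * γ ^ s := by
          gcongr
          · norm_num
          · exact half' s hγs

end IsBuilt

/-! ## The expected separation radius -/

section Counting

open Finset

/-- Exchanging the values at `v` and `w` moves the strict minimum from `w` to `v`. The images for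
different `v ∈ S` are disjoint, so `#S` copies embed into all functions. -/
theorem card_first_mul_le {n m : ℕ} (S : Finset (Fin n)) {w : Fin n} (hw : w ∈ S) :
    #{f : Fin n → Fin (m + 1) | ∀ v ∈ S, v ≠ w → f w < f v} * #S ≤ (m + 1) ^ n := by
  classical
  rw [mul_comm, ← card_product]
  refine (card_le_card_of_injOn (t := (univ : Finset (Fin n → Fin (m + 1))))
    (fun p => p.2 ∘ Equiv.swap p.1 w) (fun _ _ => mem_univ _) ?_).trans (by simp)
  rintro ⟨v, f⟩ h ⟨v', f'⟩ h' he
  simp only [coe_product, coe_filter, mem_univ, true_and, Set.mem_prod, mem_coe,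
    Set.mem_ofPred_eq] at h h'
  have lt : ∀ v ∈ S, ∀ f : Fin n → Fin (m + 1), (∀ v ∈ S, v ≠ w → f w < f v) → ∀ z ∈ S, z ≠ v →
      (f ∘ Equiv.swap v w) v < (f ∘ Equiv.swap v w) z := by
    intro v hv f hf z hz hzv
    simp only [Function.comp, Equiv.swap_apply_left]
    apply hf
    · rcases eq_or_ne z w with rfl | hzw
      · simpa using hv
      · rwa [Equiv.swap_apply_of_ne_of_ne hzv hzw]
    · intro hz'
      exact hzv ((Equiv.swap v w).injective (hz'.trans (Equiv.swap_apply_left v w).symm))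
  simp only at he
  obtain rfl : v = v' := by
    by_contra hne
    have h1 := lt v h.1 f h.2 v' h'.1 (Ne.symm hne)
    have h2 := lt v' h'.1 f' h'.2 v h.1 hne
    rw [he] at h1
    exact lt_asymm h1 h2
  have := (Equiv.swap v w).surjective.injective_comp_right he
  rw [this]

/-- The tie makes the value at `v` redundant, so overwriting it by an arbitrary number loses
nothing. -/
theorem card_tie_mul_le {n m : ℕ} {v w : Fin n} (h : v ≠ w) :
    #{f : Fin n → Fin (m + 1) | f v = f w} * (m + 1) ≤ (m + 1) ^ n := by
  classical
  have : #(univ : Finset (Fin (m + 1))) = m + 1 := by simp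
  rw [← this, ← card_product, this]
  refine (card_le_card_of_injOn (t := (univ : Finset (Fin n → Fin (m + 1))))
    (fun p => Function.update p.1 v p.2) (fun _ _ => mem_univ _) ?_).trans (by simp)
  rintro ⟨f, c⟩ hf ⟨f', c'⟩ hf' he
  simp only [coe_product, coe_filter, mem_univ, true_and, Set.mem_prod,
    Set.mem_ofPred_eq] at hf hf' he
  have key : ∀ z, z ≠ v → f z = f' z := fun z hz => by
    have := congrFun he z
    simpa [Function.update_of_ne hz] using this
  have hc : c = c' := by simpa using congrFun he v
  have : f = f' := by
    funext z
    rcases eq_or_ne z v with rfl | hz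
    · rw [hf.1, hf'.1, key w h.symm]
    · exact key z hz
  rw [this, hc]

/-- The probability that `w` has the least priority in `S` is at most `2 / #S`. -/
theorem card_least_mul_le {n m : ℕ} (hm : n ^ 2 ≤ m + 1) (S : Finset (Fin n)) {w : Fin n}
    (hw : w ∈ S) :
    #{f : Fin n → Fin (m + 1) | ∀ v ∈ S, f w ≤ f v} * #S ≤ 2 * (m + 1) ^ n := by
  classical
  -- Either `w` is the strict minimum or it is tied with another element of `S`. Ties have
  -- probability at most `#S / (m + 1)`, hence at most `1 / #S` by `hm`.
  have hsub : ({f | ∀ v ∈ S, f w ≤ f v} : Finset (Fin n → Fin (m + 1))) ⊆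
      ({f | ∀ v ∈ S, v ≠ w → f w < f v} : Finset (Fin n → Fin (m + 1))) ∪
        (S.erase w).biUnion fun v => {f | f v = f w} := by
    intro f hf
    simp only [mem_filter, mem_univ, true_and, mem_union, mem_biUnion, mem_erase] at hf ⊢
    by_contra! hcon
    obtain ⟨⟨v, hv, hvw, hle⟩, h2⟩ := hcon
    exact h2 v ⟨hvw, hv⟩ (le_antisymm hle (hf v hv))
  have hS : #S ≤ n := by simpa using card_le_univ S
  have h1 : #((S.erase w).biUnion fun v => ({f | f v = f w} : Finset (Fin n → Fin (m + 1)))) * #S ≤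
      (m + 1) ^ n := by
    have : #((S.erase w).biUnion fun v => ({f | f v = f w} : Finset (Fin n → Fin (m + 1)))) *
        (m + 1) ≤ #S * (m + 1) ^ n := by
      calc _ ≤ (∑ v ∈ S.erase w, #({f | f v = f w} : Finset (Fin n → Fin (m + 1)))) * (m + 1) :=
            Nat.mul_le_mul_right _ card_biUnion_le
        _ = ∑ v ∈ S.erase w, #({f | f v = f w} : Finset (Fin n → Fin (m + 1))) * (m + 1) := by
            rw [sum_mul]
        _ ≤ ∑ v ∈ S.erase w, (m + 1) ^ n :=
            sum_le_sum fun v hv => card_tie_mul_le (ne_of_mem_erase hv)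
        _ = #(S.erase w) * (m + 1) ^ n := by rw [sum_const, smul_eq_mul]
        _ ≤ #S * (m + 1) ^ n := Nat.mul_le_mul_right _ (card_le_card (erase_subset _ _))
    refine Nat.le_of_mul_le_mul_right ?_ (Nat.succ_pos m)
    calc _ = #((S.erase w).biUnion fun v => ({f | f v = f w} : Finset (Fin n → Fin (m + 1)))) *
        (m + 1) * #S := by rw [Nat.succ_eq_add_one]; ring
      _ ≤ #S * (m + 1) ^ n * #S := Nat.mul_le_mul_right _ this
      _ = (m + 1) ^ n * (#S * #S) := by ring
      _ ≤ (m + 1) ^ n * (m + 1) := by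
        gcongr
        calc #S * #S ≤ n * n := Nat.mul_le_mul hS hS
          _ = n ^ 2 := by ring
          _ ≤ m + 1 := hm
  calc _ ≤ (#{f : Fin n → Fin (m + 1) | ∀ v ∈ S, v ≠ w → f w < f v} +
        #((S.erase w).biUnion fun v => ({f | f v = f w} : Finset (Fin n → Fin (m + 1))))) * #S :=
        Nat.mul_le_mul_right _ ((card_le_card hsub).trans (card_union_le _ _))
    _ ≤ (m + 1) ^ n + (m + 1) ^ n := by
        rw [add_mul]
        exact Nat.add_le_add (card_first_mul_le S hw) h1
    _ = 2 * (m + 1) ^ n := by ring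

/-- The ranks of the elements of a finite set are at least `1, 2, 3, …` in some order. -/
theorem sum_inv_rank_le {ι : Type*} [DecidableEq ι] (μ : ι → ℝ) (s : Finset ι) :
    ∑ w ∈ s, ((#{v ∈ s | μ v ≤ μ w} : ℕ) : ℝ)⁻¹ ≤ harmonic #s := by
  induction s using Finset.induction_on_max_value μ with
  | empty => simp
  | insert a s ha hmax ih =>
    have h1 : ({v ∈ insert a s | μ v ≤ μ a} : Finset ι) = insert a s := by
      apply filter_true_of_mem
      intro v hv
      rcases mem_insert.1 hv with rfl | hv
      · exact le_rfl
      · exact hmax v hv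
    rw [sum_insert ha, h1, card_insert_of_notMem ha, harmonic_succ, add_comm]
    push_cast
    gcongr
    refine le_trans (sum_le_sum fun w hw => ?_) ih
    have hpos : 0 < #{v ∈ s | μ v ≤ μ w} := card_pos.2 ⟨w, by simp [hw]⟩
    gcongr
    exact subset_insert a s

/-- The radii form a grid of mesh `ρ / m` on `[ρ, 2 * ρ]`, and the window has length at most `δ`.
Since `ρ ≤ m * δ`, rounding costs no more than a factor of two; the condition on the right says when
window and grid can meet. -/
theorem card_cut_le {m : ℕ} (hm : 0 < m) {ρ lo hi δ : ℝ} (hρ : 0 < ρ) (hδ : hi ≤ lo + δ)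
    (hδm : ρ ≤ m * δ) :
    (#{u : Fin (m + 1) | lo ≤ (1 + (u : ℕ) / (m : ℝ)) * ρ ∧ (1 + (u : ℕ) / (m : ℝ)) * ρ < hi} : ℝ) ≤
      if ρ < hi ∧ lo ≤ 2 * ρ then (m + 1 : ℝ) * (2 * δ / ρ) else 0 := by
  have hm' : (0 : ℝ) < m := by exact_mod_cast hm
  have hδ0 : 0 < δ := by
    by_contra! h
    nlinarith
  split_ifs with h
  · set s : Finset (Fin (m + 1)) :=
      {u | lo ≤ (1 + (u : ℕ) / (m : ℝ)) * ρ ∧ (1 + (u : ℕ) / (m : ℝ)) * ρ < hi} with hs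
    have hone : 1 ≤ m * δ / ρ := by rwa [le_div_iff₀ hρ, one_mul]
    have h2 : m * δ / ρ + 1 ≤ (m + 1 : ℝ) * (2 * δ / ρ) := by
      have : 0 < δ / ρ := by positivity
      have e1 : m * δ / ρ = m * (δ / ρ) := by ring
      have e2 : 2 * δ / ρ = 2 * (δ / ρ) := by ring
      rw [e1] at hone ⊢
      rw [e2]
      nlinarith
    refine le_trans ?_ h2
    rcases s.eq_empty_or_nonempty with h0 | hne
    · rw [h0]
      simp only [card_empty, Nat.cast_zero]
      positivity
    · set c := s.min' hne with hc
      have hsub : s.image (fun u : Fin (m + 1) => (u : ℕ)) ⊆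
          Ico (c : ℕ) (c + ⌈m * δ / ρ⌉₊) := by
        intro k hk
        obtain ⟨u, hu, rfl⟩ := mem_image.1 hk
        have hcu : (c : ℕ) ≤ u := s.min'_le u hu
        have hcs := (mem_filter.1 (s.min'_mem hne)).2
        have hus := (mem_filter.1 hu).2
        rw [mem_Ico]
        refine ⟨hcu, ?_⟩
        have h3 : ((u : ℕ) / (m : ℝ) - (c : ℕ) / (m : ℝ)) * ρ < δ := by
          have := hcs.1
          rw [← hc] at this
          nlinarith [hus.2]
        have h4 : ((u : ℕ) : ℝ) - (c : ℕ) < m * δ / ρ := by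
          rw [lt_div_iff₀ hρ]
          have : (((u : ℕ) : ℝ) - (c : ℕ)) * ρ =
              m * (((u : ℕ) / (m : ℝ) - (c : ℕ) / (m : ℝ)) * ρ) := by
            field_simp
          rw [this]
          gcongr
        have h5 : ((u : ℕ) : ℝ) < ((c + ⌈m * δ / ρ⌉₊ : ℕ) : ℝ) := by
          push_cast
          linarith [Nat.le_ceil (m * δ / ρ)]
        exact_mod_cast h5
      have hcard : #s ≤ ⌈m * δ / ρ⌉₊ := by
        rw [← card_image_of_injective s Fin.val_injective]
        simpa using card_le_card hsub
      calc (#s : ℝ) ≤ ⌈m * δ / ρ⌉₊ := by exact_mod_cast hcard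
        _ ≤ m * δ / ρ + 1 := (Nat.ceil_lt_add_one (by positivity)).le
  · rw [Nat.cast_nonpos, card_eq_zero, filter_eq_empty_iff]
    rintro u - ⟨h1, h2⟩
    apply h
    have h3 : (0 : ℝ) ≤ (u : ℕ) / (m : ℝ) := by positivity
    have h4 : (u : ℕ) / (m : ℝ) ≤ 1 := by
      rw [div_le_one hm']
      exact_mod_cast Nat.lt_succ_iff.1 u.2
    constructor <;> nlinarith

/-- The radii double with each level and lie in `[μ / 2, 2 * μ)`, whose ends have ratio `4`. -/
theorem card_levels_le {ρ₀ μ : ℝ} (hρ : 0 < ρ₀) (s : Finset ℕ)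
    (h : ∀ i ∈ s, ρ₀ * 2 ^ i < 2 * μ ∧ μ ≤ 2 * (ρ₀ * 2 ^ i)) : #s ≤ 2 := by
  rcases s.eq_empty_or_nonempty with h0 | hne
  · simp [h0]
  · have hsub : s ⊆ Ico (s.min' hne) (s.min' hne + 2) := by
      intro i hi
      rw [mem_Ico]
      refine ⟨s.min'_le i hi, ?_⟩
      by_contra! hlt
      have h1 := (h _ (s.min'_mem hne)).2
      have h2 := (h i hi).1
      have h3 : ρ₀ * 2 ^ (s.min' hne + 2) ≤ ρ₀ * 2 ^ i := by
        gcongr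
        norm_num
      rw [pow_add] at h3
      linarith
    simpa using card_le_card hsub

end Counting

namespace Clustering

open Finset

/-- The priorities: the numbers drawn, made distinct. -/
noncomputable def prio (n : ℕ) (r : ℕ → ℕ) (v : ℕ) : ℝ := r v * n + v

/-- A tuple of draws as a function on all natural numbers. -/
def drawn {n m : ℕ} (f : Fin n → Fin (m + 1)) (v : ℕ) : ℕ := if h : v < n then f ⟨v, h⟩ else 0

/-- The smallest radius: a random multiple, between `1` and `2`, of `1 / (4 * I)`. -/
noncomputable def baseRadius (I : ℝ) (m u : ℕ) : ℝ := (u / m + 1) / I / 4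

/-- Priorities compare the draws first and break ties by index. Only the weak inequality of draws is
kept, so tied points all count as least. -/
theorem le_of_prio_le {n : ℕ} {r : ℕ → ℕ} {v w : ℕ} (hv : v < n)
    (h : prio n r w ≤ prio n r v) : r w ≤ r v := by
  have h' : r w * n + w ≤ r v * n + v := by
    unfold prio at h
    exact_mod_cast h
  by_contra! hlt
  have : (r v + 1) * n ≤ r w * n := Nat.mul_le_mul_right n hlt
  rw [add_mul] at this
  omega

theorem prio_inj {n : ℕ} {r : ℕ → ℕ} {v w : ℕ} (hv : v < n) (hw : w < n)
    (h : prio n r w = prio n r v) : w = v := by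
  have h1 := le_antisymm (le_of_prio_le hv h.le) (le_of_prio_le hw h.ge)
  unfold prio at h
  rw [h1] at h
  have : (w : ℝ) = v := by linarith
  exact_mod_cast this

/-- If two points have different centres, one of these centres is the first point in the order of
priority that is close to one of them, and it is close to only one of them. -/
theorem exists_cut {D : ℕ → ℕ → ℝ} {n : ℕ} {r : ℕ → ℕ} {R : ℝ} (hR : 0 ≤ R)
    (hD : ∀ i < n, D i i = 0) {x y : ℕ} (hx : x < n) (hy : y < n)
    (h : minPrio D (prio n r) R x n ≠ minPrio D (prio n r) R y n) :
    ∃ w < n, min (D w x) (D w y) ≤ R ∧ R < max (D w x) (D w y) ∧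
      ∀ v < n, min (D v x) (D v y) ≤ min (D w x) (D w y) → r w ≤ r v := by
  wlog hlt : minPrio D (prio n r) R x n < minPrio D (prio n r) R y n generalizing x y
  · obtain ⟨w, hw, h1, h2, h3⟩ := this hy hx h.symm (lt_of_le_of_ne (not_lt.1 hlt) h.symm)
    refine ⟨w, hw, ?_, ?_, fun v hv hvw => h3 v hv ?_⟩
    · rwa [min_comm]
    · rwa [max_comm]
    · rwa [min_comm (D v y), min_comm (D w y)]
  -- The centre of the point with the smaller minimum cuts the pair: were it also within `R` of `y`,
  -- the minimum at `y` would be as small.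
  obtain ⟨w, hw, hwx, he⟩ := exists_minPrio_eq (π := prio n r) hx ((hD x hx).trans_le hR)
  refine ⟨w, hw, (min_le_left _ _).trans hwx, ?_, fun v hv hvw => ?_⟩
  · refine lt_of_lt_of_le ?_ (le_max_right _ _)
    by_contra! hwy
    have := minPrio_le (D := D) (π := prio n r) hw hwy
    linarith
  · apply le_of_prio_le hv
    rw [← he]
    rcases min_le_iff.1 (hvw.trans ((min_le_left _ _).trans hwx)) with h1 | h1
    · exact minPrio_le hv h1
    · exact hlt.le.trans (minPrio_le hv h1)

/-- The expectation of the separation radius, multiplied by the number of outcomes. -/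
theorem sum_sepLevel_le {D : ℕ → ℕ → ℝ} {n K : ℕ} {I : ℝ} (hI : 0 < I)
    (hm : n ^ 2 ≤ 2 ^ K) (hD : ∀ i < n, D i i = 0)
    (hs : ∀ i < n, ∀ j < n, D i j = D j i)
    (ht : ∀ i < n, ∀ j < n, ∀ k < n, D i k ≤ D i j + D j k)
    {x y : ℕ} (hx : x < n) (hy : y < n) (hxy : 1 ≤ I * D x y) :
    ∑ p : (Fin n → Fin (2 ^ K + 1)) × Fin (2 ^ K + 1),
      baseRadius I (2 ^ K) p.2 *
        2 ^ sepLevel D (prio n (drawn p.1)) n (baseRadius I (2 ^ K) p.2) x y K ≤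
      Fintype.card ((Fin n → Fin (2 ^ K + 1)) × Fin (2 ^ K + 1)) *
        ((20 + 16 * Real.log n) * D x y) := by
  classical
  set m := 2 ^ K with hm_def
  have hm0 : 0 < m := by positivity
  set δ := D x y with hδ
  have hδ0 : 0 < δ := pos_of_mul_pos_right (lt_of_lt_of_le one_pos hxy) hI.le
  set ρ₀ : ℝ := 1 / I / 4 with hρ₀
  have hρ0 : 0 < ρ₀ := by positivity
  have hρδ : 4 * ρ₀ ≤ δ := by
    rw [hρ₀, mul_div_cancel₀ _ (by norm_num : (4 : ℝ) ≠ 0), div_le_iff₀ hI]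
    linarith
  set μ : Fin n → ℝ := fun w => min (D w x) (D w y) with hμ
  set ν : Fin n → ℝ := fun w => max (D w x) (D w y) with hν
  have hμν : ∀ w, ν w ≤ μ w + δ := by
    intro w
    have h1 := ht w w.2 x hx y hy
    have h2 := ht w w.2 y hy x hx
    rw [hs y hy x hx] at h2
    simp only [hμ, hν]
    rcases min_choice (D w x) (D w y) with h | h <;> rw [h] <;> refine max_le ?_ ?_ <;> linarith
  set N : ℝ := ((Fintype.card ((Fin n → Fin (m + 1)) × Fin (m + 1)) : ℕ) : ℝ) with hN
  have hNe : N = (m + 1 : ℝ) ^ n * (m + 1 : ℝ) := by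
    rw [hN, Fintype.card_prod]
    simp
  -- `F w` constrains the priorities and `U i w` the radius; these are separate draws, so the counts
  -- multiply. Levels outside `J` have radius below `4 * δ` and go into the additive term, as does
  -- level `0`, where the radius is at most `2 * ρ₀ ≤ δ / 2`.
  set F : Fin n → Finset (Fin n → Fin (m + 1)) := fun w =>
    {f | ∀ v ∈ ({v | μ v ≤ μ w} : Finset (Fin n)), f w ≤ f v} with hF
  set U : ℕ → Fin n → Finset (Fin (m + 1)) := fun i w =>
    {u | μ w ≤ (1 + (u : ℕ) / (m : ℝ)) * (ρ₀ * 2 ^ i) ∧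
      (1 + (u : ℕ) / (m : ℝ)) * (ρ₀ * 2 ^ i) < ν w} with hU
  set J : Finset ℕ := {i ∈ range K | 2 * δ ≤ ρ₀ * 2 ^ i} with hJ
  have hbase : ∀ u : Fin (m + 1), baseRadius I m u = (1 + (u : ℕ) / (m : ℝ)) * ρ₀ := by
    intro u
    rw [baseRadius, hρ₀]
    ring
  have hu1 : ∀ u : Fin (m + 1), (u : ℕ) / (m : ℝ) ≤ 1 := by
    intro u
    rw [div_le_one (by positivity)]
    exact_mod_cast Nat.lt_succ_iff.1 u.2
  have pointwise : ∀ p : (Fin n → Fin (m + 1)) × Fin (m + 1),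
      baseRadius I m p.2 * 2 ^ sepLevel D (prio n (drawn p.1)) n (baseRadius I m p.2) x y K ≤
        4 * δ + ∑ w, ∑ i ∈ J, 2 * (ρ₀ * 2 ^ i) *
          ((if p.1 ∈ F w then 1 else 0) * if p.2 ∈ U i w then 1 else 0) := by
    rintro ⟨f, u⟩
    have hnn : ∀ w, ∀ i ∈ J, 0 ≤ 2 * (ρ₀ * 2 ^ i) *
          ((if f ∈ F w then (1 : ℝ) else 0) * if u ∈ U i w then 1 else 0) := by
      intro w i _
      have : ∀ (p : Prop) [Decidable p], (0 : ℝ) ≤ if p then 1 else 0 := by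
        intro p _
        split_ifs <;> norm_num
      exact mul_nonneg (by positivity) (mul_nonneg (this _) (this _))
    have hu2 := hu1 u
    have hu0 : 0 ≤ (u : ℕ) / (m : ℝ) := by positivity
    rcases sepLevel_spec (D := D) (π := prio n (drawn f)) (n := n) (R := baseRadius I m u) (x := x)
      (y := y) K with h0 | ⟨hlt, hne⟩
    · rw [h0]
      have := sum_nonneg fun w (_ : w ∈ univ) => sum_nonneg (hnn w)
      simp only [hbase]
      nlinarith
    · set i := sepLevel D (prio n (drawn f)) n (baseRadius I m u) x y K
      have hle : baseRadius I m u * 2 ^ i ≤ 2 * (ρ₀ * 2 ^ i) := by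
        rw [hbase, mul_assoc]
        gcongr
        linarith
      simp only
      by_cases hi : i ∈ J
      · obtain ⟨w, hw, h1, h2, h3⟩ := exists_cut (by rw [hbase]; positivity) hD hx hy hne
        have e1 : f ∈ F ⟨w, hw⟩ := by
          simp only [hF, mem_filter, mem_univ, true_and]
          intro v hv
          have := h3 v v.2 hv
          simpa [drawn, hw] using this
        have e2 : u ∈ U i ⟨w, hw⟩ := by
          simp only [hU, mem_filter, mem_univ, true_and]
          rw [← mul_assoc, ← hbase]
          exact ⟨h1, h2⟩
        have h4 := single_le_sum (fun w _ => sum_nonneg (hnn w)) (mem_univ (⟨w, hw⟩ : Fin n))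
        refine le_trans ?_ (add_le_add (by positivity : 0 ≤ 4 * δ)
          ((single_le_sum (hnn ⟨w, hw⟩) hi).trans h4))
        rw [if_pos e1, if_pos e2]
        linarith
      · have hi' : ρ₀ * 2 ^ i < 2 * δ := by
          by_contra! hcon
          exact hi (mem_filter.2 ⟨mem_range.2 hlt, hcon⟩)
        have := sum_nonneg fun w (_ : w ∈ univ) => sum_nonneg (hnn w)
        linarith
  have hsum : ∀ w, ∀ i ∈ J, ∑ p : (Fin n → Fin (m + 1)) × Fin (m + 1), 2 * (ρ₀ * 2 ^ i) *
      ((if p.1 ∈ F w then 1 else 0) * if p.2 ∈ U i w then 1 else 0) ≤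
      if ρ₀ * 2 ^ i < ν w ∧ μ w ≤ 2 * (ρ₀ * 2 ^ i) then
        N * (8 * δ * ((#{v | μ v ≤ μ w} : ℕ) : ℝ)⁻¹) else 0 := by
    intro w i hi
    have hiK : i < K := mem_range.1 (mem_filter.1 hi).1
    have e1 : ∑ p : (Fin n → Fin (m + 1)) × Fin (m + 1), 2 * (ρ₀ * 2 ^ i) *
        ((if p.1 ∈ F w then (1 : ℝ) else 0) * if p.2 ∈ U i w then 1 else 0) =
        2 * (ρ₀ * 2 ^ i) * (#(F w) * #(U i w)) := by
      have := sum_mul_sum univ univ (fun f => if f ∈ F w then (1 : ℝ) else 0)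
        fun u => if u ∈ U i w then (1 : ℝ) else 0
      rw [← mul_sum, ← univ_product_univ, sum_product, ← this]
      simp
    rw [e1]
    have hρm : ρ₀ * 2 ^ i ≤ m * δ := by
      have : (2 : ℝ) ^ i ≤ m := by
        rw [hm_def]
        push_cast
        gcongr
        norm_num
      calc ρ₀ * 2 ^ i ≤ δ * m := by gcongr; linarith
        _ = m * δ := by ring
    have hU' := card_cut_le (lo := μ w) hm0 (by positivity : 0 < ρ₀ * 2 ^ i) (hμν w) hρm
    have hwS : w ∈ ({v | μ v ≤ μ w} : Finset (Fin n)) := by simp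
    have hS0 : (0 : ℝ) < #({v | μ v ≤ μ w} : Finset (Fin n)) := by
      exact_mod_cast card_pos.2 ⟨w, hwS⟩
    have hF' : (#(F w) : ℝ) ≤ 2 * (m + 1 : ℝ) ^ n * ((#{v | μ v ≤ μ w} : ℕ) : ℝ)⁻¹ := by
      rw [← div_eq_mul_inv, le_div_iff₀ hS0]
      exact_mod_cast card_least_mul_le (hm.trans (Nat.le_succ _)) _ hwS
    change (#(U i w) : ℝ) ≤ _ at hU'
    split_ifs at hU' ⊢ with h
    · calc 2 * (ρ₀ * 2 ^ i) * (#(F w) * #(U i w)) ≤ 2 * (ρ₀ * 2 ^ i) *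
          ((2 * (m + 1 : ℝ) ^ n * ((#{v | μ v ≤ μ w} : ℕ) : ℝ)⁻¹) *
            ((m + 1 : ℝ) * (2 * δ / (ρ₀ * 2 ^ i)))) := by gcongr
        _ = N * (8 * δ * ((#{v | μ v ≤ μ w} : ℕ) : ℝ)⁻¹) := by
          rw [hNe]
          field_simp
          ring
    · have : (#(U i w) : ℝ) = 0 := le_antisymm hU' (Nat.cast_nonneg _)
      rw [this]
      simp
  have hN0 : 0 ≤ N := Nat.cast_nonneg _
  calc _ ≤ ∑ p : (Fin n → Fin (m + 1)) × Fin (m + 1), (4 * δ + ∑ w, ∑ i ∈ J, 2 * (ρ₀ * 2 ^ i) *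
          ((if p.1 ∈ F w then 1 else 0) * if p.2 ∈ U i w then 1 else 0)) :=
        sum_le_sum fun p _ => pointwise p
    _ = N * (4 * δ) + ∑ w, ∑ i ∈ J, ∑ p : (Fin n → Fin (m + 1)) × Fin (m + 1),
          2 * (ρ₀ * 2 ^ i) * ((if p.1 ∈ F w then 1 else 0) * if p.2 ∈ U i w then 1 else 0) := by
        rw [sum_add_distrib, sum_const, card_univ, nsmul_eq_mul, sum_comm]
        congr 1
        refine sum_congr rfl fun w _ => ?_
        rw [sum_comm]
    _ ≤ N * (4 * δ) + ∑ w, N * (16 * δ * ((#{v | μ v ≤ μ w} : ℕ) : ℝ)⁻¹) := by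
        gcongr with w
        refine (sum_le_sum (hsum w)).trans ?_
        rw [← sum_filter, sum_const, nsmul_eq_mul]
        -- On `J` the bounds `ν w ≤ μ w + δ` and `2 * δ ≤ ρ₀ * 2 ^ i` turn `ρ₀ * 2 ^ i < ν w` into
        -- `ρ₀ * 2 ^ i < 2 * μ w`.
        have hc : #{i ∈ J | ρ₀ * 2 ^ i < ν w ∧ μ w ≤ 2 * (ρ₀ * 2 ^ i)} ≤ 2 := by
          refine card_levels_le (μ := μ w) hρ0 _ fun i hi => ?_
          obtain ⟨hi1, hi2, hi3⟩ := mem_filter.1 hi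
          have := (mem_filter.1 hi1).2
          have := hμν w
          exact ⟨by linarith, hi3⟩
        have hc' : (#{i ∈ J | ρ₀ * 2 ^ i < ν w ∧ μ w ≤ 2 * (ρ₀ * 2 ^ i)} : ℝ) ≤ 2 := by
          exact_mod_cast hc
        calc _ ≤ 2 * (N * (8 * δ * ((#{v | μ v ≤ μ w} : ℕ) : ℝ)⁻¹)) := by gcongr
          _ = _ := by ring
    _ = N * (4 * δ + 16 * δ * ∑ w, ((#{v | μ v ≤ μ w} : ℕ) : ℝ)⁻¹) := by
        rw [← mul_sum, ← mul_sum]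
        ring
    _ ≤ N * (4 * δ + 16 * δ * (1 + Real.log n)) := by
        gcongr
        refine (sum_inv_rank_le μ univ).trans ?_
        rw [card_univ, Fintype.card_fin]
        exact harmonic_le_one_add_log n
    _ = N * ((20 + 16 * Real.log n) * δ) := by ring

end Clustering

/-! ## The sampling program -/

namespace RealRAM

open Clustering

/-- Compute the separation radius of the points `N[10]` and `N[11]` in `R[19]`. -/
def sepProgram : Program :=
  .seq (code [.radd 14 6 0, .radd 19 6 0, .const 15 0, .sub 16 6 1, .const 19 20])
  (.loop (.le 15 16)
    (.seq (code [.add 17 10 19, .rload 15 17, .add 17 11 19, .rload 16 17, .const 18 0])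
    (.seq (.loop (.le 18 2)
      (.seq (code [.add 17 18 19, .rload 17 17, .input 18 18 10])
      (.seq (.branch (.rle 18 14) (.branch (.rle 17 15) (code [.radd 15 17 0]) .skip) .skip)
      (.seq (code [.input 18 18 11])
      (.seq (.branch (.rle 18 14) (.branch (.rle 17 16) (code [.radd 16 17 0]) .skip) .skip)
      (code [.add 18 18 1]))))))
    (.seq (.branch (.rle 15 16) (.branch (.rle 16 15) .skip (code [.radd 19 14 0]))
      (code [.radd 19 14 0]))
    (code [.radd 14 14 14, .add 15 15 1])))))

/-- The registers that are constant from the first instructions on. -/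
structure Base (n : ℕ) (σ : Memory) : Prop where
  size : σ.nat 0 = n
  one : σ.nat 1 = 1
  last : σ.nat 2 = n - 1
  zero : σ.nat 14 = 0
  rzero : σ.real 0 = 0
  rone : σ.real 3 = 1
  out : σ.out = []

/-- `τ` agrees with `σ` outside the scratch registers of `sepProgram`. -/
structure SameButScratch (σ τ : Memory) : Prop where
  nat : ∀ a, a < 15 ∨ 20 ≤ a → τ.nat a = σ.nat a
  real : ∀ a, a < 14 ∨ 20 ≤ a → τ.real a = σ.real a
  out : τ.out = σ.out

namespace SameButScratch

variable {σ τ : Memory}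

theorem refl (σ : Memory) : SameButScratch σ σ :=
  ⟨fun _ _ => rfl, fun _ _ => rfl, rfl⟩

theorem setNat (h : SameButScratch σ τ) {a v : ℕ} (ha : 15 ≤ a ∧ a < 20) :
    SameButScratch σ (τ.setNat a v) := by
  refine ⟨fun b hb => ?_, h.real, h.out⟩
  rw [nat_setNat, if_neg (by omega), h.nat b hb]

theorem setReal (h : SameButScratch σ τ) {a : ℕ} {r : ℝ} (ha : 14 ≤ a ∧ a < 20) :
    SameButScratch σ (τ.setReal a r) := by
  refine ⟨h.nat, fun b hb => ?_, h.out⟩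
  rw [real_setReal, if_neg (by omega), h.real b hb]

end SameButScratch

variable {D : ℕ → ℕ → ℝ}

/-- One step of the recursion of `minPrio`. Reals are copied by adding `R[0]`, which stays `0`. -/
theorem ok_updateMin {r : ℕ} {τ : Memory} {d ρ π m : ℝ} {Q : Memory → Prop}
    (h0 : τ.real 0 = 0) (hd : τ.real 18 = d) (hρ : τ.real 14 = ρ) (hπ : τ.real 17 = π)
    (hm : τ.real r = m) (h : Q (τ.setReal r (if d ≤ ρ then min m π else m))) :
    Ok D (.branch (.rle 18 14) (.branch (.rle 17 r) (code [.radd r 17 0]) .skip) .skip) 6 τ Q := by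
  have self : τ.setReal r m = τ := by
    rw [Memory.setReal, ← hm, Function.update_eq_self]
  refine ok_branch (T₁ := 5) (T₂ := 1) (fun h1 => ok_branch (T₁ := 4) (T₂ := 1)
    (fun h2 => ok_code rfl ?_) fun h2 => ok_skip ?_) fun h1 => ok_skip ?_ <;>
    simp only [Test.Holds, hd, hρ] at h1
  · simp only [Test.Holds, hπ, hm] at h2
    rw [if_pos h1, min_eq_right h2] at h
    simpa [hπ, h0] using h
  · simp only [Test.Holds, hπ, hm] at h2
    rwa [if_pos h1, min_eq_left (not_le.1 h2).le, self] at h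
  · rwa [if_neg h1, self] at h

/-- The outer loop doubles the radius and overwrites `R[19]` whenever the two minima differ, so the
last separating radius survives; the initial value `R` stands for level `0`. -/
theorem ok_sepProgram {π : ℕ → ℝ} {n K x y : ℕ} {R : ℝ} (hn : 1 ≤ n) (hK : 1 ≤ K) (hx : x < n)
    (hy : y < n) {σ : Memory} (hb : Base n σ) (h6 : σ.nat 6 = K) (hR : σ.real 6 = R)
    (hπ : ∀ v < n, σ.real (v + 20) = π v) (h10 : σ.nat 10 = x) (h11 : σ.nat 11 = y) :
    Ok D sepProgram (K * (n * 50 + 50) + 30) σ fun τ => SameButScratch σ τ ∧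
      τ.real 19 = R * 2 ^ sepLevel D π n R x y K := by
  obtain ⟨b0, b1, b2, b14, br0, br3, -⟩ := hb
  unfold sepProgram
  refine (ok_seq (ok_code rfl ?_)).mono (T := 16 + (K * (n * 50 + 49 + 1) + 1) + 1) (by
    rw [show n * 50 + 49 + 1 = n * 50 + 50 from rfl]; omega) fun _ h => h
  refine (ok_loop K (n * 50 + 49) (fun i τ => SameButScratch σ τ ∧ τ.nat 19 = 20 ∧
    τ.nat 16 = K - 1 ∧ τ.nat 15 = i ∧ τ.real 14 = R * 2 ^ i ∧
    τ.real 19 = R * 2 ^ sepLevel D π n R x y i) ?_ ?_ ?_).mono le_rfl fun τ h => ⟨h.1, h.2.2.2.2.2⟩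
  · refine ⟨?_, ?_⟩
    · refine .setNat (.setNat (.setNat (.setReal (.setReal (.refl σ) ?_) ?_) ?_) ?_) ?_ <;> simp
    · simp [*, sepLevel]
  · rintro i hi τ ⟨hS, t19, t16, t15, r14, r19⟩
    refine ⟨by simp only [Test.Holds, t15, t16]; omega, ?_⟩
    refine (ok_seq (ok_code rfl ?_)).mono (T := 16 + ((n * (36 + 1) + 1) + (6 + 7 + 1) + 1) + 1)
      (by omega) fun _ h => h
    refine ok_seq (T₁ := n * (36 + 1) + 1) (T₂ := 6 + 7 + 1) ?_
    refine (ok_loop n 36 (fun v ω => SameButScratch σ ω ∧ ω.nat 19 = 20 ∧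
      ω.nat 16 = K - 1 ∧ ω.nat 15 = i ∧ ω.real 14 = R * 2 ^ i ∧
      ω.real 19 = R * 2 ^ sepLevel D π n R x y i ∧ ω.nat 18 = v ∧
      ω.real 15 = minPrio D π (R * 2 ^ i) x v ∧ ω.real 16 = minPrio D π (R * 2 ^ i) y v)
      ?_ ?_ ?_).mono le_rfl ?_
    · refine ⟨?_, ?_⟩
      · refine .setNat (.setReal (.setNat (.setReal (.setNat hS ?_) ?_) ?_) ?_) ?_ <;> simp
      · have e1 := hS.real (x + 20) (by omega)
        have e2 := hS.real (y + 20) (by omega)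
        simp [t19, t16, t15, r14, r19, hS.nat 10, h10, hS.nat 11, h11, minPrio, e1, e2, hπ x hx, hπ y hy]
    · rintro v hv ω ⟨hS, w19, w16, w15, x14, x19, w18, x15, x16⟩
      refine ⟨by simp only [Test.Holds, w18, hS.nat 2 (by simp), b2]; omega, ?_⟩
      have e1 := hS.real (v + 20) (by omega)
      refine (ok_seq (ok_code rfl ?_)).mono (T := 10 + (6 + (4 + (6 + 4 + 1) + 1) + 1) + 1)
        (by omega) fun _ h => h
      refine ok_seq (T₁ := 6) (T₂ := 16) (ok_updateMin (d := D v x) (ρ := R * 2 ^ i) (π := π v)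
        (m := minPrio D π (R * 2 ^ i) x v) ?_ ?_ ?_ ?_ ?_ ?_)
      · simp [hS.real 0, br0]
      · simp [hS.nat 10, h10, w18]
      · simp [x14]
      · simp [w18, w19, e1, hπ v hv]
      · simp [x15]
      refine ok_seq (T₁ := 4) (T₂ := 11) (ok_code rfl ?_)
      refine ok_seq (T₁ := 6) (T₂ := 4) (ok_updateMin (d := D v y) (ρ := R * 2 ^ i) (π := π v)
        (m := minPrio D π (R * 2 ^ i) y v) ?_ ?_ ?_ ?_ ?_ ?_)
      · simp [hS.real 0, br0]
      · simp [hS.nat 11, h11, w18]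
      · simp [x14]
      · simp [w18, w19, e1, hπ v hv]
      · simp [x16]
      refine ok_code rfl ?_
      refine ⟨?_, ?_⟩
      · refine .setNat (.setReal (.setReal (.setReal (.setReal (.setReal (.setNat hS
          ?_) ?_) ?_) ?_) ?_) ?_) ?_ <;> simp
      · simp [w19, w16, w15, x14, x19, w18, hS.nat 1, b1, minPrio]
    · rintro ω ⟨hS, -, -, -, -, -, w18, -⟩
      simp only [Test.Holds, w18, hS.nat 2 (by simp), b2]
      omega
    · rintro ω ⟨hS, w19, w16, w15, x14, x19, w18, x15, x16⟩
      have fin : ∀ ω', SameButScratch σ ω' → ω'.nat 19 = 20 → ω'.nat 16 = K - 1 → ω'.nat 15 = i →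
          ω'.real 14 = R * 2 ^ i → ω'.real 19 = R * 2 ^ sepLevel D π n R x y (i + 1) →
          Ok D (code [.radd 14 14 14, .add 15 15 1]) 7 ω' fun τ => SameButScratch σ τ ∧
            τ.nat 19 = 20 ∧ τ.nat 16 = K - 1 ∧ τ.nat 15 = i + 1 ∧ τ.real 14 = R * 2 ^ (i + 1) ∧
            τ.real 19 = R * 2 ^ sepLevel D π n R x y (i + 1) := by
        intro ω' hS u19 u16 u15 v14 v19
        refine ok_code rfl ⟨?_, ?_⟩
        · refine .setNat (.setReal hS ?_) ?_ <;> simp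
        · simp [u19, u16, u15, v14, v19, hS.nat 1, b1]
          ring
      refine ok_seq (T₁ := 6) (T₂ := 7) (ok_branch (T₁ := 5) (T₂ := 4)
        (fun h1 => ok_branch (T₁ := 1) (T₂ := 4)
        (fun h2 => ok_skip ?_) fun h2 => ok_code rfl ?_) fun h1 => ok_code rfl ?_) <;>
        simp only [Test.Holds, x15, x16] at h1
      · simp only [Test.Holds, x15, x16] at h2
        refine fin _ hS w19 w16 w15 x14 ?_
        rw [x19, sepLevel, if_pos (le_antisymm h1 h2)]
      · simp only [Test.Holds, x15, x16] at h2
        refine fin _ (.setReal hS (by simp)) (by simpa) (by simpa) (by simpa) (by simpa) ?_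
        rw [sepLevel, if_neg fun h => h2 h.ge]
        simp [x14, hS.real 0, br0]
      · refine fin _ (.setReal hS (by simp)) (by simpa) (by simpa) (by simpa) (by simpa) ?_
        rw [sepLevel, if_neg fun h => h1 h.le]
        simp [x14, hS.real 0, br0]
  · rintro τ ⟨_, t19, t16, t15, -⟩
    simp only [Test.Holds, t15, t16]
    omega

end RealRAM

/-! ### Computing a greedy order of the points -/

namespace RealRAM

open Clustering

/-- Compute in `N[20], N[21], …` a greedy order of the points with respect to the separation
radius. -/
def orderProgram : Program :=
  .seq (code [.const 3 1, .const 8 20])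
  (.loop (.le 3 2)
    (.seq (code [.sub 9 3 1, .add 9 9 8, .load 10 9, .add 4 3 14, .add 13 3 14,
      .rcast 11 5, .rmul 11 11 6])
    (.seq (.loop (.le 4 2)
      (.seq (code [.add 9 4 8, .load 11 9])
      (.seq sepProgram
      (.seq (.branch (.rle 19 11) (code [.add 13 4 14, .radd 11 19 0]) .skip)
      (code [.add 4 4 1])))))
    (code [.add 9 3 8, .load 10 9, .add 12 13 8, .load 11 12, .store 9 11, .store 12 10,
      .add 9 3 0, .add 9 9 8, .rstore 9 11, .add 3 3 1]))))

/-- The memory after the parameters have been computed and the random numbers drawn. -/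
structure Env (n K : ℕ) (R γ : ℝ) (π : ℕ → ℝ) (σ : Memory) : Prop extends Base n σ where
  bound : σ.nat 5 = 2 ^ K
  levels : σ.nat 6 = K
  radius : σ.real 6 = R
  factor : σ.real 7 = γ
  prio : ∀ v < n, σ.real (v + 20) = π v

namespace Env

variable {n K : ℕ} {R γ : ℝ} {π : ℕ → ℝ} {σ τ : Memory}

theorem setNat (h : Env n K R γ π σ) {a v : ℕ}
    (ha : a ≠ 0 ∧ a ≠ 1 ∧ a ≠ 2 ∧ a ≠ 5 ∧ a ≠ 6 ∧ a ≠ 14) : Env n K R γ π (σ.setNat a v) := by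
  obtain ⟨⟨b0, b1, b2, b14, br0, br3, bo⟩, h5, h6, h7, h8, h9⟩ := h
  obtain ⟨a0, a1, a2, a5, a6, a14⟩ := ha
  exact ⟨⟨by simp [a0.symm, b0], by simp [a1.symm, b1], by simp [a2.symm, b2],
    by simp [a14.symm, b14], br0, br3, bo⟩, by simp [a5.symm, h5], by simp [a6.symm, h6], h7, h8, h9⟩

theorem setReal (h : Env n K R γ π σ) {a : ℕ} {r : ℝ}
    (ha : (a ≠ 0 ∧ a ≠ 3 ∧ a ≠ 6 ∧ a ≠ 7 ∧ a < 20) ∨ 20 + n ≤ a) :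
    Env n K R γ π (σ.setReal a r) := by
  obtain ⟨⟨b0, b1, b2, b14, br0, br3, bo⟩, h5, h6, h7, h8, h9⟩ := h
  refine ⟨⟨b0, b1, b2, b14, ?_, ?_, bo⟩, h5, h6, ?_, ?_, fun v hv => ?_⟩ <;>
    rw [real_setReal, if_neg (by omega)]
  all_goals first | assumption | exact h9 v hv

theorem congr (h : Env n K R γ π σ) (hS : SameButScratch σ τ) : Env n K R γ π τ := by
  obtain ⟨⟨b0, b1, b2, b14, br0, br3, bo⟩, h5, h6, h7, h8, h9⟩ := h
  obtain ⟨sn, sr, so⟩ := hS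
  refine ⟨⟨?_, ?_, ?_, ?_, ?_, ?_, so.trans bo⟩, ?_, ?_, ?_, ?_, fun v hv => ?_⟩
  all_goals first
    | (rw [sn _ (by omega)]; assumption)
    | (rw [sr _ (by omega)]; assumption)
    | (rw [sr _ (by omega)]; exact h9 v hv)

end Env

variable {D : ℕ → ℕ → ℝ}

/-- The invariant of the main loop of `orderProgram`. -/
structure OrderInv (d : ℕ → ℕ → ℕ) (n K : ℕ) (R γ : ℝ) (π : ℕ → ℝ) (p h : ℕ → ℕ) (k : ℕ)
    (σ : Memory) : Prop where
  env : Env n K R γ π σ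
  base : σ.nat 8 = 20
  index : σ.nat 3 = k
  greedy : IsGreedyOrder d n k p h
  perm : ∀ i < n, σ.nat (i + 20) = p i
  level : ∀ j, 1 ≤ j → j < k → σ.real (j + n + 20) = R * 2 ^ h j

/-- The invariant of the search for the next point in `orderProgram`. -/
structure SearchInv (d : ℕ → ℕ → ℕ) (n K : ℕ) (R γ : ℝ) (π : ℕ → ℝ) (p h : ℕ → ℕ) (k s : ℕ)
    (σ : Memory) : Prop extends OrderInv d n K R γ π p h k σ where
  previous : σ.nat 10 = p (k - 1)
  candidate : σ.nat 4 = k + s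
  best : ∃ l, σ.real 11 = R * 2 ^ l ∧ (s = 0 → l = K) ∧
    (∀ j, k ≤ j → j < k + s → l ≤ d (p (k - 1)) (p j)) ∧
    (0 < s → k ≤ σ.nat 13 ∧ σ.nat 13 < k + s ∧ l = d (p (k - 1)) (p (σ.nat 13)))

variable {d : ℕ → ℕ → ℕ} {n K : ℕ} {R γ : ℝ} {π : ℕ → ℝ} {p h : ℕ → ℕ} {k s : ℕ} {σ : Memory}

/-- The initial record `R * 2 ^ K` is no smaller than any separation radius, so the first candidate
is always accepted. -/
theorem ok_searchInit (H : OrderInv d n K R γ π p h k σ) (hk : 1 ≤ k) (hkn : k < n) :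
    Ok D (code [.sub 9 3 1, .add 9 9 8, .load 10 9, .add 4 3 14, .add 13 3 14,
      .rcast 11 5, .rmul 11 11 6]) 22 σ (SearchInv d n K R γ π p h k 0) := by
  obtain ⟨hE, h8, h3, hG, hp, hh⟩ := H
  refine ok_code rfl ⟨⟨?_, by simp [h8], by simp [h3], hG, fun i hi => by simp [hp i hi],
    fun j h1 h2 => by simp [hh j h1 h2]⟩, ?_,
    by simp [h3, hE.zero], K, ?_, fun _ => rfl,
    fun j h1 h2 => by omega, fun h => by omega⟩
  · refine .setReal (.setReal (.setNat (.setNat (.setNat (.setNat (.setNat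
      hE ?_) ?_) ?_) ?_) ?_) (.inl ?_)) (.inl ?_)
    all_goals simp
  · simpa [h3, hE.one, h8] using hp (k - 1) (by omega)
  · simp [hE.bound, hE.radius]
    ring

/-- The code writes to computed addresses; with the resulting memory in explicit form, coincidences
of addresses (such as `c = k`) can be treated afterwards. -/
theorem orderSwap_eq {c : ℕ} {v : ℝ} (h3 : σ.nat 3 = k) (h8 : σ.nat 8 = 20) (h13 : σ.nat 13 = c)
    (h11 : σ.real 11 = v) (h0 : σ.nat 0 = n) (h1 : σ.nat 1 = 1) (hpk : σ.nat (k + 20) = p k)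
    (hpc : σ.nat (c + 20) = p c) :
    [Instr.add 9 3 8, .load 10 9, .add 12 13 8, .load 11 12, .store 9 11, .store 12 10,
      .add 9 3 0, .add 9 9 8, .rstore 9 11, .add 3 3 1].foldl (Instr.det D) σ =
        (((((((((σ.setNat 9 (k + 20)).setNat 10 (p k)).setNat 12 (c + 20)).setNat 11
          (p c)).setNat (k + 20) (p c)).setNat (c + 20) (p k)).setNat 9
          (k + n)).setNat 9 (k + n + 20)).setReal (k + n + 20) v).setNat 3 (k + 1) := by
  simp [h3, h8, h13, h11, h0, h1, hpk, hpc]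

theorem ok_orderSwap (H : SearchInv d n K R γ π p h k (n - k) σ) (hk : 1 ≤ k) (hkn : k < n) :
    Ok D (code [.add 9 3 8, .load 10 9, .add 12 13 8, .load 11 12, .store 9 11, .store 12 10,
      .add 9 3 0, .add 9 9 8, .rstore 9 11, .add 3 3 1]) 31 σ
      fun τ => ∃ p h, OrderInv d n K R γ π p h (k + 1) τ := by
  obtain ⟨⟨hE, h8, h3, hG, hp, hh⟩, h10, h4, l, h11, -, hmin, hc⟩ := H
  obtain ⟨hc1, hc2, hc3⟩ := hc (by omega)
  generalize h13 : σ.nat 13 = c at *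
  have hcn : c < n := by omega
  refine ok_code rfl ?_
  rw [orderSwap_eq h3 h8 h13 h11 hE.size hE.one (hp k hkn) (hp c hcn)]
  refine ⟨p ∘ Equiv.swap k c, Function.update h k l, ?_, by simp [h8], by simp, ?_,
    fun i hi => ?_, fun j hj1 hj2 => ?_⟩
  · refine .setNat (.setReal (.setNat (.setNat (.setNat (.setNat (.setNat (.setNat (.setNat
      (.setNat hE ?_) ?_) ?_) ?_) ?_) ?_) ?_) ?_) ?_) ?_
    all_goals omega
  · rw [hc3]
    exact hG.step hk hc1 hcn fun j h1 h2 => hc3 ▸ hmin j h1 (by omega)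
  · have := hp i hi
    simp only [nat_setNat, nat_setReal, Function.comp, Equiv.swap_apply_def]
    rw [if_neg (by omega), if_neg (c := i + 20 = 9) (by omega),
      if_neg (c := i + 20 = 9) (by omega), if_neg (c := i + 20 = 12) (by omega),
      if_neg (c := i + 20 = 11) (by omega), if_neg (c := i + 20 = 10) (by omega),
      if_neg (c := i + 20 = 9) (by omega), this]
    simp only [Nat.add_right_cancel_iff]
    split_ifs with e1 e2 e2
    · rw [← e2, e1]
    · rfl
    · rfl
    · rfl
  · simp only [real_setNat, real_setReal]
    rcases Nat.lt_succ_iff_lt_or_eq.1 hj2 with hj | rfl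
    · rw [if_neg (by omega), Function.update_of_ne (by omega), hh j hj1 hj]
    · rw [if_pos rfl, Function.update_self]

theorem ok_searchStep (hn : 1 ≤ n) (hK : 1 ≤ K) (hR : 0 < R)
    (H : SearchInv (fun x y => sepLevel D π n R x y K) n K R γ π p h k s σ) (hk : 1 ≤ k)
    (hs : k + s < n) :
    Ok D (.seq (code [.add 9 4 8, .load 11 9]) (.seq sepProgram
      (.seq (.branch (.rle 19 11) (code [.add 13 4 14, .radd 11 19 0]) .skip)
        (code [.add 4 4 1])))) (K * (n * 50 + 50) + 52) σ
      (SearchInv (fun x y => sepLevel D π n R x y K) n K R γ π p h k (s + 1)) := by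
  obtain ⟨⟨hE, h8, h3, hG, hp, hh⟩, h10, h4, l, h11, hl0, hmin, hc⟩ := H
  refine (ok_seq (T₁ := 7) (T₂ := K * (n * 50 + 50) + 30 + (8 + 4 + 1) + 1)
    (ok_code rfl ?_)).mono (by omega) fun _ h => h
  have hmem : [Instr.add 9 4 8, .load 11 9].foldl (Instr.det D) σ =
        (σ.setNat 9 (k + s + 20)).setNat 11 (p (k + s)) := by
    simp [h4, h8, hp _ hs]
  rw [hmem]
  refine ok_seq (T₁ := K * (n * 50 + 50) + 30) (T₂ := 8 + 4 + 1) ?_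
  have hE' : Env n K R γ π ((σ.setNat 9 (k + s + 20)).setNat 11 (p (k + s))) :=
    (hE.setNat (by simp)).setNat (by simp)
  refine (ok_sepProgram hn hK (hG.lt (k - 1) (by omega)) (hG.lt (k + s) hs) hE'.toBase
    hE'.levels hE'.radius hE'.prio (by simp [h10]) (by simp)).mono le_rfl ?_
  rintro τ ⟨hS, h19⟩
  replace hE := hE'.congr hS
  replace h8 : τ.nat 8 = 20 := by rw [hS.nat _ (by simp)]; simpa
  replace h3 : τ.nat 3 = k := by rw [hS.nat _ (by simp)]; simpa
  replace h10 : τ.nat 10 = p (k - 1) := by rw [hS.nat _ (by simp)]; simpa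
  replace h4 : τ.nat 4 = k + s := by rw [hS.nat _ (by simp)]; simpa
  have h13 : τ.nat 13 = σ.nat 13 := by rw [hS.nat _ (by simp)]; simp
  replace h11 : τ.real 11 = R * 2 ^ l := by rw [hS.real _ (by simp)]; simpa
  replace hp : ∀ i < n, τ.nat (i + 20) = p i := fun i hi => by
    rw [hS.nat _ (by omega)]; simpa using hp i hi
  replace hh : ∀ j, 1 ≤ j → j < k → τ.real (j + n + 20) = R * 2 ^ h j := fun j h1 h2 => by
    rw [hS.real _ (by omega)]; simpa using hh j h1 h2
  -- The machine compares radii; as `R > 0`, this is the comparison of levels.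
  have hle : ∀ a b : ℕ, R * 2 ^ a ≤ R * 2 ^ b ↔ a ≤ b := fun a b => by
    rw [mul_le_mul_iff_right₀ hR]
    exact pow_le_pow_iff_right₀ (by norm_num)
  refine ok_seq (T₁ := 8) (T₂ := 4) (ok_branch (T₁ := 7) (T₂ := 1)
    (fun h1 => ok_code rfl ?_) fun h1 => ok_skip ?_) <;>
    simp only [Test.Holds, h19, h11, hle] at h1
  · refine ok_code rfl ⟨⟨?_, by simp [h8], by simp [h3], hG, fun i hi => by simp [hp i hi],
      fun j h1 h2 => by
        simp [hh j h1 h2]⟩, by simp [h10], by simp [h4, hE.one, add_assoc],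
      _, by simpa [hE.rzero] using h19, fun h => by omega, fun j h2 h3 => ?_, fun _ => ?_⟩
    · refine .setNat (.setReal (.setNat hE ?_) (.inl ?_)) ?_ <;> simp
    · rcases Nat.lt_succ_iff_lt_or_eq.1 h3 with h3 | rfl
      · exact h1.trans (hmin j h2 h3)
      · exact le_rfl
    · simp [h4, hE.zero]
  · refine ok_code rfl ⟨⟨?_, by simp [h8], by simp [h3], hG, fun i hi => by simp [hp i hi],
      fun j h1 h2 => by
        simp [hh j h1 h2]⟩, by simp [h10], by simp [h4, hE.one, add_assoc],
      l, by simpa using h11, fun h => by omega, fun j h2 h3 => ?_, fun _ => ?_⟩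
    · exact .setNat hE (by simp)
    · rcases Nat.lt_succ_iff_lt_or_eq.1 h3 with h3 | rfl
      · exact hmin j h2 h3
      · exact (not_le.1 h1).le
    -- A rejected candidate cannot be the first one, because the record then is still at level `K`.
    · have hs0 : 0 < s := by
        by_contra! h0
        rw [hl0 (by omega)] at h1
        exact h1 (sepLevel_le K)
      obtain ⟨h2, h3, h4⟩ := hc hs0
      have e : ([Instr.add 4 4 1].foldl (Instr.det D) τ).nat 13 = σ.nat 13 := by simp [h13]
      rw [e]
      exact ⟨h2, by omega, h4⟩

theorem ok_orderProgram (hn : 1 ≤ n) (hK : 1 ≤ K) (hR : 0 < R) (hE : Env n K R γ π σ)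
    (hp : ∀ i < n, σ.nat (i + 20) = i) :
    Ok D orderProgram (n * (n * (K * (n * 50 + 50) + 60) + 60) + 60) σ fun τ =>
      ∃ p h, OrderInv (fun x y => sepLevel D π n R x y K) n K R γ π p h n τ := by
  obtain ⟨T, hT⟩ : ∃ T, T = K * (n * 50 + 50) + 52 := ⟨_, rfl⟩
  have hbound : 7 + ((n - 1) * (22 + (n * (T + 1) + 34) + 1 + 1) + 1) + 1 ≤
      n * (n * (K * (n * 50 + 50) + 60) + 60) + 60 := by
    have h1 : n * (T + 1) ≤ n * (K * (n * 50 + 50) + 60) := Nat.mul_le_mul_left _ (by omega)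
    have : (n - 1) * (22 + (n * (T + 1) + 34) + 1 + 1) ≤
        n * (n * (K * (n * 50 + 50) + 60) + 60) := Nat.mul_le_mul (by omega) (by omega)
    omega
  refine (ok_seq (T₁ := 7) (T₂ := (n - 1) * (22 + (n * (T + 1) + 34) + 1 + 1) + 1)
    (ok_code rfl ?_)).mono hbound fun _ h => h
  refine (ok_loop (n - 1) (22 + (n * (T + 1) + 34) + 1)
    (fun t τ => ∃ p h, OrderInv (fun x y => sepLevel D π n R x y K) n K R γ π p h (t + 1) τ)
    ?_ ?_ ?_).mono le_rfl ?_
  · exact ⟨id, fun _ => 0, (hE.setNat (by simp)).setNat (by simp), by simp, by simp,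
      ⟨fun i hi => hi, fun i _ j _ h => h, fun k _ _ => by omega, fun k _ _ => by omega⟩,
      fun i hi => by simp [hp i hi], fun j _ _ => by omega⟩
  · rintro t ht τ ⟨p, h, H⟩
    refine ⟨by simp only [Test.Holds, H.index, H.env.last]; omega, ?_⟩
    refine (ok_seq (T₁ := 22) (T₂ := (n * (T + 1) + 1) + 31 + 1)
      ((ok_searchInit H (by omega) (by omega)).mono le_rfl fun τ H => ?_)).mono (by omega)
      fun _ h => h
    refine ok_seq (T₁ := n * (T + 1) + 1) (T₂ := 31) ?_
    refine (ok_loop (n - (t + 1)) T (SearchInv (fun x y => sepLevel D π n R x y K) n K R γ π p h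
      (t + 1)) H ?_ ?_).mono ?_ ?_
    · intro s hs ω H
      exact ⟨by simp only [Test.Holds, H.candidate, H.env.last]; omega,
        (ok_searchStep hn hK hR H (by omega) (by omega)).mono hT.ge fun _ h => h⟩
    · intro ω H
      simp only [Test.Holds, H.candidate, H.env.last]
      omega
    · have : (n - (t + 1)) * (T + 1) ≤ n * (T + 1) := Nat.mul_le_mul_right _ (by omega)
      omega
    · exact fun ω H => ok_orderSwap H (by omega) (by omega)
  · rintro τ ⟨p, h, H⟩
    simp only [Test.Holds, H.index, H.env.last]
    omega
  · rintro τ ⟨p, h, H⟩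
    rw [Nat.sub_add_cancel hn] at H
    exact ⟨p, h, H⟩

end RealRAM

/-! ### Left-to-right scan for the split position -/

/-- The position `c` is the one that `IsSplit` asks for among those scanned so far, which are
the positions between `a` and `m`. -/
structure IsSplitUpTo (h : ℕ → ℕ) (a b m c : ℕ) : Prop where
  left : a < c
  right : c < m
  maximal : ∀ j, a < j → j < m → h j ≤ h c
  before : ∀ j, a < j → j < c → h j = h c → 2 * j < a + b
  after : 2 * c < a + b → ∀ j, c < j → j < m → h j < h c

namespace IsSplitUpTo

variable {h : ℕ → ℕ} {a b m c : ℕ}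

theorem isSplit (H : IsSplitUpTo h a b b c) : IsSplit h a b c :=
  ⟨H.left, H.right, H.maximal, H.before, H.after⟩

/-- With `replace` this gives the rule of the scan: a higher position always wins, an equally high
one only while the current position is in the left half. -/
theorem keep (H : IsSplitUpTo h a b m c) (hm : h m ≤ h c) (hc : h m = h c → a + b ≤ 2 * c) :
    IsSplitUpTo h a b (m + 1) c := by
  have := H.right
  refine ⟨H.left, by omega, fun j h1 h2 => ?_, H.before, fun h1 j h2 h3 => ?_⟩
  · rcases Nat.lt_succ_iff_lt_or_eq.1 h2 with h2 | rfl
    · exact H.maximal j h1 h2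
    · exact hm
  · rcases Nat.lt_succ_iff_lt_or_eq.1 h3 with h3 | rfl
    · exact H.after h1 j h2 h3
    · exact lt_of_le_of_ne hm fun h => by have := hc h; omega

theorem replace (H : IsSplitUpTo h a b m c) (hm : h c < h m ∨ (h c = h m ∧ 2 * c < a + b)) :
    IsSplitUpTo h a b (m + 1) m := by
  have h1 := H.left
  have h2 := H.right
  refine ⟨by omega, by omega, fun j h3 h4 => ?_, fun j h3 h4 h5 => ?_, fun _ j h3 h4 => by omega⟩
  · rcases Nat.lt_succ_iff_lt_or_eq.1 h4 with h4 | rfl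
    · have := H.maximal j h3 h4
      omega
    · exact le_rfl
  · have h6 := H.maximal j h3 h4
    obtain ⟨h7, h8⟩ := hm.resolve_left (by omega)
    rcases lt_trichotomy j c with h9 | rfl | h9
    · exact H.before j h3 h9 (by omega)
    · exact h8
    · have := H.after h8 j h9 h4
      omega

end IsSplitUpTo

/-! ### Writing the tree with an explicit stack of intervals -/

namespace RealRAM

open Clustering

/-- Find the position where the interval is to be split. -/
def splitProgram : Program :=
  .seq (code [.add 13 3 1, .add 9 13 0, .add 9 9 8, .rload 11 9, .add 10 13 1, .sub 11 4 1,
    .add 15 3 4])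
  (.loop (.le 10 11)
    (.seq (code [.add 9 10 0, .add 9 9 8, .rload 9 9])
    (.seq (.branch (.rle 9 11)
      (.branch (.rle 11 9)
        (.seq (code [.add 9 13 13])
          (.branch (.le 15 9) .skip (code [.add 13 10 14, .radd 11 9 0])))
        .skip)
      (code [.add 13 10 14, .radd 11 9 0]))
    (code [.add 10 10 1]))))

/-- Process the interval on top of the stack: write a leaf, or write a node and split. -/
def treeStep : Program :=
  .seq (code [.load 4 12, .rload 4 12, .add 9 3 1])
  (.branch (.le 4 9)
    (code [.add 9 3 8, .load 9 9, .outLeaf 9, .add 3 3 1, .sub 12 12 1])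
    (.seq splitProgram
    (.seq (code [.rmul 4 7 4, .rmul 9 8 11])
    (.seq (.branch (.rle 4 9) .skip (code [.radd 4 9 0]))
    (code [.outNode 4, .rstore 12 4, .add 12 12 1, .store 12 13, .rstore 12 4])))))

/-- Write the tree. -/
def treeProgram : Program :=
  .seq (code [.add 12 0 0, .add 12 12 8, .store 12 0, .const 9 8, .rcast 8 9])
  (.seq (code [.rcast 4 5, .rmul 4 6 4, .rmul 4 8 4, .rstore 12 4, .const 3 0])
  (.loop (.le 3 2) treeStep))

/-- The part of the memory that is not changed while the tree is written. -/
structure TreeEnv (n : ℕ) (R γ : ℝ) (p h : ℕ → ℕ) (σ : Memory) : Prop where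
  size : σ.nat 0 = n
  one : σ.nat 1 = 1
  last : σ.nat 2 = n - 1
  base : σ.nat 8 = 20
  zero : σ.nat 14 = 0
  rzero : σ.real 0 = 0
  factor : σ.real 7 = γ
  eight : σ.real 8 = 8
  perm : ∀ i < n, σ.nat (i + 20) = p i
  level : ∀ j, 1 ≤ j → j < n → σ.real (j + n + 20) = R * 2 ^ h j

namespace TreeEnv

variable {n : ℕ} {R γ : ℝ} {p h : ℕ → ℕ} {σ : Memory}

theorem setNat (H : TreeEnv n R γ p h σ) {a v : ℕ}
    (ha : (a ≠ 0 ∧ a ≠ 1 ∧ a ≠ 2 ∧ a ≠ 8 ∧ a ≠ 14 ∧ a < 20) ∨ n + 20 ≤ a) :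
    TreeEnv n R γ p h (σ.setNat a v) := by
  obtain ⟨h0, h1, h2, h8, h14, r0, r7, r8, hp, hh⟩ := H
  refine ⟨?_, ?_, ?_, ?_, ?_, r0, r7, r8, fun i hi => ?_, hh⟩ <;>
    rw [nat_setNat, if_neg (by omega)]
  all_goals first | assumption | exact hp i hi

theorem setReal (H : TreeEnv n R γ p h σ) {a : ℕ} {v : ℝ}
    (ha : (a ≠ 0 ∧ a ≠ 7 ∧ a ≠ 8 ∧ a < 20) ∨ n + n + 20 ≤ a) :
    TreeEnv n R γ p h (σ.setReal a v) := by
  obtain ⟨h0, h1, h2, h8, h14, r0, r7, r8, hp, hh⟩ := H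
  refine ⟨h0, h1, h2, h8, h14, ?_, ?_, ?_, hp, fun j h1 h2 => ?_⟩ <;>
    rw [real_setReal, if_neg (by omega)]
  all_goals first | assumption | exact hh j h1 h2

theorem emit (H : TreeEnv n R γ p h σ) (s : Symbol) : TreeEnv n R γ p h (σ.emit s) := by
  obtain ⟨h0, h1, h2, h8, h14, r0, r7, r8, hp, hh⟩ := H
  exact ⟨h0, h1, h2, h8, h14, r0, r7, r8, hp, hh⟩

end TreeEnv

/-- The state of the machine when it processes the interval `[a, b)` with the weight `pw` of the
parent, where `s` is the top of the stack. -/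
structure TreeState (n : ℕ) (R γ : ℝ) (p h : ℕ → ℕ) (a s : ℕ) (σ : Memory) : Prop extends
    TreeEnv n R γ p h σ where
  position : σ.nat 3 = a
  stack : σ.nat 12 = s

/-- `τ` agrees with `σ` at the addresses of the stack below `s`. -/
def SameStack (n s : ℕ) (σ τ : Memory) : Prop :=
  ∀ i, n + n + 20 ≤ i → i < s → τ.nat i = σ.nat i ∧ τ.real i = σ.real i

theorem SameStack.trans {n s s' : ℕ} {σ τ ω : Memory} (h : SameStack n s σ τ)
    (h' : SameStack n s' τ ω) (hs : s ≤ s') : SameStack n s σ ω := fun i hi his =>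
  ⟨(h' i hi (by omega)).1.trans (h i hi his).1, (h' i hi (by omega)).2.trans (h i hi his).2⟩

variable {D : ℕ → ℕ → ℝ} {n : ℕ} {R γ : ℝ} {p h : ℕ → ℕ} {a b s : ℕ} {pw : ℝ} {σ : Memory}

/-- The invariant of the loop of `splitProgram`. -/
structure SplitInv (n : ℕ) (R γ : ℝ) (p h : ℕ → ℕ) (a b s : ℕ) (pw : ℝ) (ρ : Memory) (m : ℕ)
    (σ : Memory) : Prop extends TreeState n R γ p h a s σ where
  weight : σ.real 4 = pw
  next : σ.nat 10 = m
  top : σ.nat 11 = b - 1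
  mid : σ.nat 15 = a + b
  best : σ.real 11 = R * 2 ^ h (σ.nat 13)
  split : IsSplitUpTo h a b m (σ.nat 13)
  same : ∀ i, 20 ≤ i → σ.nat i = ρ.nat i ∧ σ.real i = ρ.real i
  out : σ.out = ρ.out

theorem SplitInv.update {ρ : Memory} {m : ℕ} (H : SplitInv n R γ p h a b s pw ρ m σ)
    (h9 : σ.real 9 = R * 2 ^ h m) (hm : IsSplitUpTo h a b (m + 1) m) :
    Ok D (code [.add 13 10 14, .radd 11 9 0]) 7 σ fun τ =>
      Ok D (code [.add 10 10 1]) 4 τ (SplitInv n R γ p h a b s pw ρ (m + 1)) := by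
  obtain ⟨⟨hE, h3, h12⟩, r4, h10, h11, h15, r11, hs, same, out⟩ := H
  refine ok_code rfl (ok_code rfl ⟨⟨?_, by simp [h3], by simp [h12]⟩, by simp [r4],
    by simp [h10, hE.one], by simp [h11], by simp [h15], by simp [h9, hE.rzero, h10, hE.zero],
    by simpa [h10, hE.zero], fun i hi => ?_, by simp [out]⟩)
  · refine .setNat (.setReal (.setNat hE (.inl ?_)) (.inl ?_)) (.inl ?_) <;> simp
  · obtain ⟨j, rfl⟩ := Nat.exists_eq_add_of_le' hi
    simp [same]

theorem SplitInv.keep {ρ : Memory} {m : ℕ} (H : SplitInv n R γ p h a b s pw ρ m σ)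
    (hm : IsSplitUpTo h a b (m + 1) (σ.nat 13)) :
    Ok D (code [.add 10 10 1]) 4 σ (SplitInv n R γ p h a b s pw ρ (m + 1)) := by
  obtain ⟨⟨hE, h3, h12⟩, r4, h10, h11, h15, r11, hs, same, out⟩ := H
  refine ok_code rfl ⟨⟨?_, by simp [h3], by simp [h12]⟩, by simp [r4],
    by simp [h10, hE.one], by simp [h11], by simp [h15], by simp [r11], by simpa,
    fun i hi => ?_, by simp [out]⟩
  · refine .setNat hE (.inl ?_); simp
  · obtain ⟨j, rfl⟩ := Nat.exists_eq_add_of_le' hi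
    simp [same]

theorem ok_splitProgram (hR : 0 < R) (H : TreeState n R γ p h a s σ) (h4 : σ.nat 4 = b)
    (r4 : σ.real 4 = pw) (hab : a + 2 ≤ b) (hb : b ≤ n) :
    Ok D splitProgram (n * 40 + 30) σ (SplitInv n R γ p h a b s pw σ b) := by
  have hle : ∀ a b : ℕ, R * 2 ^ a ≤ R * 2 ^ b ↔ a ≤ b := fun a b => by
    rw [mul_le_mul_iff_right₀ hR]
    exact pow_le_pow_iff_right₀ (by norm_num)
  obtain ⟨hE, h3, h12⟩ := H
  refine (ok_seq (T₁ := 22) (T₂ := (b - (a + 2)) * (38 + 1) + 1) (ok_code rfl ?_)).mono (by omega)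
    fun _ h => h
  refine (ok_loop (b - (a + 2)) 38 (fun i τ => SplitInv n R γ p h a b s pw σ (a + 2 + i) τ)
    ?_ ?_ ?_).mono le_rfl ?_
  · have e := hE.level (a + 1) (by omega) (by omega)
    have e13 : ([Instr.add 13 3 1, .add 9 13 0, .add 9 9 8, .rload 11 9, .add 10 13 1, .sub 11 4 1,
        .add 15 3 4].foldl (Instr.det D) σ).nat 13 = a + 1 := by simp [h3, hE.one]
    refine ⟨⟨?_, by simp [h3], by simp [h12]⟩, by simp [r4],
      by simp [h3, hE.one], by simp [h4, hE.one], by simp [h3, h4], ?_, ?_, fun i hi => ?_,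
      by simp⟩
    · refine .setNat (.setNat (.setNat (.setReal (.setNat (.setNat (.setNat hE
        (.inl ?_)) (.inl ?_)) (.inl ?_)) (.inl ?_)) (.inl ?_)) (.inl ?_)) (.inl ?_) <;> simp
    · rw [e13, ← e]
      simp [h3, hE.one, hE.base, hE.size]
    · rw [e13]
      refine ⟨by omega, by omega, fun j h1 h2 => ?_, fun j h1 h2 => by omega,
        fun _ j h1 h2 => by omega⟩
      obtain rfl : j = a + 1 := by omega
      exact le_rfl
    · obtain ⟨j, rfl⟩ := Nat.exists_eq_add_of_le' hi
      simp
  · intro i hi τ H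
    set m := a + 2 + i with hm
    have hmn : m < n := by omega
    refine ⟨by simp only [Test.Holds, H.next, H.top]; omega, ?_⟩
    refine (ok_seq (T₁ := 10) (T₂ := 16 + 4 + 1) (ok_code rfl ?_)).mono (by omega) fun _ h => h
    have hmem : [Instr.add 9 10 0, .add 9 9 8, .rload 9 9].foldl (Instr.det D) τ =
        ((τ.setNat 9 (m + n)).setNat 9 (m + n + 20)).setReal 9 (R * 2 ^ h m) := by
      simp [H.next, H.size, H.base, H.level m (by omega) hmn]
    rw [hmem]
    have set9 : ∀ (τ : Memory) (v : ℕ), SplitInv n R γ p h a b s pw σ m τ →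
        SplitInv n R γ p h a b s pw σ m (τ.setNat 9 v) := by
      rintro τ v ⟨⟨hE, h3, h12⟩, r4, h10, h11, h15, r11, hs, same, out⟩
      refine ⟨⟨.setNat hE (.inl (by simp)), by simp [h3], by simp [h12]⟩, by simp [r4],
        by simp [h10], by simp [h11], by simp [h15], by simp [r11], by simpa,
        fun i hi => ?_, by simp [out]⟩
      obtain ⟨j, rfl⟩ := Nat.exists_eq_add_of_le' hi
      simp [same]
    have H' : SplitInv n R γ p h a b s pw σ m
        (((τ.setNat 9 (m + n)).setNat 9 (m + n + 20)).setReal 9 (R * 2 ^ h m)) := by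
      obtain ⟨⟨hE, h3, h12⟩, r4, h10, h11, h15, r11, hs, same, out⟩ :=
        set9 _ (m + n + 20) (set9 τ (m + n) H)
      refine ⟨⟨.setReal hE (.inl (by simp)), by simpa, by simpa⟩, by simpa,
        by simpa, by simpa, by simpa, by simpa, by simpa,
        fun i hi => ?_, by simpa⟩
      obtain ⟨j, rfl⟩ := Nat.exists_eq_add_of_le' hi
      simpa using same (j + 20) hi
    have r9 : (((τ.setNat 9 (m + n)).setNat 9 (m + n + 20)).setReal 9 (R * 2 ^ h m)).real 9 =
        R * 2 ^ h m := by simp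
    generalize ((τ.setNat 9 (m + n)).setNat 9 (m + n + 20)).setReal 9 (R * 2 ^ h m) = ω at H' r9
    clear hmem H
    generalize hc : ω.nat 13 = c
    have hs := H'.split
    have r11 := H'.best
    rw [hc] at hs r11
    refine ok_seq (T₁ := 16) (T₂ := 4) ((ok_branch (T₁ := 14) (T₂ := 7) (fun h1 =>
      ok_branch (T₁ := 13) (T₂ := 1) (fun h2 => ok_seq (T₁ := 4) (T₂ := 8) (ok_code rfl
      (ok_branch (T₁ := 1) (T₂ := 7) (fun h3 => ok_skip ?_) fun h3 => ?_)))
      fun h2 => ok_skip ?_) fun h1 => ?_).mono (by simp) fun _ h => h) <;>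
      simp only [Test.Holds, r9, r11, hle] at h1
    · simp only [Test.Holds, r9, r11, hle] at h2
      refine (set9 ω _ H').keep ?_
      simp [Test.Holds, H'.mid, hc] at h3 ⊢
      exact hs.keep h1 fun _ => by omega
    · simp only [Test.Holds, r9, r11, hle] at h2
      refine (set9 ω _ H').update (by simpa) (hs.replace (.inr ⟨le_antisymm h2 h1, ?_⟩))
      simp [Test.Holds, H'.mid, hc] at h3
      omega
    · simp only [Test.Holds, r9, r11, hle] at h2
      exact H'.keep (hc ▸ hs.keep h1 fun h => absurd h.ge h2)
    · exact H'.update r9 (hs.replace (.inl (not_le.1 h1)))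
  · intro τ H
    simp only [Test.Holds, H.next, H.top]
    omega
  · intro τ H
    rwa [show a + 2 + (b - (a + 2)) = b by omega] at H

/-- A single leaf is written and the stack is popped. -/
theorem ok_treeStep_leaf (H : TreeState n R γ p h a s σ) (h4 : σ.nat s = a + 1) (ha : a < n) :
    Ok D treeStep (n * 40 + 100) σ fun τ => TreeState n R γ p h (a + 1) (s - 1) τ ∧
      τ.out = σ.out ++ [.leaf (p a)] ∧ SameStack n s σ τ := by
  obtain ⟨hE, h3, h12⟩ := H
  refine (ok_seq (T₁ := 10) (T₂ := 17) (ok_code rfl ((ok_branch (T₁ := 16) (T₂ := 0)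
    (fun _ => ok_code rfl ?_) fun h1 => absurd ?_ h1).mono (by simp) fun _ h => h))).mono
    (by omega) fun _ h => h
  · have := hE.perm a ha
    refine ⟨⟨?_, by simp [h3, hE.one], by simp [h12, hE.one]⟩, by simp [h3, hE.base, this],
      fun i hi his => ?_⟩
    · refine .setNat (.setNat (.emit (.setNat (.setNat (.setNat (.setReal (.setNat hE
        (.inl ?_)) (.inl ?_)) (.inl ?_)) (.inl ?_)) (.inl ?_)) _) (.inl ?_)) (.inl ?_) <;> simp
    · obtain ⟨j, rfl⟩ := Nat.exists_eq_add_of_le' (by omega : 20 ≤ i)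
      simp
  · simp [Test.Holds, h12, h3, h4, hE.one]

/-- A node is written and the two parts of the interval are put on the stack. -/
theorem ok_treeStep_node (hR : 0 < R) (H : TreeState n R γ p h a s σ) (h4 : σ.nat s = b)
    (r4 : σ.real s = pw) (hab : a + 2 ≤ b) (hb : b ≤ n) (hs : n + n + 20 ≤ s) :
    Ok D treeStep (n * 40 + 100) σ fun τ => ∃ k w, IsSplit h a b k ∧
      w = min (γ * pw) (8 * R * 2 ^ h k) ∧ TreeState n R γ p h a (s + 1) τ ∧
      τ.out = σ.out ++ [.node w] ∧ SameStack n s σ τ ∧ τ.nat s = b ∧ τ.real s = w ∧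
      τ.nat (s + 1) = k ∧ τ.real (s + 1) = w := by
  obtain ⟨hE, h3, h12⟩ := H
  obtain ⟨s', rfl⟩ := Nat.exists_eq_add_of_le' (by omega : 20 ≤ s)
  refine (ok_seq (T₁ := 10) (T₂ := (n * 40 + 30) + (7 + (5 + 16 + 1) + 1) + 1 + 1) (ok_code rfl
    ((ok_branch (T₁ := 0) (T₂ := (n * 40 + 30) + (7 + (5 + 16 + 1) + 1) + 1)
      (fun h1 => absurd h1 ?_) fun h1 => ?_).mono (by simp) fun _ h => h))).mono
    (by omega) fun _ h => h
  · simp [Test.Holds, h12, h3, h4, hE.one]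
    omega
  refine ok_seq (T₁ := n * 40 + 30) (T₂ := 7 + (5 + 16 + 1) + 1)
    ((ok_splitProgram (b := b) (pw := pw) hR (a := a) (s := s' + 20) (p := p) (h := h) (γ := γ)
      ⟨.setNat (.setReal (.setNat hE (.inl ?_)) (.inl ?_)) (.inl ?_), ?_, ?_⟩ ?_ ?_ hab hb).mono
      le_rfl ?_)
  iterate 3 simp
  · simp [h3]
  · simp [h12]
  · simp [h12, h4]
  · simp [h12, r4]
  rintro τ ⟨⟨hE, h3, h12⟩, r4, h10, h11, h15, r11, hsp, same, out⟩
  have same' : ∀ i, 20 ≤ i → τ.nat i = σ.nat i ∧ τ.real i = σ.real i := by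
    intro i hi
    obtain ⟨j, rfl⟩ := Nat.exists_eq_add_of_le' hi
    simpa using same (j + 20) hi
  replace out : τ.out = σ.out := by simpa using out
  clear same
  generalize h13 : τ.nat 13 = k at hsp r11
  refine ok_seq (T₁ := 7) (T₂ := 5 + 16 + 1) (ok_code rfl ?_)
  have hmem : [Instr.rmul 4 7 4, .rmul 9 8 11].foldl (Instr.det D) τ =
      (τ.setReal 4 (γ * pw)).setReal 9 (8 * R * 2 ^ h k) := by
    simp [hE.factor, hE.eight, r4, r11, mul_assoc]
  rw [hmem]
  have fin : ∀ ω : Memory, TreeEnv n R γ p h ω → ω.nat 3 = a → ω.nat 12 = s' + 20 →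
      ω.real 4 = min (γ * pw) (8 * R * 2 ^ h k) → ω.out = σ.out → ω.nat 13 = k →
      (∀ i, 20 ≤ i → ω.nat i = σ.nat i ∧ ω.real i = σ.real i) →
      Ok D (code [.outNode 4, .rstore 12 4, .add 12 12 1, .store 12 13, .rstore 12 4]) 16 ω
      fun τ => ∃ k w, IsSplit h a b k ∧
        w = min (γ * pw) (8 * R * 2 ^ h k) ∧ TreeState n R γ p h a (s' + 20 + 1) τ ∧
        τ.out = σ.out ++ [.node w] ∧ SameStack n (s' + 20) σ τ ∧ τ.nat (s' + 20) = b ∧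
        τ.real (s' + 20) = w ∧ τ.nat (s' + 20 + 1) = k ∧ τ.real (s' + 20 + 1) = w := by
    intro ω hE h3 h12 r4 out h13 same
    refine ok_code rfl ⟨k, min (γ * pw) (8 * R * 2 ^ h k), hsp.isSplit, rfl, ?_⟩
    generalize min (γ * pw) (8 * R * 2 ^ h k) = w at r4
    have hmem : [Instr.outNode 4, .rstore 12 4, .add 12 12 1, .store 12 13, .rstore 12 4].foldl
        (Instr.det D) ω = (((((ω.emit (.node w)).setReal (s' + 20) w).setNat 12 (s' + 20 + 1)).setNat
          (s' + 20 + 1) k).setReal (s' + 20 + 1) w) := by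
      simp [r4, h12, hE.one, h13]
    rw [hmem]
    refine ⟨⟨?_, by simp [h3], by simp⟩, by simp [out], fun i hi his => ?_, ?_, by simp, by simp,
      by simp⟩
    · refine .setReal (.setNat (.setNat (.setReal (.emit hE _) (.inr hs)) (.inl ?_)) (.inr ?_))
        (.inr ?_)
      · simp
      · omega
      · omega
    · simp only [nat_setReal, nat_setNat, nat_emit, real_setReal, real_setNat, real_emit]
      rw [if_neg (by omega), if_neg (by omega), if_neg (by omega), if_neg (by omega)]
      exact same i (by omega)
    · have := (same (s' + 20) (by omega)).1
      simp [this, h4]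
  refine ok_seq (T₁ := 5) (T₂ := 16) (ok_branch (T₁ := 1) (T₂ := 4) (fun h1 => ok_skip ?_)
    fun h1 => ok_code rfl ?_)
  · simp [Test.Holds] at h1
    refine fin _ (.setReal (.setReal hE (.inl (by simp))) (.inl (by simp))) (by simpa) (by simpa)
      (by simp [min_eq_left h1]) (by simpa) (by simpa) fun i hi => ?_
    obtain ⟨j, rfl⟩ := Nat.exists_eq_add_of_le' hi
    simpa using same' (j + 20) hi
  · simp [Test.Holds] at h1
    refine fin _ (.setReal (.setReal (.setReal hE (.inl (by simp))) (.inl (by simp)))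
      (.inl (by simp))) (by simpa) (by simpa)
      (by simp [min_eq_right h1.le, hE.rzero]) (by simpa) (by simpa) fun i hi => ?_
    obtain ⟨j, rfl⟩ := Nat.exists_eq_add_of_le' hi
    simpa using same' (j + 20) hi

/-- The interval on top of the stack is processed completely. -/
theorem reach_tree {V : Type*} (e : Fin n ≃ V) {q : ℕ → V} (hq : ∀ i < n, (e.symm (q i) : ℕ) = p i)
    (hR : 0 < R) (N : ℕ) : ∀ a b s pw σ, b - a ≤ N → a < b → b ≤ n → n + n + 20 ≤ s →
      TreeState n R γ p h a s σ → σ.nat s = b → σ.real s = pw →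
      ∃ t ≤ (2 * (b - a) - 1) * (n * 40 + 101), ∃ τ T, IsBuilt q h γ (8 * R) a b pw T ∧
        τ.out = σ.out ++ encodeTree e T ∧ TreeState n R γ p h b (s - 1) τ ∧ SameStack n s σ τ ∧
        ∀ K, Reach D (.loop (.le 3 2) treeStep :: K, σ) t (.loop (.le 3 2) treeStep :: K, τ) := by
  induction N with
  | zero => intro a b s pw σ h1 h2; omega
  | succ N ih =>
    intro a b s pw σ hN hab hb hs H h4 r4
    have htest : (Test.le 3 2).Holds σ := by
      simp only [Test.Holds, H.position, H.last]
      omega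
    rcases (by omega : b = a + 1 ∨ a + 2 ≤ b) with rfl | hab'
    · obtain ⟨t, ht, τ, ⟨hτ, out, hS⟩, hr⟩ := ok_treeStep_leaf (D := D) H h4 hb
      refine ⟨1 + t, ?_, τ, _, .leaf a pw, ?_, hτ, hS, fun K =>
        (Reach.loop_enter htest).trans (hr _)⟩
      · rw [show 2 * (a + 1 - a) - 1 = 1 by omega]
        omega
      · rw [out, encodeTree, hq a hb]
    · obtain ⟨t, ht, τ, ⟨k, w, hk, hw, hτ, out, hS, n0, r0, n1, r1⟩, hr⟩ :=
        ok_treeStep_node (D := D) hR H h4 r4 hab' hb hs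
      have hk1 := hk.left
      have hk2 := hk.right
      -- The stack now holds the right part below the left part, both with parent weight `w`.
      -- Processing the left part leaves the entry of the right part intact, and prefix order
      -- results.
      obtain ⟨t₁, ht₁, τ₁, T₁, hT₁, out₁, hτ₁, hS₁, hr₁⟩ := ih a k (s + 1) w τ (by omega) hk1
        (by omega) (by omega) hτ n1 r1
      rw [Nat.add_sub_cancel] at hτ₁
      obtain ⟨t₂, ht₂, τ₂, T₂, hT₂, out₂, hτ₂, hS₂, hr₂⟩ := ih k b s w τ₁ (by omega) hk2
        hb hs hτ₁ ((hS₁ s hs (by omega)).1.trans n0) ((hS₁ s hs (by omega)).2.trans r0)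
      refine ⟨1 + (t + (t₁ + t₂)), ?_, τ₂, .node w T₁ T₂, .node hk hw hT₁ hT₂, ?_, hτ₂,
        (hS.trans hS₁ (by omega)).trans hS₂ le_rfl,
        fun K => (Reach.loop_enter htest).trans ((hr _).trans ((hr₁ _).trans (hr₂ _)))⟩
      -- A full binary tree with `ℓ` leaves has `2 * ℓ - 1` vertices, and each takes one round of
      -- the loop.
      · obtain ⟨c, rfl⟩ := Nat.exists_eq_add_of_lt hk1
        obtain ⟨d, rfl⟩ := Nat.exists_eq_add_of_lt hk2
        rw [show 2 * (a + c + 1 - a) - 1 = 2 * c + 1 by omega] at ht₁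
        rw [show 2 * (a + c + 1 + d + 1 - (a + c + 1)) - 1 = 2 * d + 1 by omega] at ht₂
        rw [show 2 * (a + c + 1 + d + 1 - a) - 1 = (2 * c + 1) + (2 * d + 1) + 1 by omega]
        have : ((2 * c + 1) + (2 * d + 1) + 1) * (n * 40 + 101) = (2 * c + 1) * (n * 40 + 101) +
          (2 * d + 1) * (n * 40 + 101) + (n * 40 + 101) := by ring
        omega
      · rw [out₂, out₁, out, encodeTree]
        simp

/-- The root is given a fictitious parent of weight `8 * (R * 2 ^ K)`. The position reaches `n` just
when the stack is exhausted, so testing the position is enough. -/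
theorem ok_treeProgram {V : Type*} (e : Fin n ≃ V) {K : ℕ} {π : ℕ → ℝ} {d : ℕ → ℕ → ℕ}
    (hn : 1 ≤ n) (hR : 0 < R) (H : OrderInv d n K R γ π p h n σ) {q : ℕ → V}
    (hq : ∀ i < n, (e.symm (q i) : ℕ) = p i) :
    Ok D treeProgram (2 * n * (n * 40 + 101) + 60) σ fun τ =>
      ∃ T, IsBuilt q h γ (8 * R) 0 n (8 * (R * 2 ^ K)) T ∧ τ.out = encodeTree e T := by
  obtain ⟨hE, h8, h3, hG, hp, hh⟩ := H
  refine (ok_seq (T₁ := 16) (T₂ := 16 + ((2 * n - 1) * (n * 40 + 101) + 1) + 1)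
    (ok_code rfl ?_)).mono ?_ fun _ h => h
  swap
  · have : (2 * n - 1) * (n * 40 + 101) ≤ 2 * n * (n * 40 + 101) :=
      Nat.mul_le_mul_right _ (by omega)
    omega
  have hmem₁ : [Instr.add 12 0 0, .add 12 12 8, .store 12 0, .const 9 8, .rcast 8 9].foldl
      (Instr.det D) σ = ((((σ.setNat 12 (n + n)).setNat 12 (n + n + 20)).setNat (n + n + 20)
        n).setNat 9 8).setReal 8 8 := by
    simp [hE.size, h8]
  rw [hmem₁]
  refine ok_seq (T₁ := 16) (T₂ := (2 * n - 1) * (n * 40 + 101) + 1) (ok_code rfl ?_)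
  have hmem₂ : [Instr.rcast 4 5, .rmul 4 6 4, .rmul 4 8 4, .rstore 12 4, .const 3 0].foldl
      (Instr.det D) (((((σ.setNat 12 (n + n)).setNat 12 (n + n + 20)).setNat (n + n + 20)
        n).setNat 9 8).setReal 8 8) = (((((((((σ.setNat 12 (n + n)).setNat 12
        (n + n + 20)).setNat (n + n + 20) n).setNat 9 8).setReal 8 8).setReal 4 (2 ^ K)).setReal 4
        (R * 2 ^ K)).setReal 4 (8 * (R * 2 ^ K))).setReal (n + n + 20) (8 * (R * 2 ^ K))).setNat 3
        0 := by
    simp [hE.bound, hE.radius]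
  generalize hμ : [Instr.rcast 4 5, .rmul 4 6 4, .rmul 4 8 4, .rstore 12 4, .const 3 0].foldl
      (Instr.det D) (((((σ.setNat 12 (n + n)).setNat 12 (n + n + 20)).setNat (n + n + 20)
        n).setNat 9 8).setReal 8 8) = μ at hmem₂
  have hout : μ.out = [] := by simp [hmem₂, hE.out]
  have hT : TreeState n R γ p h 0 (n + n + 20) μ := by
    rw [hmem₂]
    refine ⟨.setNat (.setReal (.setReal (.setReal (.setReal ?_ (.inl ?_)) (.inl ?_)) (.inl ?_))
      (.inr le_rfl)) (.inl ?_), by simp, by simp⟩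
    · refine ⟨by simp [hE.size], by simp [hE.one], by simp [hE.last], by simp [h8],
        by simp [hE.zero], by simp [hE.rzero], by simp [hE.factor], by simp, fun i hi => ?_,
        fun j h1 h2 => by simp [hh j h1 h2]⟩
      simp only [nat_setReal, nat_setNat]
      rw [if_neg (by omega), if_neg (by omega), if_neg (by omega), if_neg (by omega), hp i hi]
    all_goals simp
  obtain ⟨t, ht, τ, T, hB, out, hτ, -, hr⟩ := reach_tree (D := D) e hq hR n 0 n (n + n + 20)
    (8 * (R * 2 ^ K)) μ (by omega) (by omega) le_rfl le_rfl hT (by simp [hmem₂]) (by simp [hmem₂])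
  rw [hout] at out
  refine ⟨t + 1, by simpa using ht, τ, ⟨T, hB, out⟩, fun K => (hr K).trans (Reach.loop_exit ?_)⟩
  simp only [Test.Holds, hτ.position, hτ.last]
  omega

end RealRAM

/-! ### Parameters, random draws and the complete program -/

namespace RealRAM

open Clustering Finset

/-- Compute the sum of all distances and the sum of their inverses. -/
def sumProgram : Program :=
  .seq (code [.const 1 1, .sub 2 0 1, .rcast 3 1])
  (.loop (.le 3 2)
    (.seq (code [.const 4 0])
    (.seq (.loop (.le 4 2)
      (code [.input 4 3 4, .radd 1 1 4, .rdiv 4 3 4, .radd 2 2 4, .add 4 4 1]))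
    (code [.add 3 3 1]))))

/-- Compute the number of levels and the decay factor of the weights. -/
def paramProgram : Program :=
  .seq (code [.rcast 4 0, .rmul 5 1 2, .rmul 5 5 4, .rmul 5 5 4, .const 5 1, .rcast 4 1])
  (.seq (.loop (.rle 4 5) (code [.radd 4 4 4, .add 5 5 5, .add 6 6 1]))
  (.seq (code [.const 8 1])
  (.seq (.loop (.le 8 0) (code [.add 8 8 8, .add 7 7 1]))
  (code [.const 8 4, .rcast 4 8, .rcast 8 7, .rmul 4 4 8, .rdiv 4 3 4, .rsub 7 3 4, .const 3 0]))))

/-- Draw the priorities of the points. -/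
def drawProgram : Program :=
  .loop (.le 3 2)
    (.seq (.instr (.draw 9 5))
    (code [.rcast 4 9, .rcast 8 0, .rmul 4 4 8, .rcast 8 3, .radd 4 4 8, .const 9 20, .add 9 3 9,
      .rstore 9 4, .add 3 3 1]))

/-- Compute the smallest radius from the number that has been drawn last. -/
def radiusProgram : Program :=
  code [.rcast 4 9, .rcast 8 5, .rdiv 4 4 8, .radd 4 4 3, .rdiv 6 4 2, .const 9 4, .rcast 8 9,
    .rdiv 6 6 8, .const 3 0]

/-- List the points in the given order. -/
def identityProgram : Program :=
  .loop (.le 3 2) (code [.const 9 20, .add 9 3 9, .store 9 3, .add 3 3 1])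

/-- The sampling program. -/
def mainProgram : Program :=
  .seq sumProgram (.seq paramProgram (.seq drawProgram (.seq (.instr (.draw 9 5))
    (.seq radiusProgram (.seq identityProgram (.seq orderProgram treeProgram))))))

variable {D : ℕ → ℕ → ℝ} {n : ℕ}

/-- The memory after the distances have been summed up. -/
structure SumInv (n : ℕ) (S I : ℝ) (σ : Memory) : Prop extends Base n σ where
  n6 : σ.nat 6 = 0
  n7 : σ.nat 7 = 0
  r1 : σ.real 1 = S
  r2 : σ.real 2 = I

/-- Since `1 / 0 = 0`, the diagonal of a distance matrix contributes nothing to the sum of inverses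
and needs no test. -/
theorem ok_sumProgram (hn : 1 ≤ n) :
    Ok D sumProgram (n * (n * 17 + 12) + 12) (initial mainProgram n).2
      (SumInv n (∑ i ∈ range n, ∑ j ∈ range n, D i j)
        (∑ i ∈ range n, ∑ j ∈ range n, 1 / D i j)) := by
  refine (ok_seq (T₁ := 10) (T₂ := n * (n * 17 + 11 + 1) + 1) (ok_code rfl ?_)).mono
    (by rw [show n * 17 + 11 + 1 = n * 17 + 12 from rfl]; omega) fun _ h => h
  refine (ok_loop n (n * 17 + 11) (fun i τ => SumInv n (∑ i ∈ range i, ∑ j ∈ range n, D i j)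
    (∑ i ∈ range i, ∑ j ∈ range n, 1 / D i j) τ ∧ τ.nat 3 = i) ?_ ?_ ?_).mono le_rfl
    fun τ h => h.1
  · simp only [initial]
    exact ⟨⟨⟨by simp, by simp, by simp, by simp, by simp, by simp, by simp⟩, by simp, by simp,
      by simp, by simp⟩, by simp⟩
  · rintro i hi τ ⟨⟨⟨b0, b1, b2, b14, c0, c3, bo⟩, n6, n7, r1, r2⟩, h3⟩
    refine ⟨by simp only [Test.Holds, h3, b2]; omega, ?_⟩
    refine (ok_seq (T₁ := 4) (T₂ := n * (16 + 1) + 1 + 4 + 1) (ok_code rfl ?_)).mono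
      (by omega) fun _ h => h
    refine ok_seq (T₁ := n * (16 + 1) + 1) (T₂ := 4) ?_
    refine (ok_loop n 16 (fun k τ => SumInv n
      (∑ i ∈ range i, ∑ j ∈ range n, D i j + ∑ j ∈ range k, D i j)
      (∑ i ∈ range i, ∑ j ∈ range n, 1 / D i j + ∑ j ∈ range k, 1 / D i j) τ ∧
      τ.nat 3 = i ∧ τ.nat 4 = k) ?_ ?_ ?_).mono le_rfl ?_
    · exact ⟨⟨⟨by simpa, by simpa, by simpa, by simpa, by simpa, by simpa, by simpa⟩, by simpa,
        by simpa, by simpa, by simpa using r2⟩, by simpa, by simp⟩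
    · rintro k hk τ ⟨⟨⟨b0, b1, b2, b14, c0, c3, bo⟩, n6, n7, r1, r2⟩, h3, h4⟩
      refine ⟨by simp only [Test.Holds, h4, b2]; omega, ok_code rfl
        ⟨⟨⟨by simpa, by simpa, by simpa, by simpa, by simpa, by simpa, by simpa⟩, by simpa,
        by simpa, ?_, ?_⟩, by simpa, ?_⟩⟩
      · simp [r1, h3, h4, sum_range_succ, add_assoc]
      · simp [r2, h3, h4, c3, sum_range_succ, add_assoc]
      · simp [h4, b1]
    · rintro τ ⟨H, h3, h4⟩
      simp only [Test.Holds, h4, H.last]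
      omega
    · rintro τ ⟨⟨⟨b0, b1, b2, b14, c0, c3, bo⟩, n6, n7, r1, r2⟩, h3, h4⟩
      refine ok_code rfl ⟨⟨⟨by simpa, by simpa, by simpa, by simpa, by simpa, by simpa, by simpa⟩,
        by simpa, by simpa, ?_, ?_⟩, by simp [h3, b1]⟩
      · rw [sum_range_succ]
        simpa
      · rw [sum_range_succ]
        simpa using r2
  · rintro τ ⟨H, h3⟩
    simp only [Test.Holds, h3, H.last]
    omega

/-- The memory while the priorities are drawn. -/
structure DrawInv (n K : ℕ) (I γ : ℝ) (i : ℕ) (r : ℕ → ℕ) (σ : Memory) : Prop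
    extends Base n σ where
  n3 : σ.nat 3 = i
  n5 : σ.nat 5 = 2 ^ K
  n6 : σ.nat 6 = K
  r2 : σ.real 2 = I
  r7 : σ.real 7 = γ
  prio : ∀ v < i, σ.real (v + 20) = prio n r v

/-- The hypotheses make `K` and `L` the least exponents with a power of two above the given bounds,
which is what repeated doubling finds. -/
theorem ok_paramProgram {S I : ℝ} {K L : ℕ} {σ : Memory} (H : SumInv n S I σ)
    (hK : S * I * n * n < 2 ^ K) (hK' : ∀ k < K, 2 ^ k ≤ S * I * n * n) (hL : n < 2 ^ L)
    (hL' : ∀ l < L, 2 ^ l ≤ n) :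
    Ok D paramProgram (K * 11 + L * 8 + 60) σ (DrawInv n K I (1 - 1 / (4 * L)) 0 fun _ => 0) := by
  obtain ⟨⟨b0, b1, b2, b14, c0, c3, bo⟩, n6, n7, r1, r2⟩ := H
  refine (ok_seq (T₁ := 19) (T₂ := (K * (10 + 1) + 1) + (4 + (L * (7 + 1) + 1 + 22 + 1) + 1) + 1)
    (ok_code rfl ?_)).mono (by omega) fun _ h => h
  refine ok_seq (T₁ := K * (10 + 1) + 1) (T₂ := 4 + (L * (7 + 1) + 1 + 22 + 1) + 1) ?_
  refine (ok_loop K 10 (fun k τ => Base n τ ∧ τ.nat 6 = k ∧ τ.nat 7 = 0 ∧ τ.real 2 = I ∧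
    τ.nat 5 = 2 ^ k ∧ τ.real 4 = 2 ^ k ∧ τ.real 5 = S * I * n * n) ?_ ?_ ?_).mono le_rfl ?_
  · exact ⟨⟨by simpa, by simpa, by simpa, by simpa, by simpa, by simpa, by simpa⟩, by simpa,
      by simpa, by simpa, by simp, by simp [b1], by simp [r1, r2, b0]⟩
  · rintro k hk τ ⟨⟨b0, b1, b2, b14, c0, c3, bo⟩, n6, n7, r2, n5, r4, r5⟩
    refine ⟨by simpa only [Test.Holds, r4, r5] using hK' k hk, ok_code rfl
      ⟨⟨by simpa, by simpa, by simpa, by simpa, by simpa, by simpa, by simpa⟩, by simp [n6, b1],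
      by simpa, by simpa, ?_, ?_, by simpa⟩⟩
    · simp [n5]
      ring
    · simp [r4]
      ring
  · rintro τ ⟨-, -, -, -, -, r4, r5⟩
    simpa only [Test.Holds, r4, r5, not_le] using hK
  rintro τ ⟨⟨b0, b1, b2, b14, c0, c3, bo⟩, n6, n7, r2, n5, -, -⟩
  refine ok_seq (T₁ := 4) (T₂ := L * (7 + 1) + 1 + 22 + 1) (ok_code rfl ?_)
  refine ok_seq (T₁ := L * (7 + 1) + 1) (T₂ := 22) ?_
  refine (ok_loop L 7 (fun l τ => Base n τ ∧ τ.nat 6 = K ∧ τ.nat 7 = l ∧ τ.real 2 = I ∧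
    τ.nat 5 = 2 ^ K ∧ τ.nat 8 = 2 ^ l) ?_ ?_ ?_).mono le_rfl ?_
  · exact ⟨⟨by simpa, by simpa, by simpa, by simpa, by simpa, by simpa, by simpa⟩, by simpa,
      by simpa, by simpa, by simpa, by simp⟩
  · rintro l hl τ ⟨⟨b0, b1, b2, b14, c0, c3, bo⟩, n6, n7, r2, n5, n8⟩
    refine ⟨by simpa only [Test.Holds, n8, b0] using hL' l hl, ok_code rfl
      ⟨⟨by simpa, by simpa, by simpa, by simpa, by simpa, by simpa, by simpa⟩, by simpa,
      by simp [n7, b1], by simpa, by simpa, ?_⟩⟩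
    simp [n8]
    ring
  · rintro τ ⟨H, -, -, -, -, n8⟩
    simpa only [Test.Holds, n8, H.size, not_le] using hL
  rintro τ ⟨⟨b0, b1, b2, b14, c0, c3, bo⟩, n6, n7, r2, n5, -⟩
  exact ok_code rfl ⟨⟨by simpa, by simpa, by simpa, by simpa, by simpa, by simpa, by simpa⟩,
    by simp, by simpa, by simpa, by simpa, by simp [c3, n7], fun v hv => by omega⟩

/-- The function `r`, with the values at `i, i + 1, …` replaced by those of `f`. -/
def overwrite {j m : ℕ} (r : ℕ → ℕ) (i : ℕ) (f : Fin j → Fin (m + 1)) (v : ℕ) : ℕ :=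
  if h : i ≤ v ∧ v - i < j then f ⟨v - i, h.2⟩ else r v

theorem overwrite_succ {j m : ℕ} (r : ℕ → ℕ) (i : ℕ) (f : Fin (j + 1) → Fin (m + 1)) :
    overwrite (Function.update r i (f 0)) (i + 1) (fun k => f k.succ) = overwrite r i f := by
  funext v
  unfold overwrite
  rcases lt_trichotomy v i with h | rfl | h
  · rw [dif_neg (by omega), dif_neg (by omega), Function.update_of_ne (by omega)]
  · rw [dif_neg (by omega), dif_pos (by omega), Function.update_self]
    simp
  · obtain ⟨c, rfl⟩ := Nat.exists_eq_add_of_lt h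
    by_cases hc : c < j
    · rw [dif_pos (by omega), dif_pos (by omega)]
      exact congrArg (fun k => ((f k : Fin (m + 1)) : ℕ)) (Fin.ext (by simp; omega))
    · rw [dif_neg (by omega), dif_neg (by omega), Function.update_of_ne (by omega)]

theorem DrawInv.step {K : ℕ} {I γ : ℝ} {i v : ℕ} {r : ℕ → ℕ} {σ : Memory}
    (H : DrawInv n K I γ i r σ) :
    Ok D (code [.rcast 4 9, .rcast 8 0, .rmul 4 4 8, .rcast 8 3, .radd 4 4 8, .const 9 20,
      .add 9 3 9, .rstore 9 4, .add 3 3 1]) 28 (σ.setNat 9 v)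
      (DrawInv n K I γ (i + 1) (Function.update r i v)) := by
  obtain ⟨⟨b0, b1, b2, b14, c0, c3, bo⟩, n3, n5, n6, r2, r7, hp⟩ := H
  refine ok_code rfl ⟨⟨by simpa, by simpa, by simpa, by simpa, by simp [n3, c0], by simp [n3, c3],
    by simpa⟩, by simp [n3, b1], by simpa, by simpa, by simp [n3, r2], by simp [n3, r7],
    fun w hw => ?_⟩
  rcases Nat.lt_succ_iff_lt_or_eq.1 hw with hw | rfl
  · have : w ≠ i := by omega
    simpa [n3, Clustering.prio, this] using hp w hw
  · simp [n3, Clustering.prio, b0]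

/-- Induction on the number `j` of draws left, with the rest `P` of the program as a continuation;
each draw is prepended to the tuple through `Fin.consEquiv`. -/
theorem yields_drawProgram {K m : ℕ} (hn : 1 ≤ n) (hm : m = 2 ^ K) {I γ : ℝ} {P : List Program}
    {T : ℕ} {B : Type} [Fintype B] [Nonempty B] {Q : (ℕ → ℕ) → B → Memory → Prop}
    (hP : ∀ r σ, DrawInv n K I γ n r σ → Yields D (P, σ) T B (Q r)) (j : ℕ) :
    ∀ i r σ, i + j = n → DrawInv n K I γ i r σ →
      Yields D (drawProgram :: P, σ) (T + j * 40 + 1) ((Fin j → Fin (m + 1)) × B)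
        fun p => Q (overwrite r i p.1) p.2 := by
  induction j with
  | zero =>
    intro i r σ hi H
    obtain rfl : i = n := by omega
    have hexit : ¬ (Test.le 3 2).Holds σ := by
      simp only [Test.Holds, H.n3, H.last]
      omega
    refine ((yields_of_reach (Reach.loop_exit hexit) (hP r σ H)).equiv
      (Equiv.uniqueProd B (Fin 0 → Fin (m + 1)))).mono (by omega) fun p τ h => ?_
    have e : overwrite r i p.1 = r := by
      funext v
      rw [overwrite, dif_neg (by omega)]
    rw [e]
    exact h
  | succ j ih =>
    intro i r σ hi H
    have htest : (Test.le 3 2).Holds σ := by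
      simp only [Test.Holds, H.n3, H.last]
      omega
    have hdraw : Yields D (.instr (.draw 9 5) :: code [.rcast 4 9, .rcast 8 0, .rmul 4 4 8,
        .rcast 8 3, .radd 4 4 8, .const 9 20, .add 9 3 9, .rstore 9 4, .add 3 3 1] ::
        drawProgram :: P, σ) (28 + (T + j * 40 + 1) + 1) (Fin (m + 1) × ((Fin j → Fin (m + 1)) × B))
        fun p => Q (overwrite (Function.update r i p.1) (i + 1) p.2.1) p.2.2 :=
      yields_draw (hm ▸ H.n5) fun v => yields_of_ok H.step fun τ hτ => ih (i + 1) _ τ (by omega) hτ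
    have := (yields_of_reach (Reach.loop_enter htest) (yields_seq hdraw)).equiv
      ((Equiv.prodCongr (Fin.consEquiv fun _ : Fin (j + 1) => Fin (m + 1)).symm
        (Equiv.refl B)).trans (Equiv.prodAssoc _ _ _))
    refine this.mono (by omega) fun p τ h => ?_
    have e := overwrite_succ r i p.1
    rw [← e]
    exact h

end RealRAM

/-! ### Assembling the run of the sampling program -/

namespace RealRAM

open Clustering Finset

variable {D : ℕ → ℕ → ℝ} {n : ℕ}

theorem ok_radiusProgram {K u : ℕ} {I γ : ℝ} {r : ℕ → ℕ} {σ : Memory}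
    (H : DrawInv n K I γ n r σ) :
    Ok D radiusProgram 28 (σ.setNat 9 u) fun τ =>
      Env n K (baseRadius I (2 ^ K) u) γ (prio n r) τ ∧ τ.nat 3 = 0 := by
  obtain ⟨⟨b0, b1, b2, b14, c0, c3, bo⟩, n3, n5, n6, r2, r7, hp⟩ := H
  exact ok_code rfl ⟨⟨⟨by simpa, by simpa, by simpa, by simpa, by simpa, by simpa, by simpa⟩,
    by simpa, by simpa, by simp [n5, c3, r2, baseRadius], by simpa, fun v hv => by simp [hp v hv]⟩,
    by simp⟩

theorem ok_identityProgram {K : ℕ} {R γ : ℝ} {π : ℕ → ℝ} {σ : Memory} (hn : 1 ≤ n)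
    (hE : Env n K R γ π σ) (h3 : σ.nat 3 = 0) :
    Ok D identityProgram (n * 14 + 1) σ fun τ => Env n K R γ π τ ∧ ∀ i < n, τ.nat (i + 20) = i := by
  refine (ok_loop n 13 (fun k τ => Env n K R γ π τ ∧ τ.nat 3 = k ∧ ∀ i < k, τ.nat (i + 20) = i)
    ⟨hE, h3, fun i hi => by omega⟩ ?_ ?_).mono le_rfl fun τ h => ⟨h.1, h.2.2⟩
  · rintro k hk τ ⟨hE, h3, hp⟩
    refine ⟨by simp only [Test.Holds, h3, hE.last]; omega, ok_code rfl ?_⟩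
    have hmem : [Instr.const 9 20, .add 9 3 9, .store 9 3, .add 3 3 1].foldl (Instr.det D) τ =
        (((τ.setNat 9 20).setNat 9 (k + 20)).setNat (k + 20) k).setNat 3 (k + 1) := by
      simp [h3, hE.one]
    rw [hmem]
    refine ⟨.setNat (.setNat (.setNat (.setNat hE ?_) ?_) ?_) ?_, by simp, fun i hi => ?_⟩
    iterate 4 omega
    rcases Nat.lt_succ_iff_lt_or_eq.1 hi with hi | rfl
    · simp [hp i hi]
      omega
    · simp
  · rintro τ ⟨hE, h3, -⟩
    simp only [Test.Holds, h3, hE.last]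
    omega

/-- The points in the order `p`. -/
def labels {V : Type*} (e : Fin n ≃ V) (hn : 1 ≤ n) (p : ℕ → ℕ) (i : ℕ) : V :=
  e (if h : p i < n then ⟨p i, h⟩ else ⟨0, hn⟩)

theorem symm_labels {V : Type*} (e : Fin n ≃ V) (hn : 1 ≤ n) {p : ℕ → ℕ} {i : ℕ} (h : p i < n) :
    (e.symm (labels e hn p i) : ℕ) = p i := by
  simp [labels, h]

/-- The output is a tree as it is to be built from the priorities `r` and the number `u`. -/
def Outcome {V : Type*} (D : ℕ → ℕ → ℝ) (e : Fin n ≃ V) (hn : 1 ≤ n) (K : ℕ) (I γ : ℝ)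
    (r : ℕ → ℕ) (u : ℕ) (τ : Memory) : Prop :=
  ∃ p h T,
    IsGreedyOrder (fun x y => sepLevel D (prio n r) n (baseRadius I (2 ^ K) u) x y K) n n p h ∧
    IsBuilt (labels e hn p) h γ (8 * baseRadius I (2 ^ K) u) 0 n
      (8 * (baseRadius I (2 ^ K) u * 2 ^ K)) T ∧
    τ.out = encodeTree e T

theorem yields_afterDraws {V : Type*} (e : Fin n ≃ V) (hn : 1 ≤ n) {I γ : ℝ} {K m : ℕ}
    (hm : m = 2 ^ K) (hI0 : 0 < I) (hK0 : 1 ≤ K) {r : ℕ → ℕ} {σ : Memory}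
    (H : DrawInv n K I γ n r σ) {T₁ T₂ : ℕ}
    (hT₁ : n * (n * (K * (n * 50 + 50) + 60) + 60) + 60 ≤ T₁)
    (hT₂ : 2 * n * (n * 40 + 101) + 60 ≤ T₂) :
    Yields D ([.seq (.instr (.draw 9 5))
      (.seq radiusProgram (.seq identityProgram (.seq orderProgram treeProgram)))], σ)
      (T₁ + T₂ + n * 14 + 40) (Fin (m + 1) × Unit) fun b => Outcome D e hn K I γ r b.1 := by
  have hdraw := yields_draw (D := D) (K := [.seq radiusProgram (.seq identityProgram
      (.seq orderProgram treeProgram))]) (σ := σ) (a := 9) (b := 5) (T := 28 + ((n * 14 + 1) +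
      (T₁ + (T₂ + 0) + 1) + 1) + 1) (A := Unit) (Q := fun u _ => Outcome D e hn K I γ r u)
      (H.n5.trans hm.symm) fun u => ?_
  · exact (yields_seq hdraw).mono (by omega) fun _ _ h => h
  have hR : 0 < baseRadius I (2 ^ K) u := by
    unfold baseRadius
    positivity
  refine yields_seq (yields_of_ok (ok_radiusProgram H) fun τ hτ => ?_)
  refine yields_seq (yields_of_ok (ok_identityProgram hn hτ.1 hτ.2) fun τ hτ => ?_)
  refine yields_seq (yields_of_ok ((ok_orderProgram hn hK0 hR hτ.1 hτ.2).mono hT₁ fun _ h => h) ?_)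
  rintro τ ⟨p, h, H⟩
  refine yields_of_ok ((ok_treeProgram e hn hR H fun i hi =>
    symm_labels e hn (H.greedy.lt i hi)).mono hT₂ fun _ h => h) ?_
  rintro τ ⟨T, hT, out⟩
  exact yields_halted ⟨p, h, T, H.greedy, hT, out⟩

theorem yields_afterSum {V : Type*} (e : Fin n ≃ V) (hn : 1 ≤ n) {S I : ℝ} {K L m : ℕ}
    (hm : m = 2 ^ K) (hI0 : 0 < I) (hK0 : 1 ≤ K) (hK : S * I * n * n < 2 ^ K)
    (hK' : ∀ k < K, 2 ^ k ≤ S * I * n * n) (hL : n < 2 ^ L) (hL' : ∀ l < L, 2 ^ l ≤ n)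
    {σ : Memory} (H : SumInv n S I σ) {T₁ T₂ : ℕ}
    (hT₁ : n * (n * (K * (n * 50 + 50) + 60) + 60) + 60 ≤ T₁)
    (hT₂ : 2 * n * (n * 40 + 101) + 60 ≤ T₂) :
    Yields D ([.seq paramProgram (.seq drawProgram (.seq (.instr (.draw 9 5))
      (.seq radiusProgram (.seq identityProgram (.seq orderProgram treeProgram)))))], σ)
      (K * 11 + L * 8 + 60 + (T₁ + T₂ + n * 14 + 40 + n * 40 + 1 + 1) + 1)
      ((Fin n → Fin (m + 1)) × (Fin (m + 1) × Unit)) fun p =>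
        Outcome D e hn K I (1 - 1 / (4 * L)) (overwrite (fun _ => 0) 0 p.1) p.2.1 := by
  have hparam := ok_paramProgram (D := D) H hK hK' hL hL'
  generalize K * 11 + L * 8 + 60 = T at hparam ⊢
  refine yields_seq (yields_of_ok hparam fun τ hτ => yields_seq ?_)
  have hdraw := yields_drawProgram (D := D) (I := I) (γ := 1 - 1 / (4 * L))
    (B := Fin (m + 1) × Unit)
    (Q := fun r b => Outcome D e hn K I (1 - 1 / (4 * L)) r b.1) hn hm
    (fun r σ H => yields_afterDraws e hn hm hI0 hK0 H hT₁ hT₂) n 0 (fun _ => 0) τ (zero_add n) hτ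
  exact hdraw

theorem yields_mainProgram {V : Type*} (e : Fin n ≃ V) (hn : 1 ≤ n) {S I : ℝ} {K L : ℕ}
    (hS : ∑ i ∈ range n, ∑ j ∈ range n, D i j = S)
    (hI : ∑ i ∈ range n, ∑ j ∈ range n, 1 / D i j = I) (hI0 : 0 < I)
    (hK0 : 1 ≤ K) (hK : S * I * n * n < 2 ^ K) (hK' : ∀ k < K, 2 ^ k ≤ S * I * n * n)
    (hL : n < 2 ^ L) (hL' : ∀ l < L, 2 ^ l ≤ n) :
    Yields D (initial mainProgram n) (n * (n * 17 + 12) + n * (n * (K * (n * 50 + 50) + 60) + 60) +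
        2 * n * (n * 40 + 101) + K * 11 + L * 8 + n * 54 + 300)
      ((Fin n → Fin (2 ^ K + 1)) × Fin (2 ^ K + 1)) fun ω =>
        Outcome D e hn K I (1 - 1 / (4 * L)) (drawn ω.1) ω.2 := by
  obtain ⟨m, hm⟩ : ∃ m, m = 2 ^ K := ⟨_, rfl⟩
  rw [← hm]
  obtain ⟨T₁, hT₁⟩ : ∃ T, T = n * (n * (K * (n * 50 + 50) + 60) + 60) + 60 := ⟨_, rfl⟩
  obtain ⟨T₂, hT₂⟩ : ∃ T, T = 2 * n * (n * 40 + 101) + 60 := ⟨_, rfl⟩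
  obtain ⟨T₃, hT₃⟩ : ∃ T, T = n * (n * 17 + 12) + 12 := ⟨_, rfl⟩
  have hmain := yields_seq (yields_of_ok (ok_sumProgram (D := D) hn) fun τ hτ =>
    yields_afterSum e hn hm hI0 hK0 hK hK' hL hL' (hS ▸ hI ▸ hτ) hT₁.ge hT₂.ge)
  refine (hmain.equiv (Equiv.prodCongr (Equiv.refl _) (Equiv.prodUnique _ Unit).symm)).mono
    (by omega) fun ω τ h => ?_
  have e : overwrite (fun _ => 0) 0 ω.1 = drawn ω.1 := by
    funext v
    simp [overwrite, drawn]
  rw [← e]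
  exact h

end RealRAM

/-! ## The distribution of the output -/

namespace Clustering

/-- The weights decay by less than a factor of two along every chain of forced decreases. -/
theorem half_le_decay_pow {n L s : ℕ} (hL : n < 2 ^ L) (hs : 2 * 2 ^ s ≤ n ^ 2) :
    (1 : ℝ) / 2 ≤ (1 - 1 / (4 * L)) ^ (s + 1) := by
  have h1 : 2 ^ (s + 1) < 2 ^ (L * 2) := by
    rw [pow_mul, pow_succ']
    exact hs.trans_lt (Nat.pow_lt_pow_left hL (by norm_num))
  have h2 := (Nat.pow_lt_pow_iff_right (by norm_num)).1 h1
  have hL0 : (1 : ℝ) ≤ L := by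
    exact_mod_cast (by omega : 1 ≤ L)
  have h3 : ((s + 1 : ℕ) : ℝ) ≤ L * 2 := by exact_mod_cast h2.le
  have h4 : 1 / (4 * (L : ℝ)) ≤ 1 := by
    rw [div_le_one (by positivity)]
    linarith
  -- Bernoulli's inequality: `s + 1 < 2 * L`, so the total loss is at most `2 * L / (4 * L) = 1 /
  -- 2`.
  have h5 := one_add_mul_le_pow (a := -(1 / (4 * (L : ℝ)))) (by linarith) (s + 1)
  have h6 : ((s + 1 : ℕ) : ℝ) * (1 / (4 * L)) ≤ 1 / 2 := by
    rw [mul_one_div, div_le_iff₀ (by positivity)]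
    linarith
  rw [← sub_eq_add_neg] at h5
  linarith

theorem exists_pow_two_bracket (x : ℝ) : ∃ K : ℕ, x < 2 ^ K ∧ ∀ k < K, 2 ^ k ≤ x := by
  classical
  have h := pow_unbounded_of_one_lt x (one_lt_two (α := ℝ))
  exact ⟨Nat.find h, Nat.find_spec h, fun k hk => not_lt.1 (Nat.find_min h hk)⟩

/-- The logarithm of the least power of two that exceeds `x`. -/
theorem mul_log_two_le {x : ℝ} {K : ℕ} (hK0 : 1 ≤ K) (hK : ∀ k < K, 2 ^ k ≤ x) :
    K * Real.log 2 ≤ Real.log 2 + Real.log x := by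
  obtain ⟨k, rfl⟩ := Nat.exists_eq_add_of_le' hK0
  have h := Real.log_le_log (by positivity) (hK k (by omega))
  rw [Real.log_pow] at h
  push_cast
  linarith

end Clustering

/-! ### Distance matrices and the properties of the output trees -/

namespace RealRAM

open Clustering Finset

theorem one_le_aspectRatio (V : Type*) [MetricSpace V] [Finite V] [Nontrivial V] :
    1 ≤ aspectRatio V := by
  obtain ⟨x, y, hxy⟩ := exists_pair_ne V
  rw [aspectRatio, one_le_div (Set.finite_univ.infsep_pos_iff_nontrivial.2 Set.nontrivial_univ)]
  exact (Set.infsep_le_dist_of_mem (Set.mem_univ x) (Set.mem_univ y) hxy).trans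
    (Metric.dist_le_diam_of_mem Set.finite_univ.isBounded trivial trivial)

section Matrix

variable {V : Type*} [MetricSpace V] {n : ℕ} (e : Fin n ≃ V)

theorem distMatrix_val (i j : Fin n) : distMatrix e i j = dist (e i) (e j) := by
  simp [distMatrix]

theorem distMatrix_self (i : ℕ) : distMatrix e i i = 0 := by
  simp [distMatrix]

theorem distMatrix_comm (i j : ℕ) : distMatrix e i j = distMatrix e j i := by
  unfold distMatrix
  split_ifs with h1 h2 h2
  · exact dist_comm _ _
  · exact absurd h1.symm h2
  · exact absurd h2.symm h1
  · rfl

theorem distMatrix_nonneg (i j : ℕ) : 0 ≤ distMatrix e i j := by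
  unfold distMatrix
  split_ifs <;> positivity

theorem distMatrix_triangle {i j k : ℕ} (hi : i < n) (hj : j < n) (hk : k < n) :
    distMatrix e i k ≤ distMatrix e i j + distMatrix e j k := by
  simp [distMatrix, hi, hj, hk, dist_triangle]

theorem distMatrix_pos {i j : ℕ} (hi : i < n) (hj : j < n) (hij : i ≠ j) :
    0 < distMatrix e i j := by
  simp [distMatrix, hi, hj, hij]

theorem distMatrix_le_sum {i j : ℕ} (hi : i < n) (hj : j < n) :
    distMatrix e i j ≤ ∑ i ∈ range n, ∑ j ∈ range n, distMatrix e i j :=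
  (single_le_sum (f := fun j => distMatrix e i j) (fun _ _ => distMatrix_nonneg e _ _)
    (mem_range.2 hj)).trans
    (single_le_sum (f := fun i => ∑ j ∈ range n, distMatrix e i j)
      (fun _ _ => sum_nonneg fun _ _ => distMatrix_nonneg e _ _) (mem_range.2 hi))

theorem inv_distMatrix_le_sum {i j : ℕ} (hi : i < n) (hj : j < n) :
    1 / distMatrix e i j ≤ ∑ i ∈ range n, ∑ j ∈ range n, 1 / distMatrix e i j :=
  (single_le_sum (f := fun j => 1 / distMatrix e i j)
    (fun _ _ => one_div_nonneg.2 (distMatrix_nonneg e _ _)) (mem_range.2 hj)).trans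
    (single_le_sum (f := fun i => ∑ j ∈ range n, 1 / distMatrix e i j)
      (fun _ _ => sum_nonneg fun _ _ => one_div_nonneg.2 (distMatrix_nonneg e _ _))
      (mem_range.2 hi))

/-- Each sum has `n ^ 2` terms, bounded by the diameter and by the inverse of the least distance.
This makes the number of levels `O(log n + log Δ)`. -/
theorem sum_mul_sum_le [Nontrivial V] :
    (∑ i ∈ range n, ∑ j ∈ range n, distMatrix e i j) *
      (∑ i ∈ range n, ∑ j ∈ range n, 1 / distMatrix e i j) * n * n ≤ n ^ 6 * aspectRatio V := by
  have : Finite V := .of_equiv _ e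
  have hpos : 0 < Set.infsep (Set.univ : Set V) :=
    Set.finite_univ.infsep_pos_iff_nontrivial.2 Set.nontrivial_univ
  have h1 : ∀ i ∈ range n, ∀ j ∈ range n, distMatrix e i j ≤ Metric.diam (Set.univ : Set V) := by
    intro i hi j hj
    lift i to Fin n using mem_range.1 hi
    lift j to Fin n using mem_range.1 hj
    rw [distMatrix_val]
    exact Metric.dist_le_diam_of_mem Set.finite_univ.isBounded trivial trivial
  have h2 : ∀ i ∈ range n, ∀ j ∈ range n,
      1 / distMatrix e i j ≤ 1 / Set.infsep (Set.univ : Set V) := by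
    intro i hi j hj
    lift i to Fin n using mem_range.1 hi
    lift j to Fin n using mem_range.1 hj
    rw [distMatrix_val]
    rcases eq_or_ne i j with rfl | h
    · simp [hpos.le]
    · exact one_div_le_one_div_of_le hpos
        (Set.infsep_le_dist_of_mem trivial trivial (e.injective.ne h))
  have h3 := sum_le_sum fun i hi => (sum_le_sum (h1 i hi)).trans_eq (sum_const _)
  have h4 := sum_le_sum fun i hi => (sum_le_sum (h2 i hi)).trans_eq (sum_const _)
  rw [sum_const, card_range, smul_smul, nsmul_eq_mul] at h3 h4
  push_cast at h3 h4
  have h5 := mul_le_mul h3 h4 (sum_nonneg fun _ _ => sum_nonneg fun _ _ =>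
    one_div_nonneg.2 (distMatrix_nonneg e _ _)) (by positivity)
  calc _ ≤ n * n * Metric.diam (Set.univ : Set V) *
        (n * n * (1 / Set.infsep (Set.univ : Set V))) * n * n := by gcongr
    _ = _ := by
      unfold aspectRatio
      ring

end Matrix

/-- The trees that are output have the required shape. -/
theorem Outcome.exists_tree {V : Type*} [MetricSpace V] {n : ℕ} {e : Fin n ≃ V} {hn : 1 ≤ n}
    {K : ℕ} {I γ : ℝ} {r : ℕ → ℕ} {u : ℕ} {τ : Memory}
    (H : Outcome (distMatrix e) e hn K I γ r u τ)
    (hr : ∀ v < n, ∀ w < n, prio n r v = prio n r w → v = w) (hK0 : 1 ≤ K)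
    (hR : 0 < baseRadius I (2 ^ K) u)
    (hK : ∀ i < n, ∀ j < n, distMatrix e i j ≤ baseRadius I (2 ^ K) u * 2 ^ K)
    (hγ : 1 / 2 ≤ γ) (hγ1 : γ < 1) (hγn : ∀ s, 2 * 2 ^ s ≤ n ^ 2 → 1 / 2 ≤ γ ^ (s + 1))
    {α : ℝ} (hα : 0 ≤ α) (hαγ : α * γ ≤ 1) :
    ∃ T : BinTree V, (T.IsHSBT α ∧ 2 ^ T.height ≤ 2 * n ^ 2 * 4 ^ K ∧
      (∀ x y, dist x y ≤ T.treeDist x y) ∧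
      (∀ i j : Fin n, i ≠ j → T.treeDist (e i) (e j) ≤ 8 * (baseRadius I (2 ^ K) u *
        2 ^ sepLevel (distMatrix e) (prio n r) n (baseRadius I (2 ^ K) u) i j K))) ∧
      τ.out = encodeTree e T := by
  obtain ⟨p, h, T, G, B, out⟩ := H
  set R := baseRadius I (2 ^ K) u
  set q := labels e hn p with hqdef
  have hu : ∀ x y z, sepLevel (distMatrix e) (prio n r) n R x z K ≤
      max (sepLevel (distMatrix e) (prio n r) n R x y K)
        (sepLevel (distMatrix e) (prio n r) n R y z K) := fun x y z => sepLevel_le_max K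
  have hqs : ∀ i, (hi : i < n) → q i = e ⟨p i, G.lt i hi⟩ := fun i hi => by
    simp [hqdef, labels, G.lt i hi]
  have hq : ∀ i < n, ∀ j < n, q i = q j → i = j := by
    intro i hi j hj hij
    rw [hqs i hi, hqs j hj] at hij
    exact G.inj i hi j hj (by simpa using hij)
  have hsurj : ∀ v : Fin n, ∃ i < n, p i = v := by
    intro v
    obtain ⟨i, hi⟩ := Finite.surjective_of_injective
      (f := fun i : Fin n => (⟨p i, G.lt i i.2⟩ : Fin n))
      (fun i j hij => Fin.ext (G.inj i i.2 j j.2 (by simpa using hij))) v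
    exact ⟨i, i.2, congrArg Fin.val hi⟩
  have hhK : ∀ j, 0 < j → j < n → h j < K := by
    intro j h0 hj
    rw [G.eq j h0 hj]
    rcases sepLevel_spec (D := distMatrix e) (π := prio n r) (n := n) (R := R) (x := p (j - 1))
      (y := p j) K with h | h <;> omega
  have hpw : 0 < 8 * (R * 2 ^ K) := by positivity
  have hγ0 : 0 < γ := by linarith
  have hover : T.IsOver := by
    constructor
    · rw [B.leaves_eq, List.nodup_map_iff_inj_on List.nodup_range']
      simp only [List.mem_range'_1]
      exact fun i hi j hj => hq i (by omega) j (by omega)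
    · intro x
      obtain ⟨i, hi, hp⟩ := hsurj (e.symm x)
      have hx : q i = x := by simp [hqs i hi, hp]
      rw [← hx, B.mem_leaves le_rfl hq hi]
      omega
  have key : ∀ i j, i < j → (hj : j < n) →
      distMatrix e (p i) (p j) ≤ T.treeDist (q i) (q j) ∧ T.treeDist (q i) (q j) ≤
        8 * (R * 2 ^ sepLevel (distMatrix e) (prio n r) n R (p i) (p j) K) := by
    intro i j hij hj
    constructor
    · obtain ⟨t, h1, h2, h3⟩ := G.exists_dist_le hu hij hj
      -- At the root the levels are at most `K - 1`, the potential is at most `2 * n ^ 2`, and `γ ≥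
      -- 1 / 2` secures the weight condition. Half of `A = 8 * R` is the `4 * R` that `le_sepLevel`
      -- requires.
      have h4 := B.le_treeDist le_rfl hq hγ0 hγ1 (by positivity) hγn (K - 1) n 0
        (fun j h0 hj => by have := hhK j h0 hj; omega) (fun j _ hj _ => by omega)
        (by
          simp only [Nat.sub_zero, pow_zero, mul_one]
          rw [max_eq_left (by omega)]
          exact (by ring : n * (2 * n) = 2 * n ^ 2).le)
        (by
          obtain ⟨K, rfl⟩ := Nat.exists_eq_add_of_le' hK0
          rw [Nat.add_sub_cancel, pow_zero, mul_one, pow_succ]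
          nlinarith [show 0 < R * 2 ^ K by positivity])
        (Nat.zero_le i) h1 h2 hj
      have h5 := le_sepLevel (π := prio n r) hR.le (fun i _ => distMatrix_self e i)
        (fun i _ j _ => distMatrix_comm e i j)
        (fun i hi j hj k hk => distMatrix_triangle e hi hj hk) hr hK (G.lt i (by omega)) (G.lt j hj)
      have h6 : R * 2 ^ sepLevel (distMatrix e) (prio n r) n R (p i) (p j) K ≤ R * 2 ^ h t := by
        gcongr
        norm_num
      linarith
    · obtain ⟨t, h1, h2, h3⟩ := B.treeDist_le le_rfl hq (Nat.zero_le i) hij hj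
      have h4 := G.le_dist (fun x y => sepLevel_comm K) hu h1 h2 hj
      refine h3.trans ?_
      rw [mul_assoc]
      gcongr
      norm_num
  have key' : ∀ i j : Fin n, i ≠ j →
      dist (e i) (e j) ≤ T.treeDist (e i) (e j) ∧ T.treeDist (e i) (e j) ≤
        8 * (R * 2 ^ sepLevel (distMatrix e) (prio n r) n R i j K) := by
    intro x y hxy
    obtain ⟨i, hi, hpi⟩ := hsurj x
    obtain ⟨j, hj, hpj⟩ := hsurj y
    have hx : q i = e x := by simp [hqs i hi, hpi]
    have hy : q j = e y := by simp [hqs j hj, hpj]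
    rw [← distMatrix_val]
    rcases lt_trichotomy i j with h | rfl | h
    · have := key i j h hj
      rwa [hpi, hpj, hx, hy] at this
    · exact absurd (Fin.ext (hpi.symm.trans hpj)) hxy
    · have := key j i h hi
      rwa [hpi, hpj, hx, hy, distMatrix_comm, sepLevel_comm, BinTree.treeDist_comm] at this
  refine ⟨T, ⟨⟨hover, (B.weight_le hγ0 hγ1 (by positivity) hpw).2.2,
    B.isSeparated hγ0 hγ1 (by positivity) hpw hα hαγ⟩, ?_, fun x y => ?_,
    fun i j hij => (key' i j hij).2⟩, out⟩
  · have := B.pow_height_le K n hhK fun j _ hj _ => by omega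
    rw [Nat.sub_zero, max_eq_left (by omega)] at this
    exact this.trans_eq (by ring)
  · rcases eq_or_ne x y with rfl | h
    · rw [dist_self, BinTree.treeDist_self (hover.2 x)]
    · have := (key' (e.symm x) (e.symm y) (e.symm.injective.ne h)).1
      simpa using this

end RealRAM

/-! ### Expectation, running time and the choice of constants -/

namespace RealRAM

open Clustering Finset

theorem tsum_map_uniform_le {A X : Type*} [Fintype A] [Nonempty A] (t : A → X) (f : X → ℝ) (b : ℝ)
    (hf : ∀ a, 0 ≤ f (t a)) (h : ∑ a, f (t a) ≤ Fintype.card A * b) :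
    ∑' x, ((PMF.uniformOfFintype A).map t) x * ENNReal.ofReal (f x) ≤ ENNReal.ofReal b := by
  classical
  have h1 : ∑' x, ((PMF.uniformOfFintype A).map t) x * ENNReal.ofReal (f x) =
      ∑ a, (Fintype.card A : ENNReal)⁻¹ * ENNReal.ofReal (f (t a)) := by
    simp only [PMF.map_apply, PMF.uniformOfFintype_apply, ← ENNReal.tsum_mul_right]
    rw [ENNReal.tsum_comm, tsum_fintype]
    refine sum_congr rfl fun a _ => ?_
    rw [tsum_eq_single (t a) fun x hx => by simp [hx]]
    simp
  rw [h1, ← mul_sum, ← ENNReal.ofReal_sum_of_nonneg fun a _ => hf a]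
  calc _ ≤ (Fintype.card A : ENNReal)⁻¹ * ENNReal.ofReal (Fintype.card A * b) := by gcongr
    _ = _ := by
      rw [ENNReal.ofReal_mul (by positivity), ENNReal.ofReal_natCast, ← mul_assoc,
        ENNReal.inv_mul_cancel (by simp) (by simp), one_mul]

/-- A program drawing uniformly at random and then writing a tree samples a distribution. -/
theorem exists_samples {V : Type*} [MetricSpace V] {n : ℕ} {e : Fin n ≃ V} {M : Program} {T : ℕ}
    {A : Type} [Fintype A] [Nonempty A] {Q : A → BinTree V → Prop}
    (h : Yields (distMatrix e) (initial M n) T A fun a τ => ∃ t, Q a t ∧ τ.out = encodeTree e t) :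
    ∃ t : A → BinTree V, (∀ a, Q a (t a)) ∧
      ∀ T' ≥ T, Samples M e ((PMF.uniformOfFintype A).map t) T' := by
  obtain ⟨G, hG, hrun⟩ := h
  choose t ht out using hG
  refine ⟨t, ht, fun T' hT' => ?_⟩
  unfold Samples
  rw [run_eq_runFrom, hrun T' hT', PMF.map_comp, PMF.map_comp]
  refine ⟨fun κ hκ => ?_, congrArg (fun f => (PMF.uniformOfFintype A).map f) (funext out)⟩
  rw [PMF.mem_support_map_iff] at hκ
  obtain ⟨a, -, rfl⟩ := hκ
  rfl

theorem time_le {n K L Y : ℕ} (hn : n ≤ Y) (hK : K ≤ 11 * Y) (hL : L ≤ Y) :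
    n * (n * 17 + 12) + n * (n * (K * (n * 50 + 50) + 60) + 60) + 2 * n * (n * 40 + 101) + K * 11 +
      L * 8 + n * 54 + 300 ≤ 2000 * (Y + 1) ^ 4 := by
  calc _ ≤ Y * (Y * 17 + 12) + Y * (Y * (11 * Y * (Y * 50 + 50) + 60) + 60) +
        2 * Y * (Y * 40 + 101) + 11 * Y * 11 + Y * 8 + Y * 54 + 300 := by gcongr
    _ ≤ 2000 * (Y + 1) ^ 4 := by
      have : 2000 * (Y + 1) ^ 4 = Y * (Y * 17 + 12) +
          Y * (Y * (11 * Y * (Y * 50 + 50) + 60) + 60) + 2 * Y * (Y * 40 + 101) + 11 * Y * 11 +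
          Y * 8 + Y * 54 + 300 +
          (1450 * Y ^ 4 + 7450 * Y ^ 3 + 11843 * Y ^ 2 + 7543 * Y + 1700) := by
        ring
      omega

theorem exists_distribution {n : ℕ} (hn : 2 ≤ n) {V : Type*} [MetricSpace V] (e : Fin n ≃ V) :
    ∃ P : PMF (BinTree V),
      P.support ⊆ BinTree.dominatingHSBTs V (1 + 1 / 12 / Real.log n)
        (400 * (Real.log (aspectRatio V) + Real.log n)) ∧
      (∀ x y : V, ∑' T : BinTree V, P T * ENNReal.ofReal (T.treeDist x y) ≤
        ENNReal.ofReal (400 * Real.log n * dist x y)) ∧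
      Samples mainProgram e P (2000 * (n + ⌈Real.log (aspectRatio V)⌉₊ + 1) ^ 4) := by
  have hn1 : 1 ≤ n := by omega
  have : Nontrivial (Fin n) := Fin.nontrivial_iff_two_le.2 hn
  have : Nontrivial V := e.symm.nontrivial
  have : Finite V := .of_equiv _ e
  have hn2 : (2 : ℝ) ≤ n := by exact_mod_cast hn
  have hlog2 := Real.log_two_gt_d9
  have hlogn : Real.log 2 ≤ Real.log n := Real.log_le_log (by norm_num) hn2
  have hΔ := Real.log_nonneg (one_le_aspectRatio V)
  obtain ⟨S, hS⟩ : ∃ S, ∑ i ∈ range n, ∑ j ∈ range n, distMatrix e i j = S := ⟨_, rfl⟩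
  obtain ⟨I, hI⟩ : ∃ I, ∑ i ∈ range n, ∑ j ∈ range n, 1 / distMatrix e i j = I := ⟨_, rfl⟩
  have hDS : ∀ i < n, ∀ j < n, distMatrix e i j ≤ S := fun i hi j hj =>
    hS ▸ distMatrix_le_sum e hi hj
  have hDI : ∀ i < n, ∀ j < n, i ≠ j → 1 ≤ I * distMatrix e i j := fun i hi j hj hij => by
    rw [← div_le_iff₀ (distMatrix_pos e hi hj hij), ← hI]
    exact inv_distMatrix_le_sum e hi hj
  have h01 := distMatrix_pos e (show 0 < n by omega) (show 1 < n by omega) zero_ne_one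
  have hI0 : 0 < I := by
    have := hDI 0 (by omega) 1 (by omega) zero_ne_one
    exact pos_of_mul_pos_left (by linarith) h01.le
  have hSI : 1 ≤ S * I := (hDI 0 (by omega) 1 (by omega) zero_ne_one).trans <| by
    rw [mul_comm]
    exact mul_le_mul_of_nonneg_right (hDS 0 (by omega) 1 (by omega)) hI0.le
  have hS0 : 0 < S := h01.trans_le (hDS 0 (by omega) 1 (by omega))
  -- The extra factor `n * n` guarantees `n ^ 2 ≤ 2 ^ K`, which controls ties among the draws, and
  -- absorbs the `1 / 4` in `baseRadius` so that the top radius exceeds all distances.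
  obtain ⟨K, hK, hK'⟩ := exists_pow_two_bracket (S * I * n * n)
  obtain ⟨L, hL, hL'⟩ := exists_pow_two_bracket n
  have hnK : (n : ℝ) * n ≤ S * I * n * n := by
    rw [mul_assoc (S * I)]
    exact le_mul_of_one_le_left (by positivity) hSI
  have hK0 : 1 ≤ K := by
    by_contra! h
    obtain rfl : K = 0 := by omega
    nlinarith
  have hL0 : 1 ≤ L := by
    by_contra! h
    obtain rfl : L = 0 := by omega
    linarith
  have hnK2 : n ^ 2 ≤ 2 ^ K := by
    have : (n : ℝ) * n ≤ 2 ^ K := hnK.trans hK.le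
    rw [pow_two]
    exact_mod_cast this
  have hnL : n < 2 ^ L := by exact_mod_cast hL
  have hnL' : ∀ l < L, 2 ^ l ≤ n := fun l hl => by exact_mod_cast hL' l hl
  have hKlog : K * Real.log 2 ≤ 7 * Real.log n + Real.log (aspectRatio V) := by
    have h1 := mul_log_two_le hK0 hK'
    have h2 : S * I * n * n ≤ n ^ 6 * aspectRatio V := hS ▸ hI ▸ sum_mul_sum_le e
    have h3 := Real.log_le_log (by positivity) h2
    rw [Real.log_mul (x := n ^ 6) (by positivity) (by linarith [one_le_aspectRatio V]),
      Real.log_pow] at h3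
    push_cast at h3
    linarith
  have hLlog := mul_log_two_le hL0 hL'
  have hLn : (L : ℝ) ≤ 3 * Real.log n := by nlinarith
  have hL1 : (1 : ℝ) ≤ L := by exact_mod_cast hL0
  have hLY : L ≤ n := by
    by_contra! h
    exact (hnL' n h).not_gt Nat.lt_two_pow_self
  have hKY : K ≤ 11 * (n + ⌈Real.log (aspectRatio V)⌉₊) := by
    have h1 := Nat.le_ceil (Real.log (aspectRatio V))
    have h2 := Real.log_le_self (show (0 : ℝ) ≤ n by positivity)
    have : (K : ℝ) ≤ 11 * (n + ⌈Real.log (aspectRatio V)⌉₊) := by nlinarith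
    exact_mod_cast this
  have hγ : 1 / (4 * (L : ℝ)) ≤ 1 / 4 := by
    apply one_div_le_one_div_of_le <;> linarith
  have hγ0 : 0 < 1 / (4 * (L : ℝ)) := by positivity
  -- The constant `1 / 12` comes from `L ≤ 3 * log n`; with `x = 1 / (4 * L)` the product `α * γ` is
  -- at most `(1 + x) * (1 - x) ≤ 1`.
  have hα : 1 / 12 / Real.log n ≤ 1 / (4 * L) := by
    rw [div_div]
    apply one_div_le_one_div_of_le <;> linarith
  have hα0 : 0 ≤ 1 / 12 / Real.log n := div_nonneg (by norm_num) (by linarith)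
  have hR : ∀ u : ℕ, 1 / I / 4 ≤ baseRadius I (2 ^ K) u := fun u => by
    unfold baseRadius
    gcongr
    exact le_add_of_nonneg_left (by positivity)
  have hR0 : ∀ u : ℕ, 0 < baseRadius I (2 ^ K) u := fun u => lt_of_lt_of_le (by positivity) (hR u)
  have hRK : ∀ u : ℕ, ∀ i < n, ∀ j < n, distMatrix e i j ≤ baseRadius I (2 ^ K) u * 2 ^ K := by
    intro u i hi j hj
    calc distMatrix e i j ≤ S := hDS i hi j hj
      _ ≤ S * (n * n / 4) := le_mul_of_one_le_right hS0.le (by nlinarith)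
      _ = 1 / I / 4 * (S * I * n * n) := by field_simp
      _ ≤ baseRadius I (2 ^ K) u * 2 ^ K := mul_le_mul (hR u) hK.le (by positivity) (hR0 u).le
  have hyields := (yields_mainProgram e hn1 hS hI hI0 hK0 hK hK' hnL hnL').mono le_rfl
    fun ω τ h => h.exists_tree (fun v hv w hw => prio_inj hw hv) hK0 (hR0 _) (hRK _) (by linarith)
      (by linarith) (fun s hs => half_le_decay_pow hnL hs)
      (α := 1 + 1 / 12 / Real.log n) (by linarith) (by nlinarith)
  obtain ⟨t, ht, hsample⟩ := exists_samples hyields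
  refine ⟨_, ?_, fun x y => ?_,
    hsample _ (time_le (Nat.le_add_right _ _) hKY (hLY.trans (Nat.le_add_right _ _)))⟩
  · intro T hT
    rw [PMF.mem_support_map_iff] at hT
    obtain ⟨ω, -, rfl⟩ := hT
    obtain ⟨h1, h2, h3, -⟩ := ht ω
    refine ⟨h1, ?_, h3⟩
    have h4 : (2 : ℝ) ^ (t ω).height ≤ 2 * n ^ 2 * (2 ^ K) ^ 2 := by
      rw [← pow_mul, mul_comm K, pow_mul]
      norm_num
      exact_mod_cast h2
    have h5 := Real.log_le_log (by positivity) h4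
    rw [Real.log_mul (by positivity) (by positivity), Real.log_mul (by positivity) (by positivity),
      Real.log_pow, Real.log_pow, Real.log_pow, Real.log_pow] at h5
    push_cast at h5
    nlinarith
  · refine tsum_map_uniform_le t (fun T => T.treeDist x y) _
      (fun ω => dist_nonneg.trans ((ht ω).2.2.1 x y)) ?_
    rcases eq_or_ne x y with rfl | hxy
    · refine (sum_eq_zero fun ω _ => BinTree.treeDist_self ((ht ω).1.isOver.2 x)).trans_le ?_
      simp
    obtain ⟨i, rfl⟩ := e.surjective x
    obtain ⟨j, rfl⟩ := e.surjective y
    have hij : i ≠ j := fun h => hxy (congrArg e h)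
    have hsum := sum_sepLevel_le hI0 hnK2 (fun i _ => distMatrix_self e i)
      (fun i _ j _ => distMatrix_comm e i j)
      (fun i hi j hj k hk => distMatrix_triangle e hi hj hk) i.2 j.2
      (hDI i i.2 j j.2 fun h => hij (Fin.ext h))
    refine (sum_le_sum fun ω _ => (ht ω).2.2.2 i j hij).trans ?_
    rw [← mul_sum]
    refine (mul_le_mul_of_nonneg_left hsum (by norm_num)).trans ?_
    -- The additive `160` is absorbed because `log n ≥ log 2 > 0.69`.
    have hcoef : 8 * (20 + 16 * Real.log n) ≤ 400 * Real.log n := by linarith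
    rw [distMatrix_val, mul_left_comm, ← mul_assoc 8]
    exact mul_le_mul_of_nonneg_left (mul_le_mul_of_nonneg_right hcoef dist_nonneg)
      (Nat.cast_nonneg _)

end RealRAM

theorem mainTheorem5 :
    ∃ (c C : ℝ) (M : RealRAM.Program) (q : Polynomial ℕ), 0 < c ∧ 0 < C ∧
      ∀ (n : ℕ), 2 ≤ n → ∀ (V : Type*) [MetricSpace V] (e : Fin n ≃ V),
        ∃ P : PMF (BinTree V),
          P.support ⊆ BinTree.dominatingHSBTs V (1 + c / Real.log n)
            (C * (Real.log (aspectRatio V) + Real.log n)) ∧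
          (∀ x y : V, ∑' T : BinTree V, P T * ENNReal.ofReal (T.treeDist x y) ≤
            ENNReal.ofReal (C * Real.log n * dist x y)) ∧
          RealRAM.Samples M e P (q.eval (n + ⌈Real.log (aspectRatio V)⌉₊)) := by
  refine ⟨1 / 12, 400, RealRAM.mainProgram, 2000 * (Polynomial.X + 1) ^ 4, by norm_num, by norm_num,
    fun n hn V _ e => ?_⟩
  have h : (2000 * (Polynomial.X + 1) ^ 4 : Polynomial ℕ).eval
      (n + ⌈Real.log (aspectRatio V)⌉₊) = 2000 * (n + ⌈Real.log (aspectRatio V)⌉₊ + 1) ^ 4 := by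
    simp
  rw [h]
  exact RealRAM.exists_distribution hn e
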